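/- **Setting.** Let $\Lambda=\{a,a+1,\dots,b\}\times[s,t]$ ($a\le b$ integers, $s\le t$ reals) be a box of $\mathbb Z\times\mathbb R$ with top/bottom periodic boundary condition, that is, $(x,s)$ and $(x,t)$ are identified for every $x$. Let $\lambda,\delta\in(0,\infty)$. Under $\mathbb P_{\Lambda,\lambda,\delta}$ there are independent Poisson processes of deaths, with intensity $\delta$ on each time-line $\{x\}\times[s,t]$, and of bridges, with intensity $\lambda$ between each pair of neighbouring time-lines of $\Lambda$; a bridge at time $u$ between $x$ and $x+1$ is the unit segment joining $(x,u)$ and $(x+1,u)$. A path of $\Lambda$ is a finite alternating sequence of closed intervals of time-lines and horizontal unit segments joining neighbouring time-lines; it is open in a configuration $\omega$ if its intervals contain no death and its horizontal segments are bridges of $\omega$. Write $x\leftrightarrow y$ if there is an open path from $x$ to $y$, and $S\leftrightarrow T$ if $x\leftrightarrow y$ for some $x\in S$, $y\in T$. Clusters are the classes of points connected by $\leftrightarrow$ (deaths belong to no cluster). The set $\Sigma_S$ consists of the restrictions to $S\subseteq\Lambda$ of the functions $\sigma:\Lambda\to\{-1,+1\}$ that are constant along the (periodic) time-lines off some finite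 set of points. A subset $D$ of $\Lambda$ is linear if it is a finite union of closed intervals of time-lines (equivalently, the trace on $\Lambda$ of a finite disjoint union of paths and circuits), and it separates $\Delta$ and $\Gamma$ if every path of $\Lambda$ from $\Delta$ to $\Gamma$ passes through $D$. For $\Delta,\Gamma\subseteq\Lambda$, let $\overline\phi$ be the wired random-cluster measure with density proportional to $2^{k(\omega)}$ with respect to $\mathbb P_{\Lambda,\lambda,\delta}$, where all the clusters that intersect $\Delta\cup\Gamma$ count only $1$ in total towards the number $k(\omega)$ of clusters. For $\tau\in\Sigma_\Gamma$ let $T_i=\{x\in\Gamma:\tau(x)=i\}$, $i=\pm1$, and let $\phi^\tau_\Lambda$ be the random-cluster measure with density proportional to $2^{k(\omega)}$, where all the clusters that intersect $\Gamma$ count only $1$ in total, conditioned on the event $T_{1}\nleftrightarrow T_{-1}$. (If the finite set $\overline{T_1}\cap\overline{T_{-1}}$ is non-empty, closures being taken in the periodic time-lines, this event is null; $\phi_\Lambda^\tau$ is then the measure obtained by the same recipe after adding to $\omega$ a death at each point of $\overline{T_1}\cap\overline{T_{-1}}$.) Under $\phi_\Lambda^\tau$, spins $\sigma$ are allocated to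 clusters: those that intersect $\Gamma$ receive the spin given by $\tau$, and the others receive independent spins uniform on $\{-1,+1\}$. **Theorem (Ratio weak-mixing).** Let $\Gamma\subseteq\Lambda$ be measurable, let $\Delta\subseteq\Lambda$ be finite with $\Delta\cap\Gamma=\varnothing$, and let $D$ be a linear subset of $\Lambda$ that separates $\Delta$ and $\Gamma$. Let $$t_1=\overline\phi(\Delta\leftrightarrow D),\qquad t_2=\sqrt{\overline\phi(D\leftrightarrow\Gamma)} .$$ If $t_1+2t_2<1$ and $$2\Bigl(t_1+2t_2+\frac{t_1+t_2}{1-t_1-2t_2}\Bigr)\le 1,$$ then, for all $\tau,\tau'\in\Sigma_\Gamma$ and $\alpha\in\Sigma_\Delta$, $\phi_\Lambda^{\tau'}(\sigma_\Delta=\alpha)>0$ and $$\left|\frac{\phi_\Lambda^{\tau}(\sigma_\Delta=\alpha)}{\phi_\Lambda^{\tau'}(\sigma_\Delta=\alpha)}-1\right|\le 2\left(t_1+2t_2+\frac{t_1+t_2}{1-t_1-2t_2}\right).$$ -/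

import Mathlib

open MeasureTheory ProbabilityTheory
open scoped ENNReal

/-- The space-time `ℤ × ℝ`: a site together with a time. -/
abbrev Pt : Type := ℤ × ℝ

/-- A box `{a, …, b} × [s, t]` of `ℤ × ℝ`. -/
structure Box where
  a : ℤ
  b : ℤ
  s : ℝ
  t : ℝ
  hab : a ≤ b
  hst : s ≤ t

namespace Box

/-- The points of the box. -/
def carrier (Λ : Box) : Set Pt :=
  {p | Λ.a ≤ p.1 ∧ p.1 ≤ Λ.b ∧ Λ.s ≤ p.2 ∧ p.2 ≤ Λ.t}

/-- The top/bottom periodic boundary condition: `(x, s)` and `(x, t)` are identified. -/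
def Glued (Λ : Box) (p q : Pt) : Prop :=
  p.1 = q.1 ∧ ((p.2 = Λ.s ∧ q.2 = Λ.t) ∨ (p.2 = Λ.t ∧ q.2 = Λ.s))

/-- All representatives, under the top/bottom identification, of the points of `S`. -/
def sat (Λ : Box) (S : Set Pt) : Set Pt :=
  {p | p ∈ S ∨ ∃ q ∈ S, Λ.Glued p q}

/-- One step along a path of the box that contains no point of `dead` and uses only the
horizontal unit segments in `br`; here `(x, u) ∈ br` stands for the segment with endpoints
`(x, u)` and `(x + 1, u)`. The step traverses an interval of a time-line (possibly a single
point), or a horizontal segment, or passes between two identified points. -/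
def Step (Λ : Box) (dead br : Set Pt) (p q : Pt) : Prop :=
  p ∈ Λ.carrier ∧ q ∈ Λ.carrier ∧ p ∉ dead ∧ q ∉ dead ∧
    ((p.1 = q.1 ∧ ∀ u ∈ Set.uIcc p.2 q.2, (p.1, u) ∉ dead) ∨
      (p.2 = q.2 ∧ ((q.1 = p.1 + 1 ∧ p ∈ br) ∨ (p.1 = q.1 + 1 ∧ q ∈ br))) ∨
      Λ.Glued p q)

/-- `p ↔ q`: there is a path from `p` to `q` avoiding `dead` and using horizontal segments
in `br` only. In particular `p ↔ p` iff `p` is a point of the box outside `dead`. -/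
def Conn (Λ : Box) (dead br : Set Pt) : Pt → Pt → Prop :=
  Relation.TransGen (Λ.Step dead br)

/-- `S ↔ T`: some point of `S` is connected to some point of `T`. -/
def ConnSets (Λ : Box) (dead br S T : Set Pt) : Prop :=
  ∃ p ∈ S, ∃ q ∈ T, Λ.Conn dead br p q

/-- A linear subset of the box. A path or circuit meets the time-lines in finitely many
disjoint closed intervals, and a single interval is itself a path; so the sets
obtained on `Λ` from finite disjoint unions of paths and circuits are exactly the finite unions
of closed intervals of time-lines. -/
def IsLinear (Λ : Box) (D : Set Pt) : Prop :=
  ∃ I : Finset (ℤ × ℝ × ℝ),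
    (∀ i ∈ I, i.2.1 ≤ i.2.2 ∧ (i.1, i.2.1) ∈ Λ.carrier ∧ (i.1, i.2.2) ∈ Λ.carrier) ∧
      D = {p | ∃ i ∈ I, p.1 = i.1 ∧ p.2 ∈ Set.Icc i.2.1 i.2.2}

/-- `D` separates `S` and `T`: every path of the box from `S` to `T` (with all horizontal
segments available) passes through `D`. -/
def Separates (Λ : Box) (D S T : Set Pt) : Prop :=
  ¬ Λ.ConnSets (Λ.sat D) Set.univ S T

/-- The clusters of the configuration with deaths `dead` and bridges `br`. -/
def clusters (Λ : Box) (dead br : Set Pt) : Set (Set Pt) :=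
  {C | ∃ p, Λ.Conn dead br p p ∧ C = {q | Λ.Conn dead br p q}}

open Classical in
/-- The cluster count in which all clusters that meet `W` count only `1` in total. -/
noncomputable def clusterCount (Λ : Box) (dead br W : Set Pt) : ℕ :=
  {C ∈ Λ.clusters dead br | Disjoint C W}.ncard + if W.Nonempty then 1 else 0

/-- The spin-configurations of `Λ`, restricted to `S`: there are finitely many points off
which the spin is constant along (periodic) time-lines. The value at a
point where the spin jumps is unrestricted. -/
def spinConfigs (Λ : Box) (S : Set Pt) : Set (Pt → ℤˣ) :=
  {τ | ∃ σ : Pt → ℤˣ, Set.EqOn τ σ S ∧ (∀ p q, Λ.Glued p q → σ p = σ q) ∧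
    ∃ J : Set Pt, J.Finite ∧ ∀ p q, Λ.Conn J ∅ p q → σ p = σ q}

end Box

/-- Finite families of points of `X`, listed with arbitrary labels. -/
abbrev PointList (X : Type) : Type := Σ n : ℕ, (Fin n → X)

/-- The finite set of points in a family. -/
def PointList.points {X : Type} (c : PointList X) : Set X := Set.range c.2

/-- The Poisson process with finite intensity measure `μ`: the number of points has the Poisson
distribution with parameter `μ(X)`, and given this number the points are independent with law
`μ / μ(X)`. -/
noncomputable def poissonProcess {X : Type} [MeasurableSpace X] (μ : Measure X) :
    Measure (PointList X) :=
  Measure.sum fun n : ℕ =>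
    ENNReal.ofReal (Real.exp (-(μ Set.univ).toReal) / (n.factorial : ℝ)) •
      (Measure.pi fun _ : Fin n => μ).map (Sigma.mk n)

/-- A configuration: a finite family of deaths and a finite family of bridges. -/
abbrev Config : Type := PointList Pt × PointList Pt

/-- The deaths `(x, u)` of a configuration. -/
def Config.deaths (ω : Config) : Set Pt := ω.1.points

/-- The bridges of a configuration; `(x, u)` is the bridge joining `(x, u)` and `(x + 1, u)`. -/
def Config.bridges (ω : Config) : Set Pt := ω.2.points

/-- One-dimensional Lebesgue measure on `ℤ × ℝ`. -/
noncomputable def lineMeasure : Measure Pt := (Measure.count : Measure ℤ).prod volume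

namespace Box

/-- The continuum percolation measure on the box: independent Poisson processes of deaths
(intensity `del`, on the time-lines `a, …, b`) and of bridges (intensity `lam`, between
neighbouring time-lines of the box). -/
noncomputable def percolation (Λ : Box) (lam del : ℝ) : Measure Config :=
  (poissonProcess (ENNReal.ofReal del • lineMeasure.restrict Λ.carrier)).prod
    (poissonProcess
      (ENNReal.ofReal lam • lineMeasure.restrict {p | p ∈ Λ.carrier ∧ p.1 < Λ.b}))

/-- The (unnormalized) `q = 2` random-cluster measure, with extra deaths forced at the points
of `J`, and the clusters that meet `W` counted as one. -/
noncomputable def rcWeight (Λ : Box) (lam del : ℝ) (J W : Set Pt) : Measure Config :=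
  (Λ.percolation lam del).withDensity fun ω =>
    (2 : ℝ≥0∞) ^ Λ.clusterCount (ω.deaths ∪ J) ω.bridges W

/-- The wired random-cluster probability measure: the clusters that meet `W` count as one. -/
noncomputable def wired (Λ : Box) (lam del : ℝ) (W : Set Pt) : Measure Config :=
  (Λ.rcWeight lam del ∅ W Set.univ)⁻¹ • Λ.rcWeight lam del ∅ W

/-- The part of `Γ` on which the boundary condition `τ` has value `i`. -/
def spinPart (Γ : Set Pt) (τ : Pt → ℤˣ) (i : ℤˣ) : Set Pt := {p ∈ Γ | τ p = i}

/-- The jumps of the boundary condition `τ` on `Γ` whose position is determined by `τ`: the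
points of the (periodic) time-lines in the closure of both spin parts. Every configuration
compatible with `τ` has a death at each of them. -/
def forcedJumps (Λ : Box) (Γ : Set Pt) (τ : Pt → ℤˣ) : Set Pt :=
  Λ.sat (closure (spinPart Γ τ 1)) ∩ Λ.sat (closure (spinPart Γ τ (-1)))

/-- The deaths of `ω` together with those forced by the boundary condition. -/
def deathsWith (Λ : Box) (Γ : Set Pt) (τ : Pt → ℤˣ) (ω : Config) : Set Pt :=
  ω.deaths ∪ Λ.forcedJumps Γ τ

/-- The random-cluster measure with spin boundary condition `τ` on `Γ`: clusters that meet `Γ`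
count as one, and we condition on there being no connection between the two spin parts of `Γ`.
If `τ` has no forced jump, then no death is added and the conditioning event has positive
probability. Otherwise that event is null for the Poisson process, and the conditional
measure is given by placing a death at each forced jump (the law of a Poisson process
given that it has points at these places being that of the process with the points added). -/
noncomputable def boundaryMeasure (Λ : Box) (lam del : ℝ) (Γ : Set Pt) (τ : Pt → ℤˣ) :
    Measure Config :=
  cond (Λ.rcWeight lam del (Λ.forcedJumps Γ τ) Γ)
    {ω | ¬ Λ.ConnSets (Λ.deathsWith Γ τ ω) ω.bridges (spinPart Γ τ 1) (spinPart Γ τ (-1))}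

/-- The allocations of spins to the clusters of `ω` in which each cluster that meets `Γ`
takes the spin prescribed by `τ`. -/
def SpinAlloc (Λ : Box) (Γ : Set Pt) (τ : Pt → ℤˣ) (ω : Config) : Type :=
  {f : Λ.clusters (Λ.deathsWith Γ τ ω) ω.bridges → ℤˣ // ∀ C, ∀ p ∈ C.1 ∩ Γ, f C = τ p}

/-- The conditional probability, given `ω`, that `σ_Δ = α`, when the spin allocation is uniform
on `SpinAlloc`: clusters meeting `Γ` take the spin given by `τ`, and the others
receive independent uniform spins. -/
noncomputable def spinProbGiven (Λ : Box) (Γ : Set Pt) (τ : Pt → ℤˣ) (Δ : Set Pt)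
    (α : Pt → ℤˣ) (ω : Config) : ℝ≥0∞ :=
  (Nat.card {f : Λ.SpinAlloc Γ τ ω // ∀ C, ∀ p ∈ C.1 ∩ Δ, f.1 C = α p} : ℝ≥0∞) /
    (Nat.card (Λ.SpinAlloc Γ τ ω) : ℝ≥0∞)

/-- The probability of `σ_Δ = α` under the spin boundary condition `τ` on `Γ`. -/
noncomputable def spinProb (Λ : Box) (lam del : ℝ) (Γ : Set Pt) (τ : Pt → ℤˣ) (Δ : Set Pt)
    (α : Pt → ℤˣ) : ℝ :=
  (∫⁻ ω, Λ.spinProbGiven Γ τ Δ α ω ∂(Λ.boundaryMeasure lam del Γ τ)).toReal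

/-- The probability of `S ↔ T` under the random-cluster measure wired on `W`. -/
noncomputable def wiredConnProb (Λ : Box) (lam del : ℝ) (W S T : Set Pt) : ℝ :=
  (Λ.wired lam del W {ω | Λ.ConnSets ω.deaths ω.bridges S T}).toReal

end Box

/-! Put `W = Δ ∪ Γ` and integrate `2 ^ (number of clusters not meeting W)` over events. The number
of spin allocations compatible with `τ` equals the random-cluster density up to a constant, so the
spins can be summed out: the probability of `α` is `i(α) / ∑ i(α')`, where `i(α)` is the integral
(`rcInt`) of the event that no open path joins a `+1` point of `Δ ∪ Γ` to a `-1` point, deaths being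
forced at the jumps that `τ` determines.

Let `A` be the compatibility of `α` on `Δ`, `B` that of `τ` on `Γ`, and `G` the event that `D` is
not connected to `Γ`. Let `a`, `β`, `g` be their integrals (`β` with the forced deaths) and `Z` the
total mass without forced deaths. All three events are decreasing. Explore the clusters of `Γ`. On
`G` they do not reach `Δ`, so the joint event is `A ∩ B`, where `B` is seen by the exploration and
`A` depends only on the rest. Given the explored part, `A` has conditional probability at least `a /
Z`; with FKG for `B` and `G` this yields the lower bound `a β g ≤ Z² i`. For the upper bound, call
an outcome tame if `G` holds and the conditional probability of `A` is at most `(1 + s) a / Z`. A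
Markov argument shows that the mass `h` of tame outcomes satisfies `(1 + s) g ≤ s h + Z`. Tameness
is decreasing, since a smaller explored set makes `A` less likely, so FKG for the joint event and
tameness yields `i h ≤ (1 + s) a β`. This is `rcInt_screening`.

With `t = t₂`, so that `g = (1 - t²) Z`, and `s = t`, the ratio of `i(α)` to `a(α) β / Z` lies
between `1 - t²` and `(1 + t) / (1 - t - t²)`. Normalizing cancels `β` and `Z`. Hence every boundary
condition gives a probability within a factor `c = (1 - t)(1 - t - t²)` of `a(α) / ∑ a(α')`, which
does not involve `τ` (`spinProb_bounds`), and `one_le_mul_of_mixing` absorbs `c²`.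

FKG (`rcInt_fkg`) comes from viewing two independent Poisson configurations as all splittings of a
single one, which leaves the four functions theorem on a finite Boolean lattice. Its lattice
condition is the supermodularity of the cluster count, a dimension inequality
(`freeCount_supermodular`). The same splitting identity disintegrates the measure along the
exploration (`lintegral_explore`), and an exchange of the parts outside the explored set identifies
the conditional law (`nInt_mul_xInt`). -/

namespace Box

/-! ### Connectivity and clusters for finite sets of deaths. -/

section Connectivity

variable {Λ : Box} {d d' b b' S T W : Set Pt} {p q r : Pt}

lemma Glued.symm (h : Λ.Glued p q) : Λ.Glued q p := by
  obtain ⟨h1, h2⟩ := h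
  exact ⟨h1.symm, by tauto⟩

lemma Step.symm (h : Λ.Step d b p q) : Λ.Step d b q p := by
  obtain ⟨hp, hq, hpd, hqd, h⟩ := h
  refine ⟨hq, hp, hqd, hpd, ?_⟩
  rcases h with ⟨h1, h2⟩ | ⟨h1, h2⟩ | h
  · left
    refine ⟨h1.symm, fun u hu => ?_⟩
    rw [← h1]
    rw [Set.uIcc_comm] at hu
    exact h2 u hu
  · right; left
    exact ⟨h1.symm, h2.symm⟩
  · exact Or.inr (Or.inr h.symm)

lemma Conn.symm (h : Λ.Conn d b p q) : Λ.Conn d b q p := by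
  induction h with
  | single h => exact .single h.symm
  | tail _ h ih => exact .head h.symm ih

lemma Conn.trans (h : Λ.Conn d b p q) (h' : Λ.Conn d b q r) : Λ.Conn d b p r :=
  Relation.TransGen.trans h h'

lemma Conn.mem_right (h : Λ.Conn d b p q) : q ∈ Λ.carrier ∧ q ∉ d := by
  cases h with
  | single h => exact ⟨h.2.1, h.2.2.2.1⟩
  | tail _ h => exact ⟨h.2.1, h.2.2.2.1⟩

lemma Conn.mem_left (h : Λ.Conn d b p q) : p ∈ Λ.carrier ∧ p ∉ d := h.symm.mem_right

lemma conn_vertical (hp : p ∈ Λ.carrier) (hq : q ∈ Λ.carrier) (h : p.1 = q.1)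
    (hd : ∀ u ∈ Set.uIcc p.2 q.2, (p.1, u) ∉ d) : Λ.Conn d b p q := by
  refine .single ⟨hp, hq, ?_, ?_, Or.inl ⟨h, hd⟩⟩
  · exact hd p.2 Set.left_mem_uIcc
  · have := hd q.2 Set.right_mem_uIcc
    rwa [h] at this

lemma conn_refl (hp : p ∈ Λ.carrier) (hd : p ∉ d) : Λ.Conn d b p p :=
  conn_vertical hp hp rfl (by simpa using hd)

lemma conn_self_iff : Λ.Conn d b p p ↔ p ∈ Λ.carrier ∧ p ∉ d :=
  ⟨fun h => h.mem_left, fun h => conn_refl h.1 h.2⟩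

/-- An induction principle for connectivity in terms of steps inside the cluster. -/
lemma Conn.induction {P : Pt → Prop} (h : Λ.Conn d b p q) (h0 : P p)
    (hs : ∀ x y, Λ.Conn d b p x → P x → Λ.Step d b x y → P y) : P q := by
  induction h with
  | single h => exact hs _ _ (conn_refl h.1 h.2.2.1) h0 h
  | tail h1 h ih => exact hs _ _ h1 ih h

lemma Step.mono (hd : d' ⊆ d) (hb : b ⊆ b') (h : Λ.Step d b p q) : Λ.Step d' b' p q := by
  obtain ⟨hp, hq, hpd, hqd, h⟩ := h
  refine ⟨hp, hq, fun h => hpd (hd h), fun h => hqd (hd h), ?_⟩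
  rcases h with ⟨h1, h2⟩ | ⟨h1, h2⟩ | h
  · exact Or.inl ⟨h1, fun u hu hh => h2 u hu (hd hh)⟩
  · exact Or.inr (Or.inl ⟨h1, h2.imp (fun h => ⟨h.1, hb h.2⟩) (fun h => ⟨h.1, hb h.2⟩)⟩)
  · exact Or.inr (Or.inr h)

lemma Conn.mono (hd : d' ⊆ d) (hb : b ⊆ b') (h : Λ.Conn d b p q) : Λ.Conn d' b' p q :=
  Relation.TransGen.mono (fun _ _ h => Step.mono hd hb h) _ _ h

lemma ConnSets.mono (hd : d' ⊆ d) (hb : b ⊆ b') (h : Λ.ConnSets d b S T) :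
    Λ.ConnSets d' b' S T := by
  obtain ⟨p, hp, q, hq, h⟩ := h
  exact ⟨p, hp, q, hq, h.mono hd hb⟩

lemma Step.carrier_segment (hp : p ∈ Λ.carrier) (hq : q ∈ Λ.carrier) {u : ℝ}
    (hu : u ∈ Set.uIcc p.2 q.2) : (p.1, u) ∈ Λ.carrier := by
  obtain ⟨h1, h2, h3, h4⟩ := hp
  obtain ⟨h1', h2', h3', h4'⟩ := hq
  rw [Set.mem_uIcc] at hu
  refine ⟨h1, h2, ?_, ?_⟩ <;> rcases hu with hu | hu <;> simp only <;> linarith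

/-- Points on a free segment issued from `p` are connected to `p`. -/
lemma conn_of_mem_segment (hp : p ∈ Λ.carrier) (hq : q ∈ Λ.carrier)
    (hd : ∀ u ∈ Set.uIcc p.2 q.2, (p.1, u) ∉ d) {u : ℝ} (hu : u ∈ Set.uIcc p.2 q.2) :
    Λ.Conn d b p (p.1, u) := by
  refine conn_vertical hp (Step.carrier_segment hp hq hu) rfl fun v hv => hd v ?_
  exact Set.uIcc_subset_uIcc Set.left_mem_uIcc hu hv

/-- A connection survives when the dead set and the bridges change away from the cluster. -/
lemma Conn.transfer (h : Λ.Conn d b p q) (hd : ∀ z, Λ.Conn d b p z → z ∉ d')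
    (hb : ∀ e ∈ b, Λ.Conn d b p e → Λ.Conn d b p (e.1 + 1, e.2) → e ∈ b') :
    Λ.Conn d' b' p q := by
  refine Conn.induction (P := fun z => Λ.Conn d' b' p z) h
    (conn_refl h.mem_left.1 (hd p (conn_refl h.mem_left.1 h.mem_left.2))) ?_
  intro x y hx hx' hs
  have hy : Λ.Conn d b p y := hx.trans (.single hs)
  refine hx'.trans (.single ?_)
  obtain ⟨hxc, hyc, hxd, hyd, hs⟩ := hs
  refine ⟨hxc, hyc, hd x hx, hd y hy, ?_⟩
  rcases hs with ⟨h1, h2⟩ | ⟨h1, h2⟩ | hs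
  · exact Or.inl ⟨h1, fun u hu => hd _ (hx.trans (conn_of_mem_segment hxc hyc h2 hu))⟩
  · refine Or.inr (Or.inl ⟨h1, ?_⟩)
    rcases h2 with ⟨h2, h3⟩ | ⟨h2, h3⟩
    · refine Or.inl ⟨h2, hb x h3 hx ?_⟩
      rwa [show ((x.1 + 1, x.2) : Pt) = y from Prod.ext h2.symm h1]
    · refine Or.inr ⟨h2, hb y h3 hy ?_⟩
      rwa [show ((y.1 + 1, y.2) : Pt) = x from Prod.ext h2.symm h1.symm]
  · exact Or.inr (Or.inr hs)

/-- Near a point off a finite set, the time-line is free of that set. -/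
lemma exists_free_nhd (hd : d.Finite) (hp : p ∉ d) :
    ∃ ε > 0, ∀ v, |v - p.2| < ε → (p.1, v) ∉ d := by
  have hc : IsOpen {u : ℝ | (p.1, u) ∉ d} :=
    (hd.isClosed.preimage (by fun_prop : Continuous fun u : ℝ => (p.1, u))).isOpen_compl
  obtain ⟨ε, hε, h⟩ := Metric.isOpen_iff.1 hc p.2 hp
  exact ⟨ε, hε, fun v hv => h (by simpa [Real.dist_eq] using hv)⟩

lemma abs_sub_lt_of_mem_uIcc {a c v ε : ℝ} (hv : v ∈ Set.uIcc a c) (h : |c - a| < ε) :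
    |v - a| < ε := by
  rw [Set.mem_uIcc] at hv
  rw [abs_lt] at *
  rcases hv with hv | hv <;> constructor <;> linarith

lemma exists_conn_nhd (hd : d.Finite) (hp : p ∈ Λ.carrier) (hpd : p ∉ d) :
    ∃ ε > 0, ∀ q ∈ Λ.carrier, q.1 = p.1 → |q.2 - p.2| < ε → Λ.Conn d b p q := by
  obtain ⟨ε, hε, h⟩ := exists_free_nhd hd hpd
  exact ⟨ε, hε, fun q hq h1 h2 => conn_vertical hp hq h1.symm
    fun u hu => h u (abs_sub_lt_of_mem_uIcc hu h2)⟩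

lemma exists_near {S₀ : Set Pt} (h : p ∈ closure S₀) {ε : ℝ} (hε : 0 < ε) :
    ∃ q ∈ S₀, q.1 = p.1 ∧ |q.2 - p.2| < ε := by
  obtain ⟨q, hq, hd⟩ := Metric.mem_closure_iff.1 h (min ε 1) (by positivity)
  rw [Prod.dist_eq, max_lt_iff, lt_min_iff, lt_min_iff] at hd
  refine ⟨q, hq, ?_, ?_⟩
  · have := hd.1.2
    rw [Int.dist_eq] at this
    have h2 : |p.1 - q.1| < 1 := by exact_mod_cast this
    rw [Int.abs_lt_one_iff] at h2
    omega
  · rw [abs_sub_comm, ← Real.dist_eq]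
    exact hd.2.1

/-- If the dead set is finite then a cluster that meets `S` meets any dense subset of `S`. -/
lemma exists_conn_dense {S₀ : Set Pt} (hd : d.Finite) (hS : S ⊆ closure S₀)
    (hS₀ : S₀ ⊆ Λ.carrier) (hp : p ∈ S) (h : Λ.Conn d b q p) :
    ∃ p' ∈ S₀, p'.1 = p.1 ∧ Λ.Conn d b q p' := by
  obtain ⟨ε, hε, h'⟩ := exists_conn_nhd (b := b) hd h.mem_right.1 h.mem_right.2
  obtain ⟨p', hp', h1, h2⟩ := exists_near (hS hp) hε
  exact ⟨p', hp', h1, h.trans (h' p' (hS₀ hp') h1 h2)⟩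

/-- The points connected to `S`. -/
def reach (Λ : Box) (d b S : Set Pt) : Set Pt := {z | ∃ γ ∈ S, Λ.Conn d b γ z}

lemma mem_reach_of_conn (h : p ∈ Λ.reach d b S) (h' : Λ.Conn d b p q) : q ∈ Λ.reach d b S := by
  obtain ⟨γ, hγ, hc⟩ := h
  exact ⟨γ, hγ, hc.trans h'⟩

lemma reach_subset_carrier : Λ.reach d b S ⊆ Λ.carrier := fun _ ⟨_, _, h⟩ => h.mem_right.1

lemma notMem_of_mem_reach (h : p ∈ Λ.reach d b S) : p ∉ d := by
  obtain ⟨_, _, h⟩ := h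
  exact h.mem_right.2

lemma reach_mono (hd : d' ⊆ d) (hb : b ⊆ b') : Λ.reach d b S ⊆ Λ.reach d' b' S :=
  fun _ ⟨γ, hγ, h⟩ => ⟨γ, hγ, h.mono hd hb⟩

lemma connSets_iff_reach : Λ.ConnSets d b T S ↔ (T ∩ Λ.reach d b S).Nonempty := by
  constructor
  · rintro ⟨p, hp, q, hq, h⟩
    exact ⟨p, hp, q, hq, h.symm⟩
  · rintro ⟨p, hp, q, hq, h⟩
    exact ⟨p, hp, q, hq, h.symm⟩

/-- With finitely many deaths a living point has a whole interval of its time-line in its cluster,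
so a cluster meeting `S` meets any dense part of `S`. This allows an uncountable `Γ` to be explored,
measurably, from countably many roots. -/
lemma reach_eq_of_dense {S₀ : Set Pt} (hd : d.Finite) (hS : S ⊆ closure S₀)
    (hS₀ : S₀ ⊆ S) (hc : S ⊆ Λ.carrier) : Λ.reach d b S₀ = Λ.reach d b S := by
  ext z
  constructor
  · rintro ⟨γ, hγ, h⟩
    exact ⟨γ, hS₀ hγ, h⟩
  · rintro ⟨γ, hγ, h⟩
    obtain ⟨p', hp', -, h'⟩ := exists_conn_dense hd hS (hS₀.trans hc) hγ h.symm
    exact ⟨p', hp', h'.symm⟩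

/-- The clusters that do not meet `W`. -/
def freeClusters (Λ : Box) (d b W : Set Pt) : Set (Set Pt) :=
  {C ∈ Λ.clusters d b | Disjoint C W}

/-- The number of clusters that do not meet `W`. -/
noncomputable def freeCount (Λ : Box) (d b W : Set Pt) : ℕ := (Λ.freeClusters d b W).ncard

open Classical in
lemma clusterCount_eq : Λ.clusterCount d b W =
    Λ.freeCount d b W + if W.Nonempty then 1 else 0 := rfl

/-- The cluster of a point. -/
def cl (Λ : Box) (d b : Set Pt) (p : Pt) : Set Pt := {q | Λ.Conn d b p q}

lemma cl_eq_of_conn (h : Λ.Conn d b p q) : Λ.cl d b p = Λ.cl d b q := by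
  ext z
  exact ⟨fun h' => h.symm.trans h', fun h' => h.trans h'⟩

/-- The points just below which a cluster can end: the dead points and the tops of lines. -/
def tops (Λ : Box) (d : Set Pt) : Set Pt := d ∪ (fun x : ℤ => (x, Λ.t)) '' Set.Icc Λ.a Λ.b

lemma exists_top (hd : d.Finite) (hp : p ∈ Λ.carrier) :
    ∃ w ∈ Λ.tops d, w.1 = p.1 ∧ p.2 ≤ w.2 ∧ ∀ u, p.2 ≤ u → u < w.2 → (p.1, u) ∉ d := by
  have hfin : (Λ.tops d ∩ {w | w.1 = p.1 ∧ p.2 ≤ w.2}).Finite :=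
    (hd.union ((Set.finite_Icc _ _).image _)).inter_of_left _
  have hne : (Λ.tops d ∩ {w | w.1 = p.1 ∧ p.2 ≤ w.2}).Nonempty :=
    ⟨(p.1, Λ.t), Or.inr ⟨p.1, ⟨hp.1, hp.2.1⟩, rfl⟩, rfl, hp.2.2.2⟩
  obtain ⟨w, hw, hmin⟩ := Set.exists_min_image _ (fun w : Pt => w.2) hfin hne
  refine ⟨w, hw.1, hw.2.1, hw.2.2, fun u hu huw hud => ?_⟩
  have := hmin (p.1, u) ⟨Or.inl hud, rfl, hu⟩
  simp only at this
  linarith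

/-- Going up from a point of a cluster, the first death or end of the line determines the cluster:
of two points below the same such obstacle, the lower one sees the upper one. -/
lemma clusters_finite_and_ncard_le (hd : d.Finite) :
    (Λ.clusters d b).Finite ∧ (Λ.clusters d b).ncard ≤ (Λ.tops d).ncard := by
  classical
  have htops : (Λ.tops d).Finite := hd.union ((Set.finite_Icc _ _).image _)
  have hex : ∀ C ∈ Λ.clusters d b, ∃ w ∈ Λ.tops d, ∃ p, Λ.Conn d b p p ∧ C = Λ.cl d b p ∧
      w.1 = p.1 ∧ p.2 ≤ w.2 ∧ ∀ u, p.2 ≤ u → u < w.2 → (p.1, u) ∉ d := by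
    rintro C ⟨p, hp, rfl⟩
    obtain ⟨w, hw, h⟩ := exists_top hd hp.mem_left.1
    exact ⟨w, hw, p, hp, rfl, h⟩
  choose! f hf g hg using hex
  have key : ∀ p q : Pt, ∀ w : Pt, Λ.Conn d b p p → Λ.Conn d b q q →
      w.1 = p.1 → p.2 ≤ w.2 → (∀ u, p.2 ≤ u → u < w.2 → (p.1, u) ∉ d) →
      w.1 = q.1 → q.2 ≤ w.2 → q.2 ≤ p.2 → (∀ u, q.2 ≤ u → u < w.2 → (q.1, u) ∉ d) →
      Λ.cl d b p = Λ.cl d b q := by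
    intro p q w hp hq h1 h2 h3 h1' h2' hqp h3'
    refine (cl_eq_of_conn (conn_vertical hq.mem_left.1 hp.mem_left.1 (by rw [← h1, ← h1'])
      fun u hu => ?_)).symm
    rw [Set.uIcc_of_le hqp] at hu
    rcases lt_or_eq_of_le (hu.2.trans h2) with h | h
    · exact h3' u hu.1 h
    · have hup : u = p.2 := le_antisymm hu.2 (h ▸ h2)
      rw [hup, ← h1', h1]
      exact hp.mem_left.2
  have hinj : Set.InjOn f (Λ.clusters d b) := by
    intro C hC C' hC' hCC
    obtain ⟨hp, hCe, h1, h2, h3⟩ := hg C hC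
    obtain ⟨hp', hCe', h1', h2', h3'⟩ := hg C' hC'
    rw [hCe, hCe']
    rw [← hCC] at h1' h2' h3'
    rcases le_total (g C').2 (g C).2 with h | h
    · exact key _ _ _ hp hp' h1 h2 h3 h1' h2' h h3'
    · exact (key _ _ _ hp' hp h1' h2' h3' h1 h2 h h3).symm
  have hmaps : Set.MapsTo f (Λ.clusters d b) (Λ.tops d) := fun C hC => hf C hC
  exact ⟨Set.Finite.of_injOn hmaps hinj htops, Set.ncard_le_ncard_of_injOn f hmaps hinj htops⟩

lemma clusters_finite (hd : d.Finite) : (Λ.clusters d b).Finite :=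
  (clusters_finite_and_ncard_le hd).1

lemma freeClusters_finite (hd : d.Finite) : (Λ.freeClusters d b W).Finite :=
  (clusters_finite hd).subset fun _ h => h.1

lemma freeCount_le (hd : d.Finite) :
    Λ.freeCount d b W ≤ d.ncard + ((fun x : ℤ => ((x, Λ.t) : Pt)) '' Set.Icc Λ.a Λ.b).ncard :=
  (Set.ncard_le_ncard (fun _ h => h.1) (clusters_finite hd)).trans
    ((clusters_finite_and_ncard_le hd).2.trans (Set.ncard_union_le _ _))

lemma exists_countable_dense (S : Set Pt) : ∃ S₀ ⊆ S, S₀.Countable ∧ S ⊆ closure S₀ :=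
  (TopologicalSpace.IsSeparable.of_separableSpace S).exists_countable_dense_subset

end Connectivity

end Box


/-! ### Measurability of random sets and of connection events. -/

/-- A random subset of `ℤ × ℝ` that is listed by countably many measurable points, each of which
is present on a measurable event. -/
def MeasFam {Ω : Type} [MeasurableSpace Ω] (S : Ω → Set Pt) : Prop :=
  ∃ (z : ℕ → Ω → Pt) (P : ℕ → Ω → Prop), (∀ i, Measurable (z i)) ∧ (∀ i, Measurable (P i)) ∧
    ∀ ω, S ω = {x | ∃ i, P i ω ∧ z i ω = x}

namespace MeasFam

variable {Ω Ω' : Type} [MeasurableSpace Ω] [MeasurableSpace Ω'] {S T : Ω → Set Pt}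

lemma comp (hS : MeasFam S) {f : Ω' → Ω} (hf : Measurable f) : MeasFam fun ω => S (f ω) := by
  obtain ⟨z, P, hz, hP, h⟩ := hS
  exact ⟨fun i => z i ∘ f, fun i => P i ∘ f, fun i => (hz i).comp hf, fun i => (hP i).comp hf,
    fun ω => h (f ω)⟩

lemma of_countable {ι : Type} [Countable ι] (z : ι → Ω → Pt) (P : ι → Ω → Prop)
    (hz : ∀ i, Measurable (z i)) (hP : ∀ i, Measurable (P i))
    (h : ∀ ω, S ω = {x | ∃ i, P i ω ∧ z i ω = x}) : MeasFam S := by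
  rcases isEmpty_or_nonempty ι with hι | hι
  · exact ⟨fun _ _ => default, fun _ _ => False, fun _ => measurable_const,
      fun _ => measurable_const, fun ω => by rw [h]; ext x; simp⟩
  · obtain ⟨e, he⟩ := exists_surjective_nat ι
    refine ⟨fun i => z (e i), fun i => P (e i), fun i => hz _, fun i => hP _, fun ω => ?_⟩
    rw [h]
    ext x
    exact he.exists

lemma union (hS : MeasFam S) (hT : MeasFam T) : MeasFam fun ω => S ω ∪ T ω := by
  obtain ⟨z, P, hz, hP, h⟩ := hS
  obtain ⟨z', P', hz', hP', h'⟩ := hT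
  refine of_countable (ι := ℕ ⊕ ℕ) (Sum.elim z z') (Sum.elim P P') ?_ ?_ ?_
  · rintro (i | i) <;> simp [hz, hz']
  · rintro (i | i) <;> simp [hP, hP']
  · intro ω
    ext x
    simp [h, h']

lemma const {C : Set Pt} (hC : C.Countable) : MeasFam fun _ : Ω => C := by
  have := hC.to_subtype
  refine of_countable (ι := C) (fun i _ => i.1) (fun _ _ => True) (fun _ => measurable_const)
    (fun _ => measurable_const) fun ω => ?_
  ext x
  simp

/-- The sub-family of those points that satisfy a measurable condition. -/
lemma filter (hS : MeasFam S) (R : Ω → Pt → Prop)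
    (hR : ∀ z : Ω → Pt, Measurable z → Measurable fun ω => R ω (z ω)) :
    MeasFam fun ω => {x ∈ S ω | R ω x} := by
  obtain ⟨z, P, hz, hP, h⟩ := hS
  refine ⟨z, fun i ω => P i ω ∧ R ω (z i ω), hz, fun i => (hP i).and (hR _ (hz i)), fun ω => ?_⟩
  ext x
  simp only [h, Set.mem_ofPred_eq]
  constructor
  · rintro ⟨⟨i, hi, rfl⟩, hx⟩
    exact ⟨i, ⟨hi, hx⟩, rfl⟩
  · rintro ⟨i, ⟨hi, hx⟩, rfl⟩
    exact ⟨⟨i, hi, rfl⟩, hx⟩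

lemma measurable_forall (hS : MeasFam S) (R : Ω → Pt → Prop)
    (hR : ∀ z : Ω → Pt, Measurable z → Measurable fun ω => R ω (z ω)) :
    Measurable fun ω => ∀ x ∈ S ω, R ω x := by
  obtain ⟨z, P, hz, hP, h⟩ := hS
  have : (fun ω => ∀ x ∈ S ω, R ω x) = fun ω => ∀ i, P i ω → R ω (z i ω) := by
    ext ω
    simp only [h, Set.mem_ofPred_eq]
    constructor
    · intro hh i hi
      exact hh _ ⟨i, hi, rfl⟩
    · rintro hh x ⟨i, hi, rfl⟩
      exact hh i hi
  rw [this]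
  exact Measurable.forall fun i => (hP i).imp (hR _ (hz i))

lemma measurable_mem (hS : MeasFam S) {u : Ω → Pt} (hu : Measurable u) :
    Measurable fun ω => u ω ∈ S ω := by
  have h := (hS.measurable_forall (fun ω x => x ≠ u ω)
    (fun z hz => (measurableSet_eq_fun hz hu).mem.not)).not
  convert h using 2 with ω
  simp only [ne_eq]
  constructor
  · intro h h'
    exact h' _ h rfl
  · intro h
    by_contra h'
    exact h fun x hx hxu => h' (hxu ▸ hx)

end MeasFam

namespace Box

lemma measurableSet_carrier (Λ : Box) : MeasurableSet Λ.carrier := by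
  unfold carrier
  apply MeasurableSet.inter (measurableSet_le measurable_const measurable_fst)
  apply MeasurableSet.inter (measurableSet_le measurable_fst measurable_const)
  apply MeasurableSet.inter (measurableSet_le measurable_const measurable_snd)
  exact measurableSet_le measurable_snd measurable_const

section

variable {Ω : Type} [MeasurableSpace Ω] {S B : Ω → Set Pt} {u v : Ω → Pt} (Λ : Box)

lemma measurable_glued (hu : Measurable u) (hv : Measurable v) :
    Measurable fun ω => Λ.Glued (u ω) (v ω) := by
  unfold Glued
  have h1 : ∀ c : ℝ, Measurable fun ω => (u ω).2 = c :=
    fun c => (measurableSet_eq_fun hu.snd measurable_const).mem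
  have h2 : ∀ c : ℝ, Measurable fun ω => (v ω).2 = c :=
    fun c => (measurableSet_eq_fun hv.snd measurable_const).mem
  exact (measurableSet_eq_fun hu.fst hv.fst).mem.and
    (((h1 _).and (h2 _)).or ((h1 _).and (h2 _)))

lemma measurable_free (hS : MeasFam S) (hu : Measurable u) (hv : Measurable v) :
    Measurable fun ω => ∀ y ∈ Set.uIcc (u ω).2 (v ω).2, ((u ω).1, y) ∉ S ω := by
  have h := hS.measurable_forall
    (fun ω x => ¬ (x.1 = (u ω).1 ∧ min (u ω).2 (v ω).2 ≤ x.2 ∧ x.2 ≤ max (u ω).2 (v ω).2)) ?_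
  · convert h using 2 with ω
    constructor
    · rintro h x hx ⟨h1, h2, h3⟩
      refine h x.2 ⟨h2, h3⟩ ?_
      rwa [← h1]
    · intro h y hy hS
      exact h _ hS ⟨rfl, hy.1, hy.2⟩
  · intro z hz
    have h1 := measurableSet_le (hu.snd.min hv.snd) hz.snd
    have h2 := measurableSet_le hz.snd (hu.snd.max hv.snd)
    exact Measurable.not (Measurable.and (measurableSet_eq_fun hz.fst hu.fst).mem
      (Measurable.and h1.mem h2.mem))

lemma measurable_step (hS : MeasFam S) (hB : MeasFam B) (hu : Measurable u) (hv : Measurable v) :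
    Measurable fun ω => Λ.Step (S ω) (B ω) (u ω) (v ω) := by
  unfold Step
  refine Measurable.and (hu Λ.measurableSet_carrier).mem
    (Measurable.and (hv Λ.measurableSet_carrier).mem
    (Measurable.and (hS.measurable_mem hu).not (Measurable.and (hS.measurable_mem hv).not
    (Measurable.or (Measurable.and (measurableSet_eq_fun hu.fst hv.fst).mem
      (measurable_free hS hu hv)) (Measurable.or ?_ (Λ.measurable_glued hu hv))))))
  refine Measurable.and (measurableSet_eq_fun hu.snd hv.snd).mem (Measurable.or ?_ ?_)
  · exact (measurableSet_eq_fun hv.fst (hu.fst.add measurable_const)).mem.and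
      (hB.measurable_mem hu)
  · exact (measurableSet_eq_fun hu.fst (hv.fst.add measurable_const)).mem.and
      (hB.measurable_mem hv)

lemma measurable_transGen {N : Type} [Countable N] {r : Ω → N → N → Prop}
    (hr : ∀ a c, Measurable fun ω => r ω a c) (a c : N) :
    Measurable fun ω => Relation.TransGen (r ω) a c := by
  let R : ℕ → Ω → N → N → Prop := fun n =>
    Nat.rec (fun ω a c => r ω a c) (fun _ R ω a c => ∃ x, R ω a x ∧ r ω x c) n
  have hR : ∀ n a c, Measurable fun ω => R n ω a c := by
    intro n
    induction n with
    | zero => exact hr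
    | succ n ih => exact fun a c => Measurable.exists fun x => (ih a x).and (hr x c)
  have : (fun ω => Relation.TransGen (r ω) a c) = fun ω => ∃ n, R n ω a c := by
    ext ω
    constructor
    · intro h
      induction h with
      | single h => exact ⟨0, h⟩
      | tail _ h ih =>
        obtain ⟨n, hn⟩ := ih
        exact ⟨n + 1, _, hn, h⟩
    · rintro ⟨n, hn⟩
      induction n generalizing c with
      | zero => exact .single hn
      | succ n ih =>
        obtain ⟨x, hx, hxc⟩ := hn
        exact .tail (ih x hx) hxc
  rw [this]
  exact Measurable.exists fun n => hR n a c

/-- A path may be taken to turn only at countably many nodes that are measurable functions of `ω`: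
its two ends, the ends of the listed bridges and the ends of the time-lines. Connection is then a
transitive closure over a countable index set. -/
lemma measurable_conn (hS : MeasFam S) (hB : MeasFam B) (hu : Measurable u) (hv : Measurable v) :
    Measurable fun ω => Λ.Conn (S ω) (B ω) (u ω) (v ω) := by
  obtain ⟨z, P, hz, hP, hBz⟩ := id hB
  let N := Bool ⊕ (ℕ × Bool) ⊕ (ℤ × Bool)
  let ν : N → Ω → Pt := Sum.elim (fun i => if i then u else v)
    (Sum.elim (fun i ω => if i.2 then z i.1 ω else ((z i.1 ω).1 + 1, (z i.1 ω).2))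
      (fun i _ => (i.1, if i.2 then Λ.s else Λ.t)))
  have hν : ∀ n, Measurable (ν n) := by
    rintro (i | ⟨i, j⟩ | ⟨i, j⟩)
    · cases i
      · exact hv
      · exact hu
    · cases j
      · exact ((hz i).fst.add measurable_const).prodMk (hz i).snd
      · exact hz i
    · exact measurable_const
  have hm := measurable_transGen (r := fun ω n n' => Λ.Step (S ω) (B ω) (ν n ω) (ν n' ω))
    (fun a c => Λ.measurable_step hS hB (hν a) (hν c)) (Sum.inl true) (Sum.inl false)
  convert hm using 2 with ω
  have hsound : ∀ n n', Relation.TransGen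
      (fun n n' => Λ.Step (S ω) (B ω) (ν n ω) (ν n' ω)) n n' →
      Λ.Conn (S ω) (B ω) (ν n ω) (ν n' ω) :=
    fun n n' h => Relation.TransGen.lift (fun n => ν n ω) (fun _ _ h => h) _ _ h
  refine ⟨fun h => ?_, fun h => hsound _ _ h⟩
  set r := fun n n' => Λ.Step (S ω) (B ω) (ν n ω) (ν n' ω) with hr
  have hvert : ∀ n (w : Pt), Λ.Conn (S ω) (B ω) (ν n ω) (ν n ω) → w ∈ Λ.carrier →
      w.1 = (ν n ω).1 → (∀ y ∈ Set.uIcc (ν n ω).2 w.2, ((ν n ω).1, y) ∉ S ω) →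
      ∀ n', ν n' ω = w → r n n' := by
    intro n w hn hw h1 h2 n' hn'
    refine ⟨hn.mem_left.1, hn' ▸ hw, hn.mem_left.2, ?_, Or.inl ⟨by rw [hn', h1], by rwa [hn']⟩⟩
    have := h2 w.2 Set.right_mem_uIcc
    rw [hn']
    rwa [← h1] at this
  -- Invariant along the path: the current point lies on a free vertical segment issued from a node
  -- already reached.
  have key : ∃ n, Relation.TransGen r (Sum.inl true) n ∧ (v ω).1 = (ν n ω).1 ∧
      ∀ y ∈ Set.uIcc (ν n ω).2 (v ω).2, ((ν n ω).1, y) ∉ S ω := by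
    refine Conn.induction (P := fun w => ∃ n, Relation.TransGen r (Sum.inl true) n ∧
      w.1 = (ν n ω).1 ∧ ∀ y ∈ Set.uIcc (ν n ω).2 w.2, ((ν n ω).1, y) ∉ S ω) h ?_ ?_
    · refine ⟨Sum.inl true, .single ?_, rfl, ?_⟩
      · refine hvert _ _ ?_ h.mem_left.1 rfl ?_ _ rfl
        · exact conn_refl h.mem_left.1 h.mem_left.2
        · intro y hy
          have : y = (u ω).2 := by simpa [ν] using hy
          rw [this]
          exact h.mem_left.2
      · intro y hy
        have : y = (u ω).2 := by simpa [ν] using hy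
        rw [this]
        exact h.mem_left.2
    · rintro x y hx ⟨n, hn, h1, h2⟩ ⟨hxc, hyc, hxd, hyd, hs⟩
      have hnn := (conn_self_iff (b := B ω)).2 ((hsound _ _ hn).mem_right)
      have hnew : ∀ n' , ν n' ω = y → ∀ m, ν m ω = x → r m n' →
          ∃ n, Relation.TransGen r (Sum.inl true) n ∧
          y.1 = (ν n ω).1 ∧ ∀ w ∈ Set.uIcc (ν n ω).2 y.2, ((ν n ω).1, w) ∉ S ω := by
        intro n' hn' m hm hmn
        refine ⟨n', (hn.tail (hvert n x hnn hxc h1 h2 m hm)).tail hmn, by rw [hn'], ?_⟩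
        rw [hn']
        intro w hw
        rw [Set.uIcc_self] at hw
        rw [Set.mem_singleton_iff.1 hw]
        exact hyd
      rcases hs with ⟨h3, h4⟩ | hs | hs
      · refine ⟨n, hn, by rw [← h3, h1], fun w hw => ?_⟩
        rcases Set.uIcc_subset_uIcc_union_uIcc (b := x.2) hw with hw | hw
        · exact h2 w hw
        · rw [← h1]
          exact h4 w hw
      · have hs' := hs
        obtain ⟨h3, ⟨h4, h5⟩ | ⟨h4, h5⟩⟩ := hs
        · rw [hBz] at h5
          obtain ⟨i, -, hi⟩ := h5
          have e1 : ν (Sum.inr (Sum.inl (i, true))) ω = x := hi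
          have e2 : ν (Sum.inr (Sum.inl (i, false))) ω = y := by
            simp only [ν, Sum.elim_inr, Sum.elim_inl, hi, Bool.false_eq_true, if_false]
            exact Prod.ext h4.symm h3
          refine hnew _ e2 _ e1 ?_
          rw [hr]
          simp only [e1, e2]
          exact ⟨hxc, hyc, hxd, hyd, Or.inr (Or.inl hs')⟩
        · rw [hBz] at h5
          obtain ⟨i, -, hi⟩ := h5
          have e1 : ν (Sum.inr (Sum.inl (i, true))) ω = y := hi
          have e2 : ν (Sum.inr (Sum.inl (i, false))) ω = x := by
            simp only [ν, Sum.elim_inr, Sum.elim_inl, hi, Bool.false_eq_true, if_false]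
            exact Prod.ext h4.symm h3.symm
          refine hnew _ e1 _ e2 ?_
          rw [hr]
          simp only [e1, e2]
          exact ⟨hxc, hyc, hxd, hyd, Or.inr (Or.inl hs')⟩
      · have e : ∀ w : Pt, (w.2 = Λ.s ∨ w.2 = Λ.t) → ∃ n, ν n ω = w := by
          rintro w (hw | hw)
          · exact ⟨Sum.inr (Sum.inr (w.1, true)), Prod.ext rfl hw.symm⟩
          · exact ⟨Sum.inr (Sum.inr (w.1, false)), Prod.ext rfl hw.symm⟩
        obtain ⟨m, hm⟩ := e x (by have := hs.2; tauto)
        obtain ⟨n', hn'⟩ := e y (by have := hs.2; tauto)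
        refine hnew n' hn' m hm ?_
        rw [hr]
        simp only [hm, hn']
        exact ⟨hxc, hyc, hxd, hyd, Or.inr (Or.inr hs)⟩
  obtain ⟨n, hn, h1, h2⟩ := key
  exact hn.tail (hvert n (v ω) ((conn_self_iff (b := B ω)).2 ((hsound _ _ hn).mem_right))
    h.mem_right.1 h1 h2 _ rfl)

/-- The dead set is random, listed measurably, and finite. -/
lemma measurable_mem_reach (hS : MeasFam S) (hSf : ∀ ω, (S ω).Finite) (hB : MeasFam B)
    (hu : Measurable u) {T : Set Pt} (hT : T ⊆ Λ.carrier) :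
    Measurable fun ω => u ω ∈ Λ.reach (S ω) (B ω) T := by
  obtain ⟨T₀, hT₀, hc, hd⟩ := exists_countable_dense T
  have := hc.to_subtype
  have h : Measurable fun ω => ∃ γ : T₀, Λ.Conn (S ω) (B ω) γ.1 (u ω) :=
    Measurable.exists fun γ => Λ.measurable_conn hS hB measurable_const hu
  convert h using 2 with ω
  rw [← reach_eq_of_dense (hSf ω) hd hT₀ hT]
  simp [reach]

lemma measurable_connSets (hS : MeasFam S) (hSf : ∀ ω, (S ω).Finite) (hB : MeasFam B)
    {T U : Set Pt} (hT : T ⊆ Λ.carrier) (hU : U ⊆ Λ.carrier) :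
    Measurable fun ω => Λ.ConnSets (S ω) (B ω) T U := by
  obtain ⟨T₀, hT₀, hc, hd⟩ := exists_countable_dense T
  have := hc.to_subtype
  have h : Measurable fun ω => ∃ γ : T₀, γ.1 ∈ Λ.reach (S ω) (B ω) U :=
    Measurable.exists fun γ => Λ.measurable_mem_reach hS hSf hB measurable_const hU
  convert h using 2 with ω
  rw [connSets_iff_reach]
  constructor
  · rintro ⟨p, hp, q, hq, h⟩
    obtain ⟨p', hp', -, h'⟩ := exists_conn_dense (hSf ω) hd (hT₀.trans hT) hp h
    exact ⟨⟨p', hp'⟩, q, hq, h'⟩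
  · rintro ⟨γ, h⟩
    exact ⟨γ, hT₀ γ.2, h⟩

/-- There are at least `k` free clusters iff some `k` points of a countable dense subset of the box
lie in distinct clusters avoiding `W`. -/
lemma measurable_freeCount (hS : MeasFam S) (hSf : ∀ ω, (S ω).Finite) (hB : MeasFam B)
    {W : Set Pt} (hW : W ⊆ Λ.carrier) :
    Measurable fun ω => Λ.freeCount (S ω) (B ω) W := by
  obtain ⟨Q, hQ, hc, hd⟩ := exists_countable_dense Λ.carrier
  have := hc.to_subtype
  refine measurable_of_Ici fun k => ?_
  have h : Measurable fun ω => ∃ x : Fin k → Q, ∀ i, (Λ.Conn (S ω) (B ω) (x i).1 (x i).1 ∧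
      (x i).1 ∉ Λ.reach (S ω) (B ω) W) ∧ ∀ j, i ≠ j → ¬ Λ.Conn (S ω) (B ω) (x i).1 (x j).1 := by
    refine Measurable.exists fun x => Measurable.forall fun i => Measurable.and
      (Measurable.and (Λ.measurable_conn hS hB measurable_const measurable_const)
        (Λ.measurable_mem_reach hS hSf hB measurable_const hW).not)
      (Measurable.forall fun j => Measurable.imp measurable_const
        (Λ.measurable_conn hS hB measurable_const measurable_const).not)
  convert measurableSet_setOfPred.2 h using 1
  ext ω
  simp only [Set.mem_preimage, Set.mem_Ici, Set.mem_ofPred_eq]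
  have hfin := freeClusters_finite (Λ := Λ) (b := B ω) (W := W) (hSf ω)
  constructor
  · intro hk
    obtain ⟨t, ht, htc⟩ := Set.exists_subset_card_eq hk
    have htf : t.Finite := hfin.subset ht
    have := htf.fintype
    have hcard : Fintype.card t = k := by rw [← htc, Set.ncard_eq_toFinset_card', Set.toFinset_card]
    let e : Fin k ≃ t := (Fintype.equivFinOfCardEq hcard).symm
    have hx : ∀ i : Fin k, ∃ q : Q, Λ.Conn (S ω) (B ω) q.1 q.1 ∧
        (e i).1 = Λ.cl (S ω) (B ω) q.1 := by
      intro i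
      obtain ⟨⟨p, hp, hpe⟩, -⟩ := ht (e i).2
      obtain ⟨p', hp', -, h'⟩ := exists_conn_dense (hSf ω) hd hQ hp.mem_left.1 hp
      exact ⟨⟨p', hp'⟩, h'.symm.trans h', by rw [hpe]; exact cl_eq_of_conn h'⟩
    choose x hx1 hx2 using hx
    refine ⟨x, fun i => ⟨⟨hx1 i, ?_⟩, fun j hij hc => hij (e.injective (Subtype.ext ?_))⟩⟩
    · rintro ⟨γ, hγ, h⟩
      have := (ht (e i).2).2
      rw [hx2] at this
      exact Set.disjoint_left.1 this h.symm hγ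
    · rw [hx2, hx2]
      exact cl_eq_of_conn hc
  · rintro ⟨x, hx⟩
    have : Function.Injective fun i => Λ.cl (S ω) (B ω) (x i).1 := by
      intro i j hij
      by_contra hne
      refine (hx i).2 j hne ?_
      have : (x j).1 ∈ Λ.cl (S ω) (B ω) (x j).1 := (hx j).1.1
      simp only at hij
      rwa [← hij] at this
    have hr : Set.range (fun i => Λ.cl (S ω) (B ω) (x i).1) ⊆ Λ.freeClusters (S ω) (B ω) W := by
      rintro _ ⟨i, rfl⟩
      refine ⟨⟨_, (hx i).1.1, rfl⟩, Set.disjoint_left.2 fun z hz hzW => ?_⟩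
      exact (hx i).1.2 ⟨z, hzW, hz.symm⟩
    calc k = (Set.range (fun i => Λ.cl (S ω) (B ω) (x i).1)).ncard := by
          rw [Set.ncard_range_of_injective this]; simp
      _ ≤ _ := Set.ncard_le_ncard hr hfin

end

end Box

/-! ### Point lists as measurable families. -/

section PointLists

lemma PointList.finite_points {X : Type} (c : PointList X) : c.points.Finite :=
  Set.finite_range _

lemma measurable_sigma_iff {X : Type} [MeasurableSpace X] {β : Type} [MeasurableSpace β]
    {f : PointList X → β} : Measurable f ↔ ∀ n, Measurable fun x : Fin n → X => f ⟨n, x⟩ := by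
  constructor
  · intro h n s hs
    exact (MeasurableSpace.measurableSet_iInf.1 (h hs)) n
  · intro h s hs
    exact MeasurableSpace.measurableSet_iInf.2 fun n => h n hs

lemma measurable_sigma_mk {X : Type} [MeasurableSpace X] (n : ℕ) :
    Measurable (fun x : Fin n → X => (⟨n, x⟩ : PointList X)) := by
  intro s hs
  exact (MeasurableSpace.measurableSet_iInf.1 hs) n

lemma MeasFam.points : MeasFam fun c : PointList Pt => c.points := by
  refine ⟨fun i c => if h : i < c.1 then c.2 ⟨i, h⟩ else default, fun i c => i < c.1,
    fun i => ?_, fun i => ?_, fun c => ?_⟩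
  · rw [measurable_sigma_iff]
    intro n
    by_cases h : i < n
    · simp only [h, dif_pos]
      exact measurable_pi_apply (⟨i, h⟩ : Fin n)
    · simp only [h, dif_neg, not_false_eq_true]
      exact measurable_const
  · rw [measurable_sigma_iff]
    intro n
    exact measurable_const (a := i < n)
  · ext x
    simp only [PointList.points, Set.mem_range, Set.mem_ofPred_eq]
    constructor
    · rintro ⟨i, rfl⟩
      exact ⟨i.1, i.2, by simp⟩
    · rintro ⟨i, hi, rfl⟩
      exact ⟨⟨i, hi⟩, by simp [hi]⟩

lemma MeasFam.deaths : MeasFam Config.deaths := MeasFam.points.comp measurable_fst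

lemma MeasFam.bridges : MeasFam Config.bridges := MeasFam.points.comp measurable_snd

lemma Config.finite_deaths (ω : Config) : ω.deaths.Finite := ω.1.finite_points

lemma Config.finite_bridges (ω : Config) : ω.bridges.Finite := ω.2.finite_points

end PointLists


/-! ### Supermodularity of the number of free clusters. -/

namespace Box

section Supermodular

variable {Λ : Box} {d d₁ d₂ b b₁ b₂ B W : Set Pt} {p q : Pt}

lemma exists_near_notMem (hst : Λ.s < Λ.t) (hB : B.Finite) (hp : p ∈ Λ.carrier) {ε : ℝ}
    (hε : 0 < ε) : ∃ q ∈ Λ.carrier, q.1 = p.1 ∧ |q.2 - p.2| < ε ∧ q ∉ B := by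
  have hlt : max Λ.s (p.2 - ε) < min Λ.t (p.2 + ε) := by
    obtain ⟨-, -, h3, h4⟩ := hp
    rw [max_lt_iff, lt_min_iff, lt_min_iff]
    exact ⟨⟨hst, by linarith⟩, by linarith, by linarith⟩
  have hfin : ((fun v : ℝ => ((p.1, v) : Pt)) ⁻¹' B).Finite :=
    hB.preimage fun a _ c _ h => by simpa using h
  obtain ⟨v, hv, hvB⟩ := ((Set.Ioo_infinite hlt).sdiff hfin).nonempty
  rw [Set.mem_Ioo, max_lt_iff, lt_min_iff] at hv
  refine ⟨(p.1, v), ⟨hp.1, hp.2.1, hv.1.1.le, hv.2.1.le⟩, rfl, ?_, hvB⟩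
  rw [abs_lt]
  constructor <;> simp only <;> linarith [hv.1.2, hv.2.2]

lemma exists_conn_notMem (hst : Λ.s < Λ.t) (hd : d.Finite) (hB : B.Finite)
    (hp : Λ.Conn d b p p) : ∃ q, q ∈ Λ.carrier \ B ∧ Λ.Conn d b p q := by
  obtain ⟨ε, hε, h⟩ := exists_conn_nhd (b := b) hd hp.mem_left.1 hp.mem_left.2
  obtain ⟨q, hq, h1, h2, h3⟩ := exists_near_notMem hst hB hp.mem_left.1 hε
  exact ⟨q, ⟨hq, h3⟩, h q hq h1 h2⟩

/-- The functions on the box without `B` that are constant on clusters and vanish on the clusters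
that meet `W`. -/
def clusterFun (Λ : Box) (B d b W : Set Pt) : Submodule ℝ (Pt → ℝ) where
  carrier := {f | (∀ p, p ∉ Λ.carrier \ B → f p = 0) ∧
    (∀ p ∈ Λ.carrier \ B, ∀ q ∈ Λ.carrier \ B, Λ.Conn d b p q → f p = f q) ∧
    ∀ p ∈ Λ.carrier \ B, ∀ w ∈ W, Λ.Conn d b p w → f p = 0}
  zero_mem' := by simp
  add_mem' := by
    rintro f g ⟨h1, h2, h3⟩ ⟨h1', h2', h3'⟩
    refine ⟨fun p hp => ?_, fun p hp q hq h => ?_, fun p hp w hw h => ?_⟩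
    · simp [h1 p hp, h1' p hp]
    · simp [h2 p hp q hq h, h2' p hp q hq h]
    · simp [h3 p hp w hw h, h3' p hp w hw h]
  smul_mem' := by
    rintro c f ⟨h1, h2, h3⟩
    refine ⟨fun p hp => ?_, fun p hp q hq h => ?_, fun p hp w hw h => ?_⟩
    · simp [h1 p hp]
    · simp [h2 p hp q hq h]
    · simp [h3 p hp w hw h]

lemma clusterFun_antitone (hd : d₁ ⊆ d₂) (hb : b₂ ⊆ b₁) :
    Λ.clusterFun B d₁ b₁ W ≤ Λ.clusterFun B d₂ b₂ W := by
  rintro f ⟨h1, h2, h3⟩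
  exact ⟨h1, fun p hp q hq h => h2 p hp q hq (h.mono hd hb),
    fun p hp w hw h => h3 p hp w hw (h.mono hd hb)⟩

/-- Evaluation at one representative per free cluster is an isomorphism onto the functions on free
clusters. Representatives outside the finite set `B` exist because the time-lines have positive
length; taking `B` to contain all deaths gives different configurations a common domain of
functions. -/
lemma finite_finrank_clusterFun (hst : Λ.s < Λ.t) (hB : B.Finite) (hd : d ⊆ B) :
    FiniteDimensional ℝ (Λ.clusterFun B d b W) ∧
      Module.finrank ℝ (Λ.clusterFun B d b W) = Λ.freeCount d b W := by
  classical
  have hdf := hB.subset hd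
  have hfin := freeClusters_finite (Λ := Λ) (b := b) (W := W) hdf
  have := hfin.fintype
  have hpt : ∀ C : Λ.freeClusters d b W, ∃ q, q ∈ Λ.carrier \ B ∧ Λ.Conn d b q q ∧
      C.1 = Λ.cl d b q := by
    rintro ⟨C, ⟨p, hp, rfl⟩, hC⟩
    obtain ⟨q, hq, h⟩ := exists_conn_notMem hst hdf hB hp
    exact ⟨q, hq, h.symm.trans h, cl_eq_of_conn h⟩
  choose pt hV hself hcl using hpt
  let L : Λ.clusterFun B d b W →ₗ[ℝ] (Λ.freeClusters d b W → ℝ) :=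
    { toFun := fun f C => f.1 (pt C)
      map_add' := fun f g => rfl
      map_smul' := fun c f => rfl }
  have hinj : Function.Injective L := by
    intro f g hfg
    ext p
    by_cases hp : p ∈ Λ.carrier \ B
    · have hpp : Λ.Conn d b p p := conn_refl hp.1 fun h => hp.2 (hd h)
      by_cases hC : Disjoint (Λ.cl d b p) W
      · let C : Λ.freeClusters d b W := ⟨Λ.cl d b p, ⟨p, hpp, rfl⟩, hC⟩
        have hc : Λ.Conn d b p (pt C) := by
          have : pt C ∈ C.1 := by rw [hcl]; exact hself C
          exact this
        rw [f.2.2.1 p hp _ (hV C) hc, g.2.2.1 p hp _ (hV C) hc]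
        exact congrFun hfg C
      · obtain ⟨w, hw, hwW⟩ := Set.not_disjoint_iff.1 hC
        rw [f.2.2.2 p hp w hwW hw, g.2.2.2 p hp w hwW hw]
    · rw [f.2.1 p hp, g.2.1 p hp]
  have hsurj : Function.Surjective L := by
    intro g
    let f : Pt → ℝ := fun p => if h : p ∈ Λ.carrier \ B ∧ Disjoint (Λ.cl d b p) W then
      g ⟨Λ.cl d b p, ⟨p, conn_refl h.1.1 fun h' => h.1.2 (hd h'), rfl⟩, h.2⟩ else 0
    refine ⟨⟨f, fun p hp => ?_, fun p hp q hq h => ?_, fun p hp w hw h => ?_⟩, ?_⟩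
    · simp only [f]
      rw [dif_neg (fun h => hp h.1)]
    · simp only [f, cl_eq_of_conn h, hp, hq]
    · simp only [f]
      rw [dif_neg]
      rintro ⟨-, hdis⟩
      exact Set.disjoint_left.1 hdis h hw
    · ext C
      simp only [L, f, LinearMap.coe_mk, AddHom.coe_mk]
      have hdis : Disjoint (Λ.cl d b (pt C)) W := by rw [← hcl]; exact C.2.2
      rw [dif_pos ⟨hV C, hdis⟩]
      congr 1
      exact Subtype.ext (hcl C).symm
  let e := LinearEquiv.ofBijective L ⟨hinj, hsurj⟩
  refine ⟨Module.Finite.equiv e.symm, ?_⟩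
  rw [e.finrank_eq, Module.finrank_pi, freeCount, Set.ncard_eq_toFinset_card', Set.toFinset_card]

/-- A set of points is saturated if it is a union of classes of the top/bottom identification. -/
def Sat (Λ : Box) (d : Set Pt) : Prop := ∀ p q, p ∈ d → Λ.Glued p q → q ∈ d

lemma Sat.union (h₁ : Λ.Sat d₁) (h₂ : Λ.Sat d₂) : Λ.Sat (d₁ ∪ d₂) :=
  fun p q hp hg => hp.imp (fun h => h₁ p q h hg) (fun h => h₂ p q h hg)

/-- No bridge of `b` has an endpoint in `d`. -/
def BrOff (b d : Set Pt) : Prop := ∀ e ∈ b, e ∉ d ∧ (e.1 + 1, e.2) ∉ d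

/-- A function constant on the clusters of both configurations is constant on those of the
configuration with deaths `d₁ ∩ d₂` and bridges `b₁ ∪ b₂`. A path there may pass through points dead
in one of the two, where the function vanishes by convention; its value must be carried across them.
-/
lemma clusterFun_inf_le (h1f : d₁.Finite) (h2f : d₂.Finite) (hs₁ : Λ.Sat d₁) (hs₂ : Λ.Sat d₂)
    (hst : Λ.s < Λ.t) (hbr : BrOff (b₁ ∪ b₂) (d₁ ∪ d₂)) :
    Λ.clusterFun (d₁ ∪ d₂) d₁ b₁ W ⊓ Λ.clusterFun (d₁ ∪ d₂) d₂ b₂ W ≤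
      Λ.clusterFun (d₁ ∪ d₂) (d₁ ∩ d₂) (b₁ ∪ b₂) W := by
  rintro f ⟨⟨hf0, hf1, hf2⟩, ⟨-, hg1, hg2⟩⟩
  set V := Λ.carrier \ (d₁ ∪ d₂) with hV
  -- `R z c` says that `c` is the right value at `z`, read off from nearby points of `V` through
  -- whichever configuration leaves `z` alive. On `V` it means `f z = c`.
  let R : Pt → ℝ → Prop := fun z c =>
    (z ∉ d₁ → ∀ v ∈ V, Λ.Conn d₁ b₁ z v → f v = c) ∧
    (z ∉ d₂ → ∀ v ∈ V, Λ.Conn d₂ b₂ z v → f v = c)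
  have hRV : ∀ z ∈ V, ∀ c, R z c ↔ f z = c := by
    intro z hz c
    have h1 : z ∉ d₁ := fun h => hz.2 (Or.inl h)
    have h2 : z ∉ d₂ := fun h => hz.2 (Or.inr h)
    constructor
    · intro h
      exact h.1 h1 z hz (conn_refl hz.1 h1)
    · rintro rfl
      exact ⟨fun _ v hv hc => (hf1 z hz v hv hc).symm, fun _ v hv hc => (hg1 z hz v hv hc).symm⟩
  -- `R` is locally constant along time-lines off the common deaths, since all points near `z` other
  -- than `z` lie in `V`. Connectedness of intervals then transports it along segments.
  have hloc : ∀ z ∈ Λ.carrier, z ∉ d₁ ∩ d₂ → ∃ ε > 0, ∀ y ∈ Λ.carrier, y.1 = z.1 →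
      |y.2 - z.2| < ε → ∀ c, (R z c ↔ R y c) := by
    intro z hz hzd
    have hA : ∃ ε > 0, ∀ y, y.1 = z.1 → |y.2 - z.2| < ε → y ≠ z → y ∉ d₁ ∪ d₂ := by
      obtain ⟨ε, hε, h⟩ := exists_free_nhd (d := (d₁ ∪ d₂) \ {z}) (p := z)
        ((h1f.union h2f).subset Set.sdiff_subset) (by simp)
      refine ⟨ε, hε, fun y hy1 hy2 hne hyd => h y.2 hy2 ?_⟩
      rw [← hy1]
      exact ⟨hyd, hne⟩
    have hC1 : ∃ ε > 0, ∀ y ∈ Λ.carrier, y.1 = z.1 → |y.2 - z.2| < ε → z ∉ d₁ →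
        Λ.Conn d₁ b₁ z y := by
      by_cases h : z ∈ d₁
      · exact ⟨1, one_pos, fun _ _ _ _ h' => absurd h h'⟩
      · obtain ⟨ε, hε, h'⟩ := exists_conn_nhd (b := b₁) h1f hz h
        exact ⟨ε, hε, fun y hy h1 h2 _ => h' y hy h1 h2⟩
    have hC2 : ∃ ε > 0, ∀ y ∈ Λ.carrier, y.1 = z.1 → |y.2 - z.2| < ε → z ∉ d₂ →
        Λ.Conn d₂ b₂ z y := by
      by_cases h : z ∈ d₂
      · exact ⟨1, one_pos, fun _ _ _ _ h' => absurd h h'⟩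
      · obtain ⟨ε, hε, h'⟩ := exists_conn_nhd (b := b₂) h2f hz h
        exact ⟨ε, hε, fun y hy h1 h2 _ => h' y hy h1 h2⟩
    obtain ⟨ε₀, hε₀, h0⟩ := hA
    obtain ⟨ε₁, hε₁, h1⟩ := hC1
    obtain ⟨ε₂, hε₂, h2⟩ := hC2
    refine ⟨min ε₀ (min ε₁ ε₂), by positivity, fun y hy hy1 hy2 c => ?_⟩
    rw [lt_min_iff, lt_min_iff] at hy2
    by_cases hyz : y = z
    · rw [hyz]
    have hyV : y ∈ V := ⟨hy, h0 y hy1 hy2.1 hyz⟩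
    rw [hRV y hyV]
    constructor
    · intro hR
      by_cases hz1 : z ∈ d₁
      · have hz2 : z ∉ d₂ := fun h => hzd ⟨hz1, h⟩
        exact hR.2 hz2 y hyV (h2 y hy hy1 hy2.2.2 hz2)
      · exact hR.1 hz1 y hyV (h1 y hy hy1 hy2.2.1 hz1)
    · rintro rfl
      exact ⟨fun hz1 v hv hc => (hf1 y hyV v hv ((h1 y hy hy1 hy2.2.1 hz1).symm.trans hc)).symm,
        fun hz2 v hv hc => (hg1 y hyV v hv ((h2 y hy hy1 hy2.2.2 hz2).symm.trans hc)).symm⟩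
  have hseg : ∀ x y : Pt, x ∈ Λ.carrier → y ∈ Λ.carrier → x.1 = y.1 →
      (∀ u ∈ Set.uIcc x.2 y.2, (x.1, u) ∉ d₁ ∩ d₂) → ∀ c, R x c → R y c := by
    intro x y hx hy hxy hfree c hxc
    have hpre : IsPreconnected (Set.uIcc x.2 y.2) := isPreconnected_uIcc
    have := hpre.induction₂' (fun u v => R (x.1, u) c → R (x.1, v) c) ?_ ?_
      (x := x.2) (y := y.2) Set.left_mem_uIcc Set.right_mem_uIcc
    · have h := this hxc
      rwa [hxy] at h
    · intro u hu
      obtain ⟨ε, hε, h⟩ := hloc (x.1, u) (Step.carrier_segment hx hy hu) (hfree u hu)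
      filter_upwards [self_mem_nhdsWithin, nhdsWithin_le_nhds (Metric.ball_mem_nhds u hε)] with
        v hv hv'
      have := h (x.1, v) (Step.carrier_segment hx hy hv) rfl (by simpa [Real.dist_eq] using hv') c
      exact ⟨this.1, this.2⟩
    · intro u v w _ _ _ h1 h2 h3
      exact h2 (h1 h3)
  have hstep : ∀ x y c, Λ.Step (d₁ ∩ d₂) (b₁ ∪ b₂) x y → R x c → R y c := by
    rintro x y c ⟨hx, hy, hxd, hyd, hs⟩ hxc
    rcases hs with ⟨h1, h2⟩ | ⟨h1, h2⟩ | hs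
    · exact hseg x y hx hy h1 h2 c hxc
    · have hV' : x ∈ V ∧ y ∈ V := by
        rcases h2 with ⟨h2, h3⟩ | ⟨h2, h3⟩
        · have := hbr x h3
          rw [show ((x.1 + 1, x.2) : Pt) = y from Prod.ext h2.symm h1] at this
          exact ⟨⟨hx, this.1⟩, ⟨hy, this.2⟩⟩
        · have := hbr y h3
          rw [show ((y.1 + 1, y.2) : Pt) = x from Prod.ext h2.symm h1.symm] at this
          exact ⟨⟨hx, this.2⟩, ⟨hy, this.1⟩⟩
      obtain ⟨hxV, hyV⟩ := hV'
      rw [hRV x hxV] at hxc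
      rw [hRV y hyV, ← hxc]
      have e1 : ∀ {z}, z ∈ V → z ∉ d₁ := fun h h' => h.2 (Or.inl h')
      have e2 : ∀ {z}, z ∈ V → z ∉ d₂ := fun h h' => h.2 (Or.inr h')
      have hor : Λ.Conn d₁ b₁ x y ∨ Λ.Conn d₂ b₂ x y := by
        rcases h2 with ⟨h2, h3 | h3⟩ | ⟨h2, h3 | h3⟩
        · exact Or.inl (.single ⟨hx, hy, e1 hxV, e1 hyV, Or.inr (Or.inl ⟨h1, Or.inl ⟨h2, h3⟩⟩)⟩)
        · exact Or.inr (.single ⟨hx, hy, e2 hxV, e2 hyV, Or.inr (Or.inl ⟨h1, Or.inl ⟨h2, h3⟩⟩)⟩)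
        · exact Or.inl (.single ⟨hx, hy, e1 hxV, e1 hyV, Or.inr (Or.inl ⟨h1, Or.inr ⟨h2, h3⟩⟩)⟩)
        · exact Or.inr (.single ⟨hx, hy, e2 hxV, e2 hyV, Or.inr (Or.inl ⟨h1, Or.inr ⟨h2, h3⟩⟩)⟩)
      rcases hor with h | h
      · exact (hf1 x hxV y hyV h).symm
      · exact (hg1 x hxV y hyV h).symm
    · refine ⟨fun hy1 v hv hc => ?_, fun hy2 v hv hc => ?_⟩
      · have hx1 : x ∉ d₁ := fun h => hy1 (hs₁ x y h hs)
        exact hxc.1 hx1 v hv (Relation.TransGen.head ⟨hx, hy, hx1, hy1, Or.inr (Or.inr hs)⟩ hc)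
      · have hx2 : x ∉ d₂ := fun h => hy2 (hs₂ x y h hs)
        exact hxc.2 hx2 v hv (Relation.TransGen.head ⟨hx, hy, hx2, hy2, Or.inr (Or.inr hs)⟩ hc)
  have hconn : ∀ x y c, Λ.Conn (d₁ ∩ d₂) (b₁ ∪ b₂) x y → R x c → R y c := by
    intro x y c h hx
    exact Conn.induction (P := fun z => R z c) h hx fun u v _ hu hs => hstep u v c hs hu
  refine ⟨hf0, fun p hp q hq h => ?_, fun p hp w hw h => ?_⟩
  · have := hconn p q (f p) h ((hRV p hp _).2 rfl)
    exact ((hRV q hq _).1 this).symm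
  · have hR := hconn p w (f p) h ((hRV p hp _).2 rfl)
    have hwd := h.mem_right
    by_cases hw1 : w ∈ d₁
    · have hw2 : w ∉ d₂ := fun h => hwd.2 ⟨hw1, h⟩
      obtain ⟨v, hv, hc⟩ := exists_conn_notMem (b := b₂) hst h2f (h1f.union h2f)
        (conn_refl hwd.1 hw2)
      rw [← hR.2 hw2 v hv hc]
      exact hg2 v hv w hw hc.symm
    · obtain ⟨v, hv, hc⟩ := exists_conn_notMem (b := b₁) hst h1f (h1f.union h2f)
        (conn_refl hwd.1 hw1)
      rw [← hR.1 hw1 v hv hc]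
      exact hf2 v hv w hw hc.symm

/-- The number of free clusters is supermodular. -/
theorem freeCount_supermodular (h1f : d₁.Finite) (h2f : d₂.Finite) (hs₁ : Λ.Sat d₁)
    (hs₂ : Λ.Sat d₂) (hst : Λ.s < Λ.t) (hbr : BrOff (b₁ ∪ b₂) (d₁ ∪ d₂)) :
    Λ.freeCount d₁ b₁ W + Λ.freeCount d₂ b₂ W ≤
      Λ.freeCount (d₁ ∪ d₂) (b₁ ∩ b₂) W + Λ.freeCount (d₁ ∩ d₂) (b₁ ∪ b₂) W := by
  have hB := h1f.union h2f
  obtain ⟨i1, e1⟩ := finite_finrank_clusterFun (b := b₁) (W := W) hst hB Set.subset_union_left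
  obtain ⟨i2, e2⟩ := finite_finrank_clusterFun (b := b₂) (W := W) hst hB Set.subset_union_right
  obtain ⟨i3, e3⟩ := finite_finrank_clusterFun (b := b₁ ∩ b₂) (W := W) hst hB subset_rfl
  obtain ⟨i4, e4⟩ := finite_finrank_clusterFun (b := b₁ ∪ b₂) (W := W) hst hB
    (Set.inter_subset_left.trans Set.subset_union_left : d₁ ∩ d₂ ⊆ d₁ ∪ d₂)
  -- The counts are dimensions, and `dim U + dim V = dim (U + V) + dim (U ∩ V)`.
  rw [← e1, ← e2, ← e3, ← e4, ← Submodule.finrank_sup_add_finrank_inf_eq]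
  refine add_le_add (Submodule.finrank_mono (sup_le ?_ ?_)) (Submodule.finrank_mono ?_)
  · exact clusterFun_antitone Set.subset_union_left Set.inter_subset_left
  · exact clusterFun_antitone Set.subset_union_right Set.inter_subset_right
  · exact clusterFun_inf_le h1f h2f hs₁ hs₂ hst hbr

end Supermodular

end Box


/-! ### Splitting a Poisson process. -/

section Poisson

variable {X : Type} [MeasurableSpace X]

lemma measurableEmbedding_sigma_mk (n : ℕ) :
    MeasurableEmbedding (fun x : Fin n → X => (⟨n, x⟩ : PointList X)) where
  injective := fun a c h => by simpa using h
  measurable := measurable_sigma_mk n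
  measurableSet_image' := by
    intro s hs
    refine MeasurableSpace.measurableSet_iInf.2 fun m => ?_
    change MeasurableSet ((fun x : Fin m → X => (⟨m, x⟩ : PointList X)) ⁻¹' _)
    by_cases h : m = n
    · subst h
      rwa [Set.preimage_image_eq _ fun a c h => by simpa using h]
    · convert MeasurableSet.empty
      ext x
      simp only [Set.mem_preimage, Set.mem_image, Set.mem_empty_iff_false, iff_false]
      rintro ⟨y, -, hy⟩
      exact h (congrArg Sigma.fst hy).symm

/-- The weight of the configurations with `n` points. -/
noncomputable def poissonCoeff (μ : Measure X) (n : ℕ) : ℝ≥0∞ :=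
  ENNReal.ofReal (Real.exp (-(μ Set.univ).toReal) / (n.factorial : ℝ))

lemma lintegral_poissonProcess (μ : Measure X) (F : PointList X → ℝ≥0∞) :
    ∫⁻ c, F c ∂(poissonProcess μ) =
      ∑' n, poissonCoeff μ n * ∫⁻ x, F ⟨n, x⟩ ∂(Measure.pi fun _ : Fin n => μ) := by
  unfold poissonProcess
  rw [lintegral_sum_measure]
  congr 1
  ext n
  rw [lintegral_smul_measure, (measurableEmbedding_sigma_mk n).lintegral_map]
  rfl

lemma ae_poissonProcess_of_forall {μ : Measure X} {P : PointList X → Prop}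
    (h : ∀ n, ∀ᵐ x ∂(Measure.pi fun _ : Fin n => μ), P ⟨n, x⟩) :
    ∀ᵐ c ∂(poissonProcess μ), P c := by
  unfold poissonProcess
  rw [Measure.ae_sum_iff]
  intro n
  exact Measure.ae_smul_measure ((measurableEmbedding_sigma_mk n).ae_map_iff.2 (h n)) _

/-- The exponential moment that makes random-cluster integrals finite: the cluster count is at most
the number of deaths plus a constant. -/
lemma lintegral_pow_poissonProcess (μ : Measure X) [IsFiniteMeasure μ] (K : ℕ) :
    ∫⁻ c, (K : ℝ≥0∞) ^ c.1 ∂(poissonProcess μ) < ∞ := by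
  rw [lintegral_poissonProcess]
  have : ∀ n, poissonCoeff μ n * ∫⁻ _ : Fin n → X, (K : ℝ≥0∞) ^ n ∂(Measure.pi fun _ => μ) =
      ENNReal.ofReal (Real.exp (-(μ Set.univ).toReal) *
        ((K * (μ Set.univ).toReal) ^ n / n.factorial)) := by
    intro n
    rw [lintegral_const, Measure.pi_univ, Finset.prod_const, Finset.card_univ, Fintype.card_fin,
      poissonCoeff, ← mul_pow]
    have hK : (K : ℝ≥0∞) * μ Set.univ = ENNReal.ofReal (K * (μ Set.univ).toReal) := by
      rw [ENNReal.ofReal_mul (by positivity), ENNReal.ofReal_natCast,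
        ENNReal.ofReal_toReal (measure_ne_top _ _)]
    rw [hK, ← ENNReal.ofReal_pow (by positivity), ← ENNReal.ofReal_mul (by positivity)]
    congr 1
    ring
  simp only [this]
  rw [← ENNReal.ofReal_tsum_of_nonneg (fun n => by positivity)
    ((Real.summable_pow_div_factorial _).mul_left _)]
  exact ENNReal.ofReal_lt_top

instance isFiniteMeasure_poissonProcess (μ : Measure X) [IsFiniteMeasure μ] :
    IsFiniteMeasure (poissonProcess μ) :=
  ⟨by simpa using lintegral_pow_poissonProcess μ 1⟩

/-- For a fixed index set `I`, the coordinates in `I` and those outside it are independent under the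
product measure; only their unordered ranges matter. -/
lemma lintegral_pi_split (μ : Measure X) [IsFiniteMeasure μ] {g : Set X → Set X → ℝ≥0∞}
    (hg : Measurable fun c : PointList X × PointList X => g c.1.points c.2.points)
    {n i j : ℕ} (I : Finset (Fin n)) (hi : I.card = i) (hj : Iᶜ.card = j) :
    ∫⁻ x, g (x '' I) (x '' (Iᶜ : Finset (Fin n))) ∂(Measure.pi fun _ : Fin n => μ) =
      ∫⁻ y : Fin i → X, ∫⁻ z : Fin j → X, g (Set.range y) (Set.range z)
        ∂(Measure.pi fun _ => μ) ∂(Measure.pi fun _ => μ) := by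
  let e : Fin i ⊕ Fin j ≃ Fin n := finSumEquivOfFinset hi hj
  have h1 := measurePreserving_piCongrLeft (α := fun _ : Fin n => X) (fun _ => μ) e
  have h2 := measurePreserving_sumPiEquivProdPi_symm (X := fun _ : Fin i ⊕ Fin j => X)
    (fun _ => μ)
  have h3 := h1.comp h2
  have hmeas : Measurable fun x : Fin n → X => g (x '' I) (x '' (Iᶜ : Finset (Fin n))) := by
    have : (fun x : Fin n → X => g (x '' I) (x '' (Iᶜ : Finset (Fin n)))) =
        (fun c : PointList X × PointList X => g c.1.points c.2.points) ∘ fun x =>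
          ((⟨_, x ∘ I.orderEmbOfFin hi⟩, ⟨_, x ∘ Iᶜ.orderEmbOfFin hj⟩) :
            PointList X × PointList X) := by
      ext x
      simp [PointList.points, Set.range_comp]
    rw [this]
    refine hg.comp (Measurable.prodMk ?_ ?_)
    · exact (measurable_sigma_mk i).comp
        (measurable_pi_lambda _ fun a => measurable_pi_apply _)
    · exact (measurable_sigma_mk j).comp
        (measurable_pi_lambda _ fun a => measurable_pi_apply _)
  rw [← h3.lintegral_comp hmeas, lintegral_prod]
  · refine lintegral_congr fun y => lintegral_congr fun z => ?_
    have key : ∀ a : Fin i ⊕ Fin j, (MeasurableEquiv.piCongrLeft (fun _ : Fin n => X) e)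
        ((MeasurableEquiv.sumPiEquivProdPi fun _ : Fin i ⊕ Fin j => X).symm (y, z)) (e a) =
        Sum.elim y z a := by
      intro a
      rw [MeasurableEquiv.coe_piCongrLeft, Equiv.piCongrLeft_apply_apply]
      cases a <;> rfl
    have hI : (I : Set (Fin n)) = Set.range fun a => e (Sum.inl a) := by
      simp [e, finSumEquivOfFinset_inl]
    have hIc : ((Iᶜ : Finset (Fin n)) : Set (Fin n)) = Set.range fun a => e (Sum.inr a) := by
      simp only [e, finSumEquivOfFinset_inr, Finset.range_orderEmbOfFin]
    simp only [Function.comp_apply]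
    rw [hI, hIc, ← Set.range_comp, ← Set.range_comp]
    congr 1
    · congr 1
      ext a
      exact key (Sum.inl a)
    · congr 1
      ext a
      exact key (Sum.inr a)
  · exact (hmeas.comp h3.measurable).aemeasurable

lemma ENNReal.tsum_tsum_eq_tsum_antidiagonal (F : ℕ → ℕ → ℝ≥0∞) :
    ∑' i, ∑' j, F i j = ∑' n, ∑ q ∈ Finset.HasAntidiagonal.antidiagonal n, F q.1 q.2 := by
  rw [← ENNReal.tsum_prod (f := F),
    ← Finset.HasAntidiagonal.sigmaAntidiagonalEquivProd.tsum_eq (fun q : ℕ × ℕ => F q.1 q.2),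
    ENNReal.tsum_sigma']
  congr 1
  ext n
  rw [tsum_fintype]
  exact Finset.sum_coe_sort (Finset.HasAntidiagonal.antidiagonal n) (fun q : ℕ × ℕ => F q.1 q.2)

/-- Two independent Poisson processes are obtained by splitting a configuration into two parts
in all possible ways. -/
theorem lintegral_poissonProcess_split (μ : Measure X) [IsFiniteMeasure μ]
    {g : Set X → Set X → ℝ≥0∞}
    (hg : Measurable fun c : PointList X × PointList X => g c.1.points c.2.points) :
    ∫⁻ c, ∫⁻ c', g c.points c'.points ∂(poissonProcess μ) ∂(poissonProcess μ) =
      ENNReal.ofReal (Real.exp (-(μ Set.univ).toReal)) *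
        ∫⁻ c, ∑ I : Finset (Fin c.1), g (c.2 '' I) (c.2 '' (Iᶜ : Finset (Fin c.1)))
          ∂(poissonProcess μ) := by
  set G : ℕ → ℕ → ℝ≥0∞ := fun i j => ∫⁻ y : Fin i → X, ∫⁻ z : Fin j → X,
    g (Set.range y) (Set.range z) ∂(Measure.pi fun _ => μ) ∂(Measure.pi fun _ => μ) with hG
  have hL : ∫⁻ c, ∫⁻ c', g c.points c'.points ∂(poissonProcess μ) ∂(poissonProcess μ) =
      ∑' i, ∑' j, poissonCoeff μ i * poissonCoeff μ j * G i j := by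
    rw [lintegral_poissonProcess]
    congr 1
    ext i
    simp_rw [lintegral_poissonProcess]
    rw [lintegral_tsum, ← ENNReal.tsum_mul_left]
    · congr 1
      ext j
      rw [lintegral_const_mul', mul_assoc]
      · rfl
      · exact ENNReal.ofReal_ne_top
    · intro j
      refine (Measurable.const_mul ?_ _).aemeasurable
      have : Measurable fun q : (Fin i → X) × (Fin j → X) => g (Set.range q.1) (Set.range q.2) :=
        hg.comp (((measurable_sigma_mk i).comp measurable_fst).prodMk
          ((measurable_sigma_mk j).comp measurable_snd))
      exact this.lintegral_prod_right'
  have hR : ∫⁻ c, ∑ I : Finset (Fin c.1), g (c.2 '' I) (c.2 '' (Iᶜ : Finset (Fin c.1)))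
      ∂(poissonProcess μ) = ∑' n, poissonCoeff μ n *
        ∑ q ∈ Finset.HasAntidiagonal.antidiagonal n, (n.choose q.1 : ℝ≥0∞) * G q.1 q.2 := by
    rw [lintegral_poissonProcess]
    congr 1
    ext n
    congr 1
    have hm : ∀ I : Finset (Fin n),
        Measurable fun x : Fin n → X => g (x '' I) (x '' (Iᶜ : Finset (Fin n))) := by
      intro I
      have : (fun x : Fin n → X => g (x '' I) (x '' (Iᶜ : Finset (Fin n)))) =
          (fun c : PointList X × PointList X => g c.1.points c.2.points) ∘ fun x =>
            ((⟨_, x ∘ I.orderEmbOfFin rfl⟩, ⟨_, x ∘ Iᶜ.orderEmbOfFin rfl⟩) :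
              PointList X × PointList X) := by
        ext x
        simp [PointList.points, Set.range_comp]
      rw [this]
      exact hg.comp (Measurable.prodMk
        ((measurable_sigma_mk _).comp (measurable_pi_lambda _ fun a => measurable_pi_apply _))
        ((measurable_sigma_mk _).comp (measurable_pi_lambda _ fun a => measurable_pi_apply _)))
    change ∫⁻ x : Fin n → X, ∑ I : Finset (Fin n), g (x '' I) (x '' (Iᶜ : Finset (Fin n)))
      ∂(Measure.pi fun _ => μ) = _
    rw [lintegral_finsetSum _ fun I _ => hm I]
    have hI : ∀ I : Finset (Fin n),
        ∫⁻ x, g (x '' I) (x '' (Iᶜ : Finset (Fin n))) ∂(Measure.pi fun _ : Fin n => μ) =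
          G I.card (n - I.card) := fun I =>
      lintegral_pi_split μ hg I rfl (by rw [Finset.card_compl, Fintype.card_fin])
    simp_rw [hI]
    have := Finset.sum_powerset_apply_card (fun k => G k (n - k))
      (x := (Finset.univ : Finset (Fin n)))
    rw [Finset.powerset_univ, Finset.card_univ, Fintype.card_fin] at this
    rw [this, Finset.Nat.sum_antidiagonal_eq_sum_range_succ
      (fun i j => (n.choose i : ℝ≥0∞) * G i j)]
    simp [nsmul_eq_mul]
  rw [hL, hR, ENNReal.tsum_tsum_eq_tsum_antidiagonal, ← ENNReal.tsum_mul_left]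
  congr 1
  ext n
  rw [Finset.mul_sum, Finset.mul_sum]
  -- Coefficients match: with `n = i + j` and total mass `m`, `e⁻ᵐ/i! · e⁻ᵐ/j! = e⁻ᵐ · (e⁻ᵐ/n!) ·
  -- n.choose i`.
  refine Finset.sum_congr rfl fun q hq => ?_
  rw [Finset.HasAntidiagonal.mem_antidiagonal] at hq
  rw [← mul_assoc, ← mul_assoc]
  congr 1
  unfold poissonCoeff
  rw [← ENNReal.ofReal_mul (by positivity), ← ENNReal.ofReal_mul (by positivity),
    ← ENNReal.ofReal_natCast, ← ENNReal.ofReal_mul (by positivity)]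
  congr 1
  rw [← hq]
  have h : (((q.1 + q.2).choose q.1 : ℕ) : ℝ) * q.1.factorial * q.2.factorial =
      (q.1 + q.2).factorial := by
    rw [Nat.choose_symm_add]
    exact_mod_cast Nat.add_choose_mul_factorial_mul_factorial q.1 q.2
  have h1 : (q.1.factorial : ℝ) ≠ 0 := by positivity
  have h2 : (q.2.factorial : ℝ) ≠ 0 := by positivity
  have h3 : ((q.1 + q.2).factorial : ℝ) ≠ 0 := by positivity
  rw [div_mul_div_comm, ← mul_div_assoc, div_mul_eq_mul_div, div_eq_div_iff (by positivity) h3,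
    ← h]
  ring

/-- Distinct labels carry distinct points, so that intersections and complements of index sets
correspond to those of point sets. -/
lemma ae_injective_pi (μ : Measure X) [IsFiniteMeasure μ] [MeasurableEq X]
    (hμ : ∀ x, μ {x} = 0) (n : ℕ) :
    ∀ᵐ x ∂(Measure.pi fun _ : Fin n => μ), Function.Injective x := by
  have h : ∀ i j : Fin n, i ≠ j → ∀ᵐ x ∂(Measure.pi fun _ : Fin n => μ), x i ≠ x j := by
    intro i j hij
    cases n with
    | zero => exact i.elim0
    | succ n =>
      obtain ⟨k, rfl⟩ := Fin.exists_succAbove_eq hij.symm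
      have hmp := measurePreserving_piFinSuccAbove (fun _ : Fin (n + 1) => μ) i
      have hms : MeasurableSet {q : X × (Fin n → X) | q.1 ≠ q.2 k} :=
        (measurableSet_eq_fun (g := fun q : X × (Fin n → X) => q.2 k) measurable_fst
          (by fun_prop)).mem.not.setOf
      have hae : ∀ᵐ q ∂(μ.prod (Measure.pi fun _ : Fin n => μ)), q.1 ≠ q.2 k := by
        rw [Measure.ae_prod_iff_ae_ae hms]
        refine ae_of_all _ fun a => ?_
        have : ∀ᵐ y ∂μ, a ≠ y := by
          rw [ae_iff]
          simpa [eq_comm] using hμ a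
        exact (Measure.tendsto_eval_ae_ae (μ := fun _ : Fin n => μ) (i := k)).eventually this
      exact hmp.quasiMeasurePreserving.ae hae
  have : ∀ᵐ x ∂(Measure.pi fun _ : Fin n => μ), ∀ i j, i ≠ j → x i ≠ x j := by
    simp only [ae_all_iff]
    exact h
  filter_upwards [this] with x hx i j hij
  by_contra hne
  exact hx i j hne hij

end Poisson

/-! ### The four functions theorem for complementary pairs. -/

section FourFunctions

/-- The four functions theorem in complementary degrees. -/
lemma sum_mul_compl_le {α : Type} [BooleanAlgebra α] [Fintype α] (f₁ f₂ f₃ f₄ : α → ℕ)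
    (h : ∀ a c, f₁ a * f₂ c ≤ f₃ (a ⊔ c) * f₄ (a ⊓ c)) :
    ∑ a, f₁ a * f₂ aᶜ ≤ ∑ a, f₃ a * f₄ aᶜ := by
  classical
  -- The two products on each side are exchanged by complementation, so they have equal sums. The
  -- theorem therefore gives the square of the desired inequality.
  have key := four_functions_theorem (fun a => f₁ a * f₂ aᶜ) (fun c => f₁ cᶜ * f₂ c)
    (fun a => f₃ aᶜ * f₄ a) (fun a => f₃ a * f₄ aᶜ) (fun _ => Nat.zero_le _)
    (fun _ => Nat.zero_le _) (fun _ => Nat.zero_le _) (fun _ => Nat.zero_le _) ?_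
    Finset.univ Finset.univ
  · have h1 : ∑ c : α, f₁ cᶜ * f₂ c = ∑ a, f₁ a * f₂ aᶜ :=
      Fintype.sum_equiv (Equiv.mk compl compl compl_compl compl_compl) _ _ (by simp)
    have h2 : ∑ c : α, f₃ cᶜ * f₄ c = ∑ a, f₃ a * f₄ aᶜ :=
      Fintype.sum_equiv (Equiv.mk compl compl compl_compl compl_compl) _ _ (by simp)
    rw [h1] at key
    have key2 := key.trans (Nat.mul_le_mul
      (Finset.sum_le_univ_sum_of_nonneg fun _ => Nat.zero_le _)
      (Finset.sum_le_univ_sum_of_nonneg fun _ => Nat.zero_le _))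
    rw [h2] at key2
    exact Nat.mul_self_le_mul_self_iff.1 key2
  · intro a c
    have e1 := h a c
    have e2 := h cᶜ aᶜ
    rw [← compl_inf, ← compl_sup, inf_comm c a, sup_comm c a] at e2
    calc f₁ a * f₂ aᶜ * (f₁ cᶜ * f₂ c) = (f₁ a * f₂ c) * (f₁ cᶜ * f₂ aᶜ) := by ring
      _ ≤ (f₃ (a ⊔ c) * f₄ (a ⊓ c)) * (f₃ (a ⊓ c)ᶜ * f₄ (a ⊔ c)ᶜ) := Nat.mul_le_mul e1 e2
      _ = _ := by ring

end FourFunctions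


/-! ### The percolation measure: general position and splitting. -/

section Percolation

lemma lineMeasure_time (c : ℝ) : lineMeasure {p : Pt | p.2 = c} = 0 := by
  have : {p : Pt | p.2 = c} = Set.univ ×ˢ {c} := by
    ext p
    simp
  rw [this, lineMeasure, Measure.prod_prod]
  simp

namespace Box

variable (Λ : Box) (lam del : ℝ)

lemma lineMeasure_carrier : lineMeasure Λ.carrier =
    ENNReal.ofReal (Λ.b + 1 - Λ.a) * ENNReal.ofReal (Λ.t - Λ.s) := by
  have : Λ.carrier = Set.Icc Λ.a Λ.b ×ˢ Set.Icc Λ.s Λ.t := by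
    ext p
    simp only [carrier, Set.mem_ofPred_eq, Set.mem_prod, Set.mem_Icc]
    tauto
  rw [this, lineMeasure, Measure.prod_prod, Real.volume_Icc, ← Finset.coe_Icc,
    Measure.count_apply_finset, Int.card_Icc]
  congr 1
  rw [← ENNReal.ofReal_natCast]
  congr 1
  have h : ((Λ.b + 1 - Λ.a).toNat : ℤ) = Λ.b + 1 - Λ.a := Int.toNat_of_nonneg (by
    have := Λ.hab
    omega)
  exact_mod_cast h

/-- The intensity measure of deaths. -/
noncomputable def deathInt : Measure Pt := ENNReal.ofReal del • lineMeasure.restrict Λ.carrier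

/-- The intensity measure of bridges. -/
noncomputable def bridgeInt : Measure Pt :=
  ENNReal.ofReal lam • lineMeasure.restrict {p | p ∈ Λ.carrier ∧ p.1 < Λ.b}

lemma percolation_eq : Λ.percolation lam del =
    (poissonProcess (Λ.deathInt del)).prod (poissonProcess (Λ.bridgeInt lam)) := rfl

instance isFiniteMeasure_deathInt : IsFiniteMeasure (Λ.deathInt del) := by
  refine ⟨?_⟩
  simp only [deathInt, Measure.smul_apply, Measure.restrict_apply_univ, lineMeasure_carrier,
    smul_eq_mul]
  exact ENNReal.mul_lt_top ENNReal.ofReal_lt_top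
    (ENNReal.mul_lt_top ENNReal.ofReal_lt_top ENNReal.ofReal_lt_top)

instance isFiniteMeasure_bridgeInt : IsFiniteMeasure (Λ.bridgeInt lam) := by
  refine ⟨?_⟩
  simp only [bridgeInt, Measure.smul_apply, Measure.restrict_apply_univ, smul_eq_mul]
  refine ENNReal.mul_lt_top ENNReal.ofReal_lt_top
    ((measure_mono (t := Λ.carrier) fun p hp => hp.1).trans_lt ?_)
  rw [lineMeasure_carrier]
  exact ENNReal.mul_lt_top ENNReal.ofReal_lt_top ENNReal.ofReal_lt_top

instance isFiniteMeasure_percolation : IsFiniteMeasure (Λ.percolation lam del) := by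
  rw [percolation_eq]
  infer_instance

lemma deathInt_time (c : ℝ) : Λ.deathInt del {p | p.2 = c} = 0 := by
  simp only [deathInt, Measure.smul_apply, smul_eq_mul]
  rw [nonpos_iff_eq_zero.1 ((Measure.restrict_apply_le _ _).trans (lineMeasure_time c).le),
    mul_zero]

lemma bridgeInt_time (c : ℝ) : Λ.bridgeInt lam {p | p.2 = c} = 0 := by
  simp only [bridgeInt, Measure.smul_apply, smul_eq_mul]
  rw [nonpos_iff_eq_zero.1 ((Measure.restrict_apply_le _ _).trans (lineMeasure_time c).le),
    mul_zero]

lemma ae_deathInt_mem : ∀ᵐ p ∂Λ.deathInt del, p ∈ Λ.carrier :=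
  Measure.ae_smul_measure (ae_restrict_mem Λ.measurableSet_carrier) _

lemma ae_bridgeInt_mem : ∀ᵐ p ∂Λ.bridgeInt lam, p ∈ Λ.carrier := by
  refine Measure.ae_smul_measure ?_ _
  have hm : MeasurableSet {p : Pt | p ∈ Λ.carrier ∧ p.1 < Λ.b} :=
    Λ.measurableSet_carrier.inter (measurableSet_lt measurable_fst measurable_const)
  filter_upwards [ae_restrict_mem hm] with p hp using hp.1

/-- A configuration in general position with respect to the set `N` of times. -/
structure Gen (N : Set ℝ) (d b : Set Pt) : Prop where
  d_fin : d.Finite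
  b_fin : b.Finite
  d_mem : ∀ z ∈ d, z ∈ Λ.carrier
  b_mem : ∀ z ∈ b, z ∈ Λ.carrier
  d_N : ∀ z ∈ d, z.2 ∉ N
  b_N : ∀ z ∈ b, z.2 ∉ N
  ne : ∀ z ∈ d, ∀ e ∈ b, z.2 ≠ e.2

variable {Λ} in
lemma Gen.subset {N : Set ℝ} {d b d' b' : Set Pt} (h : Λ.Gen N d b) (hd : d' ⊆ d) (hb : b' ⊆ b) :
    Λ.Gen N d' b' where
  d_fin := h.d_fin.subset hd
  b_fin := h.b_fin.subset hb
  d_mem z hz := h.d_mem z (hd hz)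
  b_mem z hz := h.b_mem z (hb hz)
  d_N z hz := h.d_N z (hd hz)
  b_N z hz := h.b_N z (hb hz)
  ne z hz e he := h.ne z (hd hz) e (hb he)

lemma ae_point_of_time {μ : Measure Pt} (hμ : ∀ c, μ {p | p.2 = c} = 0)
    (hm : ∀ᵐ p ∂μ, p ∈ Λ.carrier) {N : Set ℝ} (hN : N.Countable) :
    ∀ᵐ p ∂μ, p ∈ Λ.carrier ∧ p.2 ∉ N := by
  refine hm.and ?_
  have : ∀ᵐ p ∂μ, ∀ c ∈ N, p.2 ≠ c := by
    rw [ae_ball_iff hN]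
    intro c _
    rw [ae_iff]
    simpa using hμ c
  filter_upwards [this] with p hp h
  exact hp _ h rfl

lemma ae_pointList {μ : Measure Pt} [IsFiniteMeasure μ] (hμ : ∀ c, μ {p | p.2 = c} = 0)
    (hm : ∀ᵐ p ∂μ, p ∈ Λ.carrier) {N : Set ℝ} (hN : N.Countable) :
    ∀ᵐ c ∂(poissonProcess μ), Function.Injective c.2 ∧
      ∀ i, c.2 i ∈ Λ.carrier ∧ (c.2 i).2 ∉ N := by
  refine ae_poissonProcess_of_forall fun n => ?_
  refine Filter.Eventually.and (ae_injective_pi μ (fun x => ?_) n) ?_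
  · refine measure_mono_null (t := {p | p.2 = x.2}) ?_ (hμ _)
    rintro _ rfl
    rfl
  · have h := Λ.ae_point_of_time hμ hm hN
    have h' : ∀ i : Fin n, ∀ᵐ x ∂(Measure.pi fun _ : Fin n => μ),
        x i ∈ Λ.carrier ∧ (x i).2 ∉ N := fun i =>
      (Measure.tendsto_eval_ae_ae (μ := fun _ : Fin n => μ) (i := i)).eventually h
    exact Filter.eventually_all.2 h'

/-- Times of points have no atoms, so a countable set of times is avoided. That no bridge is
simultaneous with a death follows by Fubini, the finite set of death times serving as the set to
avoid. -/
lemma ae_gen {N : Set ℝ} (hN : N.Countable) : ∀ᵐ ω ∂Λ.percolation lam del,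
    Λ.Gen N ω.deaths ω.bridges ∧ Function.Injective ω.1.2 ∧ Function.Injective ω.2.2 := by
  have h1 := Λ.ae_pointList (Λ.deathInt_time del) (Λ.ae_deathInt_mem del) hN
  have h2 := Λ.ae_pointList (Λ.bridgeInt_time lam) (Λ.ae_bridgeInt_mem lam) hN
  have h3 : ∀ᵐ ω ∂Λ.percolation lam del, ∀ z ∈ ω.deaths, ∀ e ∈ ω.bridges, z.2 ≠ e.2 := by
    rw [percolation_eq, Measure.ae_prod_iff_ae_ae]
    · refine ae_of_all _ fun c => ?_
      have := Λ.ae_pointList (Λ.bridgeInt_time lam) (Λ.ae_bridgeInt_mem lam)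
        (N := (fun z : Pt => z.2) '' c.points) (c.finite_points.image _).countable
      filter_upwards [this] with c' hc'
      rintro z hz _ ⟨j, rfl⟩ h
      exact (hc'.2 j).2 ⟨z, hz, h⟩
    · refine measurableSet_setOfPred.2 (MeasFam.deaths.measurable_forall _ fun z hz =>
        MeasFam.bridges.measurable_forall _ fun e he => ?_)
      exact (measurableSet_eq_fun hz.snd he.snd).mem.not
  have h1' := Measure.quasiMeasurePreserving_fst (μ := poissonProcess (Λ.deathInt del))
    (ν := poissonProcess (Λ.bridgeInt lam)) |>.ae h1
  have h2' := Measure.quasiMeasurePreserving_snd (μ := poissonProcess (Λ.deathInt del))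
    (ν := poissonProcess (Λ.bridgeInt lam)) |>.ae h2
  rw [← percolation_eq] at h1' h2'
  filter_upwards [h1', h2', h3] with ω hd hb hne
  refine ⟨⟨ω.finite_deaths, ω.finite_bridges, ?_, ?_, ?_, ?_, hne⟩, hd.1, hb.1⟩
  · rintro _ ⟨i, rfl⟩
    exact (hd.2 i).1
  · rintro _ ⟨i, rfl⟩
    exact (hb.2 i).1
  · rintro _ ⟨i, rfl⟩
    exact (hd.2 i).2
  · rintro _ ⟨i, rfl⟩
    exact (hb.2 i).2

/-- The normalizing constant in the splitting identity. -/
noncomputable def splitConst : ℝ≥0∞ :=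
  ENNReal.ofReal (Real.exp (-(Λ.deathInt del Set.univ).toReal)) *
    ENNReal.ofReal (Real.exp (-(Λ.bridgeInt lam Set.univ).toReal))

lemma splitConst_pos : Λ.splitConst lam del ≠ 0 := by
  unfold splitConst
  simp only [ne_eq, mul_eq_zero, ENNReal.ofReal_eq_zero, not_or, not_le]
  exact ⟨Real.exp_pos _, Real.exp_pos _⟩

lemma splitConst_ne_top : Λ.splitConst lam del ≠ ∞ :=
  ENNReal.mul_ne_top ENNReal.ofReal_ne_top ENNReal.ofReal_ne_top

lemma measurable_image_pair {X : Type} [MeasurableSpace X] {n : ℕ} (I : Finset (Fin n)) :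
    Measurable fun x : Fin n → X => ((⟨_, x ∘ I.orderEmbOfFin rfl⟩,
      ⟨_, x ∘ Iᶜ.orderEmbOfFin rfl⟩) : PointList X × PointList X) :=
  Measurable.prodMk
    ((measurable_sigma_mk _).comp (measurable_pi_lambda _ fun _ => measurable_pi_apply _))
    ((measurable_sigma_mk _).comp (measurable_pi_lambda _ fun _ => measurable_pi_apply _))

/-- The index set of the sum varies with the configuration, so measurability is checked separately
for each number of points. -/
lemma measurable_sum_split {X Y : Type} [MeasurableSpace X] [MeasurableSpace Y]
    {g : Set X → Set X → Y → ℝ≥0∞}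
    (hg : Measurable fun c : (PointList X × PointList X) × Y => g c.1.1.points c.1.2.points c.2) :
    Measurable fun c : Y × PointList X =>
      ∑ I : Finset (Fin c.2.1), g (c.2.2 '' I) (c.2.2 '' (Iᶜ : Finset (Fin c.2.1))) c.1 := by
  have hemb : ∀ n : ℕ, Measurable fun q : Y × (Fin n → X) =>
      ∑ I : Finset (Fin n), g (q.2 '' I) (q.2 '' (Iᶜ : Finset (Fin n))) q.1 := by
    intro n
    refine Finset.measurable_sum _ fun I _ => ?_
    have : (fun q : Y × (Fin n → X) => g (q.2 '' I) (q.2 '' (Iᶜ : Finset (Fin n))) q.1) =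
        (fun c : (PointList X × PointList X) × Y => g c.1.1.points c.1.2.points c.2) ∘ fun q =>
          ((((⟨_, q.2 ∘ I.orderEmbOfFin rfl⟩, ⟨_, q.2 ∘ Iᶜ.orderEmbOfFin rfl⟩) :
            PointList X × PointList X), q.1)) := by
      ext q
      simp [PointList.points, Set.range_comp]
    rw [this]
    exact hg.comp (((measurable_image_pair I).comp measurable_snd).prodMk measurable_fst)
  intro s hs
  have hcov : ∀ n, MeasurableSet {c : Y × PointList X | c.2.1 = n} := fun n =>
    measurable_snd (measurable_sigma_iff (f := fun c : PointList X => c.1).2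
      (fun m => measurable_const (a := m)) (measurableSet_singleton n))
  have : (fun c : Y × PointList X =>
      ∑ I : Finset (Fin c.2.1), g (c.2.2 '' I) (c.2.2 '' (Iᶜ : Finset (Fin c.2.1))) c.1) ⁻¹' s =
      ⋃ n, (fun q : Y × (Fin n → X) => ((q.1, ⟨n, q.2⟩) : Y × PointList X)) ''
        ((fun q : Y × (Fin n → X) =>
          ∑ I : Finset (Fin n), g (q.2 '' I) (q.2 '' (Iᶜ : Finset (Fin n))) q.1) ⁻¹' s) := by
    ext ⟨y, n, x⟩
    simp only [Set.mem_preimage, Set.mem_iUnion, Set.mem_image]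
    constructor
    · intro h
      exact ⟨n, (y, x), h, rfl⟩
    · rintro ⟨m, q, hq, he⟩
      obtain ⟨h1, h2⟩ := Prod.ext_iff.1 he
      simp only at h1 h2
      subst h1
      obtain ⟨rfl, h3⟩ := Sigma.mk.inj_iff.1 h2
      obtain rfl := eq_of_heq h3
      exact hq
  rw [this]
  refine MeasurableSet.iUnion fun n => ?_
  exact (MeasurableEmbedding.id.prodMap (measurableEmbedding_sigma_mk n)).measurableSet_image.2
    (hemb n hs)

/-- The Poisson splitting is applied to the bridges with both lists of deaths fixed, and then to the
deaths. -/
theorem lintegral_percolation_split {g : Set Pt → Set Pt → Set Pt → Set Pt → ℝ≥0∞}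
    (hg : Measurable fun ω : Config × Config =>
      g ω.1.deaths ω.1.bridges ω.2.deaths ω.2.bridges) :
    ∫⁻ ω, ∫⁻ ω', g ω.deaths ω.bridges ω'.deaths ω'.bridges ∂Λ.percolation lam del
        ∂Λ.percolation lam del =
      Λ.splitConst lam del * ∫⁻ ω, ∑ I : Finset (Fin ω.1.1), ∑ K : Finset (Fin ω.2.1),
        g (ω.1.2 '' I) (ω.2.2 '' K) (ω.1.2 '' (Iᶜ : Finset (Fin ω.1.1)))
          (ω.2.2 '' (Kᶜ : Finset (Fin ω.2.1))) ∂Λ.percolation lam del := by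
  simp only [percolation_eq]
  set νd := poissonProcess (Λ.deathInt del) with hνd
  set νb := poissonProcess (Λ.bridgeInt lam) with hνb
  have hg4 : Measurable fun q : (PointList Pt × PointList Pt) × PointList Pt × PointList Pt =>
      g q.1.1.points q.2.1.points q.1.2.points q.2.2.points :=
    hg.comp (f := fun q : (PointList Pt × PointList Pt) × PointList Pt × PointList Pt =>
      (((q.1.1, q.2.1), (q.1.2, q.2.2)) : Config × Config)) (by fun_prop)
  have hsplitB : ∀ d d' : Set Pt, (∃ c c' : PointList Pt, c.points = d ∧ c'.points = d') →
      ∫⁻ c, ∫⁻ c', g d c.points d' c'.points ∂νb ∂νb =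
      ENNReal.ofReal (Real.exp (-(Λ.bridgeInt lam Set.univ).toReal)) *
        ∫⁻ c, ∑ K : Finset (Fin c.1), g d (c.2 '' K) d' (c.2 '' (Kᶜ : Finset (Fin c.1))) ∂νb := by
    rintro d d' ⟨e, e', rfl, rfl⟩
    exact lintegral_poissonProcess_split (Λ.bridgeInt lam)
      (g := fun S T => g e.points S e'.points T) (hg4.comp (measurable_prodMk_left (x := (e, e'))))
  have hmB : Measurable fun q : (PointList Pt × PointList Pt) × PointList Pt =>
      ∑ K : Finset (Fin q.2.1), g q.1.1.points (q.2.2 '' K) q.1.2.points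
        (q.2.2 '' (Kᶜ : Finset (Fin q.2.1))) :=
    measurable_sum_split (X := Pt) (Y := PointList Pt × PointList Pt)
      (g := fun S T c => g c.1.points S c.2.points T) (hg4.comp measurable_swap)
  set h : Set Pt → Set Pt → ℝ≥0∞ := fun S T =>
    ∫⁻ c, ∑ K : Finset (Fin c.1), g S (c.2 '' K) T (c.2 '' (Kᶜ : Finset (Fin c.1))) ∂νb with hh
  have hmh : Measurable fun c : PointList Pt × PointList Pt => h c.1.points c.2.points :=
    hmB.lintegral_prod_right'
  have e1 : ∫⁻ ω : Config, ∫⁻ ω' : Config, g ω.deaths ω.bridges ω'.deaths ω'.bridges ∂(νd.prod νb) ∂(νd.prod νb) =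
      ∫⁻ d, ∫⁻ d', ENNReal.ofReal (Real.exp (-(Λ.bridgeInt lam Set.univ).toReal)) *
        h d.points d'.points ∂νd ∂νd := by
    rw [lintegral_prod _ hg.lintegral_prod_right'.aemeasurable]
    refine lintegral_congr fun d => ?_
    have : ∀ b, ∫⁻ ω' : Config, g (Config.deaths (d, b)) (Config.bridges (d, b)) ω'.deaths ω'.bridges
        ∂(νd.prod νb) = ∫⁻ d', ∫⁻ b', g d.points b.points d'.points b'.points ∂νb ∂νd := by
      intro b
      exact lintegral_prod (fun ω' : Config => g d.points b.points ω'.deaths ω'.bridges)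
        (hg.comp (measurable_prodMk_left (x := ((d, b) : Config)))).aemeasurable
    simp_rw [this]
    rw [lintegral_lintegral_swap]
    · exact lintegral_congr fun d' => hsplitB _ _ ⟨d, d', rfl, rfl⟩
    · have hm3 : Measurable fun q : (PointList Pt × PointList Pt) × PointList Pt =>
          g d.points q.1.1.points q.1.2.points q.2.points :=
        hg4.comp (f := fun q : (PointList Pt × PointList Pt) × PointList Pt =>
          (((d, q.1.2), (q.1.1, q.2)) :
            (PointList Pt × PointList Pt) × PointList Pt × PointList Pt)) (by fun_prop)
      exact hm3.lintegral_prod_right'.aemeasurable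
  have hmB' : ∀ S T : PointList Pt, Measurable fun c : PointList Pt =>
      ∑ K : Finset (Fin c.1), g S.points (c.2 '' K) T.points
        (c.2 '' (Kᶜ : Finset (Fin c.1))) := fun S T =>
    hmB.comp (measurable_prodMk_left (x := (S, T)))
  rw [e1]
  simp_rw [lintegral_const_mul' _ _ ENNReal.ofReal_ne_top]
  rw [lintegral_poissonProcess_split (Λ.deathInt del) hmh, ← mul_assoc,
    mul_comm (ENNReal.ofReal _)]
  rw [lintegral_prod]
  · congr 1
    refine lintegral_congr fun d => ?_
    simp only [hh]
    refine (lintegral_finsetSum _ fun I _ => ?_).symm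
    have := hmB' ⟨_, d.2 ∘ I.orderEmbOfFin rfl⟩ ⟨_, d.2 ∘ Iᶜ.orderEmbOfFin rfl⟩
    simpa [PointList.points, Set.range_comp] using this
  · refine Measurable.aemeasurable ?_
    exact (measurable_sum_split (X := Pt) (Y := PointList Pt)
      (g := fun S T c => ∑ K : Finset (Fin c.1), g S (c.2 '' K) T
        (c.2 '' (Kᶜ : Finset (Fin c.1)))) hmB).comp measurable_swap

end Box

end Percolation


/-! ### Random-cluster integrals and the FKG inequality. -/

/-- A property of (finite) dead sets and sets of bridges that is measurable for every measurable
listing of these sets. -/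
def MeasEv (E : Set Pt → Set Pt → Prop) : Prop :=
  ∀ (Ω : Type) [MeasurableSpace Ω] (S B : Ω → Set Pt), MeasFam S → MeasFam B →
    (∀ ω, (S ω).Finite) → (∀ ω, (B ω).Finite) → Measurable fun ω => E (S ω) (B ω)

namespace MeasEv

variable {E F : Set Pt → Set Pt → Prop}

lemma and (hE : MeasEv E) (hF : MeasEv F) : MeasEv fun d b => E d b ∧ F d b :=
  fun _ _ S B hS hB hSf hBf => (hE _ S B hS hB hSf hBf).and (hF _ S B hS hB hSf hBf)

lemma not (hE : MeasEv E) : MeasEv fun d b => ¬ E d b :=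
  fun _ _ S B hS hB hSf hBf => (hE _ S B hS hB hSf hBf).not

lemma true : MeasEv fun _ _ => True := fun _ _ _ _ _ _ _ _ => measurable_const

lemma comp_union (hE : MeasEv E) {J : Set Pt} (hJ : J.Finite) : MeasEv fun d b => E (d ∪ J) b :=
  fun _ _ S B hS hB hSf hBf => hE _ (fun ω => S ω ∪ J) B (hS.union (MeasFam.const hJ.countable)) hB
    (fun ω => (hSf ω).union hJ) hBf

lemma connSets (Λ : Box) {T U : Set Pt} (hT : T ⊆ Λ.carrier) (hU : U ⊆ Λ.carrier) :
    MeasEv fun d b => Λ.ConnSets d b T U :=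
  fun _ _ _ _ hS hB hSf _ => Λ.measurable_connSets hS hSf hB hT hU

end MeasEv

namespace Box

variable (Λ : Box) (lam del : ℝ) (W J : Set Pt)

open Classical in
/-- The random-cluster weight of a configuration with deaths forced at `J`, restricted to an
event. -/
noncomputable def wt (E : Set Pt → Set Pt → Prop) (d b : Set Pt) : ℕ :=
  if E d b then 2 ^ Λ.freeCount (d ∪ J) b W else 0

/-- The integral of the random-cluster weight over an event. -/
noncomputable def rcInt (E : Set Pt → Set Pt → Prop) : ℝ≥0∞ :=
  ∫⁻ ω, (Λ.wt W J E ω.deaths ω.bridges : ℝ≥0∞) ∂Λ.percolation lam del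

section

variable {Λ W J}
variable {E F : Set Pt → Set Pt → Prop} {Ω : Type} [MeasurableSpace Ω]

lemma wt_of_mem {d b : Set Pt} (h : E d b) : Λ.wt W J E d b = 2 ^ Λ.freeCount (d ∪ J) b W :=
  if_pos h

lemma wt_of_not {d b : Set Pt} (h : ¬ E d b) : Λ.wt W J E d b = 0 := if_neg h

lemma wt_le {d b : Set Pt} : Λ.wt W J E d b ≤ 2 ^ Λ.freeCount (d ∪ J) b W := by
  unfold wt
  split_ifs
  · exact le_rfl
  · exact Nat.zero_le _

lemma wt_mono {d b : Set Pt} (h : E d b → F d b) : Λ.wt W J E d b ≤ Λ.wt W J F d b := by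
  by_cases hE : E d b
  · rw [wt_of_mem hE, wt_of_mem (h hE)]
  · rw [wt_of_not hE]
    exact Nat.zero_le _

lemma measurable_wt (hW : W ⊆ Λ.carrier) (hJ : J.Finite) (hE : MeasEv E) {S B : Ω → Set Pt}
    (hS : MeasFam S) (hB : MeasFam B) (hSf : ∀ ω, (S ω).Finite) (hBf : ∀ ω, (B ω).Finite) :
    Measurable fun ω => (Λ.wt W J E (S ω) (B ω) : ℝ≥0∞) := by
  classical
  have h1 : Measurable fun ω => Λ.freeCount (S ω ∪ J) (B ω) W :=
    Λ.measurable_freeCount (hS.union (MeasFam.const hJ.countable)) (fun ω => (hSf ω).union hJ) hB hW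
  have h2 : Measurable fun ω => Λ.wt W J E (S ω) (B ω) := by
    unfold wt
    refine Measurable.ite (measurableSet_setOfPred.2 (hE _ S B hS hB hSf hBf)) ?_ measurable_const
    exact (measurable_from_nat (f := fun n => 2 ^ n)).comp h1
  exact (measurable_from_nat (f := fun n : ℕ => (n : ℝ≥0∞))).comp h2

lemma measurable_wt_config (hW : W ⊆ Λ.carrier) (hJ : J.Finite) (hE : MeasEv E) :
    Measurable fun ω : Config => (Λ.wt W J E ω.deaths ω.bridges : ℝ≥0∞) :=
  measurable_wt hW hJ hE MeasFam.deaths MeasFam.bridges Config.finite_deaths Config.finite_bridges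

lemma rcInt_mono {N : Set ℝ} (hN : N.Countable) (h : ∀ d b, Λ.Gen N d b → E d b → F d b) :
    Λ.rcInt lam del W J E ≤ Λ.rcInt lam del W J F := by
  refine lintegral_mono_ae ?_
  filter_upwards [Λ.ae_gen lam del hN] with ω hω
  exact_mod_cast wt_mono (h _ _ hω.1)

lemma rcInt_congr {N : Set ℝ} (hN : N.Countable) (h : ∀ d b, Λ.Gen N d b → (E d b ↔ F d b)) :
    Λ.rcInt lam del W J E = Λ.rcInt lam del W J F :=
  le_antisymm (rcInt_mono lam del hN fun d b hg => (h d b hg).1)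
    (rcInt_mono lam del hN fun d b hg => (h d b hg).2)

variable (Λ) in
lemma lintegral_two_pow_lt_top (K : ℕ) :
    ∫⁻ ω, (2 : ℝ≥0∞) ^ K * ((2 : ℕ) : ℝ≥0∞) ^ ω.1.1 ∂Λ.percolation lam del < ∞ := by
  rw [lintegral_const_mul' _ _ (by finiteness)]
  refine ENNReal.mul_lt_top (by finiteness) ?_
  rw [percolation_eq, lintegral_prod]
  · simp only [lintegral_const]
    rw [lintegral_mul_const' _ _ (measure_ne_top _ _)]
    exact ENNReal.mul_lt_top (lintegral_pow_poissonProcess _ 2) (measure_lt_top _ _)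
  · refine Measurable.aemeasurable ?_
    have : Measurable fun c : PointList Pt => (((2 : ℕ) : ℝ≥0∞)) ^ c.1 :=
      measurable_sigma_iff.2 fun n => measurable_const (a := (((2 : ℕ) : ℝ≥0∞)) ^ n)
    exact this.comp measurable_fst

variable (Λ) in
/-- A bound for the random-cluster weights, uniform in the bridges. -/
lemma exists_two_pow_bound (hJ : J.Finite) : ∃ K : ℕ, ∀ (ω : Config) (b W : Set Pt),
    2 ^ Λ.freeCount (ω.deaths ∪ J) b W ≤ 2 ^ K * 2 ^ ω.1.1 := by
  set L := ((fun x : ℤ => ((x, Λ.t) : Pt)) '' Set.Icc Λ.a Λ.b).ncard with hL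
  refine ⟨J.ncard + L, fun ω b W => ?_⟩
  have h1 : ω.deaths.ncard ≤ ω.1.1 := by
    unfold Config.deaths PointList.points
    rw [← Set.image_univ]
    exact (Set.ncard_image_le Set.finite_univ).trans (by simp [Set.ncard_univ])
  have h2 : Λ.freeCount (ω.deaths ∪ J) b W ≤ J.ncard + L + ω.1.1 := by
    have := freeCount_le (Λ := Λ) (b := b) (W := W) (ω.finite_deaths.union hJ)
    have h3 := Set.ncard_union_le ω.deaths J
    omega
  rw [← pow_add]
  exact Nat.pow_le_pow_right (by norm_num) h2

lemma rcInt_lt_top (hJ : J.Finite) : Λ.rcInt lam del W J E < ∞ := by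
  obtain ⟨K, hK⟩ := exists_two_pow_bound Λ hJ
  refine (lintegral_mono fun ω => ?_).trans_lt (Λ.lintegral_two_pow_lt_top lam del K)
  have h : Λ.wt W J E ω.deaths ω.bridges ≤ 2 ^ K * 2 ^ ω.1.1 := wt_le.trans (hK ω _ _)
  refine (Nat.cast_le (α := ℝ≥0∞).2 h).trans (le_of_eq ?_)
  push_cast
  rfl

lemma Gen.sat {N : Set ℝ} {d b : Set Pt} (h : Λ.Gen N d b) (hs : Λ.s ∈ N) (ht : Λ.t ∈ N) :
    Λ.Sat d := by
  rintro p q hp ⟨-, ⟨h1, -⟩ | ⟨h1, -⟩⟩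
  · exact absurd (h1 ▸ hs) (h.d_N p hp)
  · exact absurd (h1 ▸ ht) (h.d_N p hp)

lemma Gen.brOff {N : Set ℝ} {d b : Set Pt} (h : Λ.Gen N d b) (hJ : ∀ z ∈ J, z.2 ∈ N) :
    BrOff b (d ∪ J) := by
  have key : ∀ e ∈ b, ∀ z : Pt, z.2 = e.2 → z ∉ d ∪ J := by
    rintro e he z hz (hd | hJz)
    · exact h.ne z hd e he hz
    · exact h.b_N e he (hz ▸ hJ z hJz)
  exact fun e he => ⟨key e he e rfl, key e he _ rfl⟩

/-- The lattice condition for random-cluster weights. -/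
lemma wt_lattice {N : Set ℝ} {J' d d' b b' : Set Pt} {E₁ E₂ E₃ E₄ : Set Pt → Set Pt → Prop}
    (hs : Λ.s ∈ N) (ht : Λ.t ∈ N) (hJ' : J'.Finite) (hJ'N : ∀ z ∈ J', z.2 ∈ N)
    (hJJ : J ⊆ J') (hJs : Λ.Sat J) (hJs' : Λ.Sat J') (hg : Λ.Gen N (d ∪ d') (b ∪ b'))
    (hE : E₁ d b → E₂ d' b' → E₃ (d ∩ d') (b ∪ b') ∧ E₄ (d ∪ d') (b ∩ b')) :
    Λ.wt W J' E₁ d b * Λ.wt W J E₂ d' b' ≤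
      Λ.wt W J E₃ (d ∩ d') (b ∪ b') * Λ.wt W J' E₄ (d ∪ d') (b ∩ b') := by
  by_cases h1 : E₁ d b
  swap
  · simp [wt_of_not h1]
  by_cases h2 : E₂ d' b'
  swap
  · simp [wt_of_not h2]
  obtain ⟨h3, h4⟩ := hE h1 h2
  rw [wt_of_mem h1, wt_of_mem h2, wt_of_mem h3, wt_of_mem h4, ← pow_add, ← pow_add]
  refine Nat.pow_le_pow_right (by norm_num) ?_
  rcases Λ.hst.lt_or_eq with hst | hst
  · have hd := hg.subset Set.subset_union_left Set.subset_union_left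
    have hd' := hg.subset Set.subset_union_right Set.subset_union_right
    have e1 : (d ∪ J') ∪ (d' ∪ J) = (d ∪ d') ∪ J' := by
      rw [Set.union_union_union_comm, Set.union_eq_self_of_subset_right hJJ]
    have e2 : (d ∪ J') ∩ (d' ∪ J) = (d ∩ d') ∪ J := by
      ext z
      -- General position keeps random deaths away from `J'`; without it `d' ∩ J'` would contribute
      -- further deaths to the intersection.
      have hz : z ∈ d' → z ∉ J' := fun hz hJ => hd'.d_N z hz (hJ'N z hJ)
      have hz' : z ∈ J → z ∈ J' := fun h => hJJ h
      simp only [Set.mem_inter_iff, Set.mem_union]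
      tauto
    have key := freeCount_supermodular (Λ := Λ) (W := W) (b₁ := b) (b₂ := b')
      (hd.d_fin.union hJ') (hd'.d_fin.union (hJ'.subset hJJ)) ((hd.sat hs ht).union hJs')
      ((hd'.sat hs ht).union hJs) hst (by rw [e1]; exact hg.brOff hJ'N)
    rw [e1, e2] at key
    omega
  -- A box of height zero has almost surely no deaths and no bridges.
  · have hdd : d ∪ d' = ∅ := by
      refine Set.eq_empty_of_forall_notMem fun z hz => hg.d_N z hz ?_
      have := hg.d_mem z hz
      rwa [show z.2 = Λ.s from le_antisymm (hst ▸ this.2.2.2) this.2.2.1]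
    have hbb : b ∪ b' = ∅ := by
      refine Set.eq_empty_of_forall_notMem fun z hz => hg.b_N z hz ?_
      have := hg.b_mem z hz
      rwa [show z.2 = Λ.s from le_antisymm (hst ▸ this.2.2.2) this.2.2.1]
    obtain ⟨rfl, rfl⟩ := Set.union_empty_iff.1 hdd
    obtain ⟨rfl, rfl⟩ := Set.union_empty_iff.1 hbb
    simp only [Set.union_empty, Set.inter_empty]
    omega

/-- The FKG inequality for random-cluster weights, with possibly different forced deaths. -/
theorem rcInt_fkg {N : Set ℝ} {J' : Set Pt} {E₁ E₂ E₃ E₄ : Set Pt → Set Pt → Prop}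
    (hW : W ⊆ Λ.carrier) (hN : N.Countable)
    (hs : Λ.s ∈ N) (ht : Λ.t ∈ N) (hJ' : J'.Finite) (hJ'N : ∀ z ∈ J', z.2 ∈ N)
    (hJJ : J ⊆ J') (hJs : Λ.Sat J) (hJs' : Λ.Sat J')
    (m₁ : MeasEv E₁) (m₂ : MeasEv E₂) (m₃ : MeasEv E₃) (m₄ : MeasEv E₄)
    (hE : ∀ d d' b b', Λ.Gen N (d ∪ d') (b ∪ b') → E₁ d b → E₂ d' b' →
      E₃ (d ∩ d') (b ∪ b') ∧ E₄ (d ∪ d') (b ∩ b')) :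
    Λ.rcInt lam del W J' E₁ * Λ.rcInt lam del W J E₂ ≤
      Λ.rcInt lam del W J E₃ * Λ.rcInt lam del W J' E₄ := by
  have hJf := hJ'.subset hJJ
  have hprod : ∀ (A B : Set Pt) (F G : Set Pt → Set Pt → Prop), A.Finite → B.Finite →
      MeasEv F → MeasEv G → Λ.rcInt lam del W A F * Λ.rcInt lam del W B G =
      Λ.splitConst lam del * ∫⁻ ω, ∑ I : Finset (Fin ω.1.1), ∑ K : Finset (Fin ω.2.1),
        ((Λ.wt W A F (ω.1.2 '' I) (ω.2.2 '' K) * Λ.wt W B G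
          (ω.1.2 '' (Iᶜ : Finset (Fin ω.1.1))) (ω.2.2 '' (Kᶜ : Finset (Fin ω.2.1))) : ℕ) : ℝ≥0∞)
          ∂Λ.percolation lam del := by
    intro A B F G hA hB hF hG
    have hmA := measurable_wt_config (Λ := Λ) hW hA hF
    have hmB := measurable_wt_config (Λ := Λ) hW hB hG
    rw [← Λ.lintegral_percolation_split lam del
      (g := fun d b d' b' => ((Λ.wt W A F d b * Λ.wt W B G d' b' : ℕ) : ℝ≥0∞))]
    · unfold rcInt
      push_cast
      rw [← lintegral_mul_const _ hmA]
      refine lintegral_congr fun ω => ?_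
      rw [lintegral_const_mul _ hmB]
    · push_cast
      exact (hmA.comp measurable_fst).mul (hmB.comp measurable_snd)
  rw [hprod _ _ _ _ hJ' hJf m₁ m₂, hprod _ _ _ _ hJf hJ' m₃ m₄]
  refine mul_le_mul' le_rfl ?_
  refine lintegral_mono_ae ?_
  filter_upwards [Λ.ae_gen lam del hN] with ω hω
  obtain ⟨hgen, hid, hib⟩ := hω
  -- Deaths are indexed by the complement of the first component, so that the lattice order is the
  -- order of increasing connectivity.
  have key := sum_mul_compl_le (α := Finset (Fin ω.1.1) × Finset (Fin ω.2.1))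
    (fun a => Λ.wt W J' E₁ (ω.1.2 '' (a.1ᶜ : Finset _)) (ω.2.2 '' a.2))
    (fun a => Λ.wt W J E₂ (ω.1.2 '' (a.1ᶜ : Finset _)) (ω.2.2 '' a.2))
    (fun a => Λ.wt W J E₃ (ω.1.2 '' (a.1ᶜ : Finset _)) (ω.2.2 '' a.2))
    (fun a => Λ.wt W J' E₄ (ω.1.2 '' (a.1ᶜ : Finset _)) (ω.2.2 '' a.2)) ?_
  · have hre : ∀ (f g : Set Pt → Set Pt → ℕ),
        ∑ a : Finset (Fin ω.1.1) × Finset (Fin ω.2.1),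
          f (ω.1.2 '' (a.1ᶜ : Finset _)) (ω.2.2 '' a.2) *
          g (ω.1.2 '' ((aᶜ).1ᶜ : Finset _)) (ω.2.2 '' (aᶜ).2) =
        ∑ I : Finset (Fin ω.1.1), ∑ K : Finset (Fin ω.2.1), f (ω.1.2 '' I) (ω.2.2 '' K) *
          g (ω.1.2 '' (Iᶜ : Finset (Fin ω.1.1))) (ω.2.2 '' (Kᶜ : Finset (Fin ω.2.1))) := by
      intro f g
      rw [Fintype.sum_prod_type]
      refine Fintype.sum_equiv (Equiv.mk compl compl compl_compl compl_compl) _ _ fun I => ?_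
      refine Finset.sum_congr rfl fun K _ => ?_
      simp
    have h1 := hre (Λ.wt W J' E₁) (Λ.wt W J E₂)
    have h2 := hre (Λ.wt W J E₃) (Λ.wt W J' E₄)
    rw [h1, h2] at key
    exact_mod_cast key
  · rintro ⟨I, K⟩ ⟨I', K'⟩
    have e1 : ω.1.2 '' ((I ⊔ I')ᶜ : Finset _) = ω.1.2 '' (Iᶜ : Finset _) ∩
        ω.1.2 '' (I'ᶜ : Finset _) := by
      rw [← Set.image_inter hid, ← Finset.coe_inter, compl_sup]
      rfl
    have e2 : ω.1.2 '' ((I ⊓ I')ᶜ : Finset _) = ω.1.2 '' (Iᶜ : Finset _) ∪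
        ω.1.2 '' (I'ᶜ : Finset _) := by
      rw [← Set.image_union, ← Finset.coe_union, compl_inf]
      rfl
    have e3 : ω.2.2 '' ((K ⊔ K' : Finset _) : Set _) = ω.2.2 '' K ∪ ω.2.2 '' K' := by
      rw [← Set.image_union, ← Finset.coe_union]
      rfl
    have e4 : ω.2.2 '' ((K ⊓ K' : Finset _) : Set _) = ω.2.2 '' K ∩ ω.2.2 '' K' := by
      rw [← Set.image_inter hib, ← Finset.coe_inter]
      rfl
    simp only [Prod.mk_sup_mk, Prod.mk_inf_mk, e1, e2, e3, e4]
    have hgen' : Λ.Gen N (ω.1.2 '' (Iᶜ : Finset _) ∪ ω.1.2 '' (I'ᶜ : Finset _))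
        (ω.2.2 '' K ∪ ω.2.2 '' K') :=
      hgen.subset (Set.union_subset (Set.image_subset_range _ _) (Set.image_subset_range _ _))
        (Set.union_subset (Set.image_subset_range _ _) (Set.image_subset_range _ _))
    exact wt_lattice hs ht hJ' hJ'N hJJ hJs hJs' hgen' (hE _ _ _ _ hgen')

end

end Box


/-! ### Exploration of the clusters of a root set. -/

namespace Box

section Exploration

variable {Λ : Box} {d d' d₁ d₂ b b' b₁ b₂ R W C : Set Pt} {N : Set ℝ} {p q z : Pt}

/-- A point `z` touches the set of points connected to `R`: it can be approached from that set
along its time-line without meeting other points of `d`. -/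
def Touch (Λ : Box) (R d b : Set Pt) (z : Pt) : Prop :=
  ∃ p ∈ Λ.reach d b R, p.1 = z.1 ∧ ∀ u ∈ Set.uIcc p.2 z.2, (z.1, u) ∈ d → u = z.2

/-- The bridge `e` has an endpoint in `C`. -/
def TouchBr (C : Set Pt) (e : Pt) : Prop := e ∈ C ∨ (e.1 + 1, e.2) ∈ C

/-- Every death and every bridge touches the set of points connected to `R`. -/
def Expl (Λ : Box) (R d b : Set Pt) : Prop :=
  (∀ z ∈ d, Λ.Touch R d b z) ∧ ∀ e ∈ b, TouchBr (Λ.reach d b R) e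

/-- No death lies in `C` and no bridge has an endpoint in `C`. -/
def Off (C d b : Set Pt) : Prop := (∀ z ∈ d, z ∉ C) ∧ ∀ e ∈ b, ¬ TouchBr C e

/-- The deaths that touch the set of points connected to `R`. -/
def touchDeaths (Λ : Box) (R d b : Set Pt) : Set Pt := {z ∈ d | Λ.Touch R d b z}

/-- The bridges that touch the set of points connected to `R`. -/
def touchBridges (Λ : Box) (R d b : Set Pt) : Set Pt := {e ∈ b | TouchBr (Λ.reach d b R) e}

/-- No step of the configuration enters or leaves `C`. -/
def Uncrossed (Λ : Box) (C d b : Set Pt) : Prop := ∀ x y, Λ.Step d b x y → (x ∈ C ↔ y ∈ C)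

/-- A step of the larger configuration that starts in `C` uses no death of `d₁` and only a bridge of
`b₁`, so it is also a step of the explored configuration and stays in `C`. -/
lemma uncrossed_of_subset (hd : d₁ ⊆ d)
    (hb : ∀ e ∈ b, e ∈ b₁ ∨ ¬ TouchBr (Λ.reach d₁ b₁ R) e) :
    Λ.Uncrossed (Λ.reach d₁ b₁ R) d b := by
  have key : ∀ x y, Λ.Step d b x y → x ∈ Λ.reach d₁ b₁ R → y ∈ Λ.reach d₁ b₁ R := by
    rintro x y ⟨hx, hy, hxd, hyd, hs⟩ hxC
    refine mem_reach_of_conn hxC (.single ⟨hx, hy, fun h => hxd (hd h), fun h => hyd (hd h), ?_⟩)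
    rcases hs with ⟨h1, h2⟩ | ⟨h1, h2⟩ | hs
    · exact Or.inl ⟨h1, fun u hu h => h2 u hu (hd h)⟩
    · refine Or.inr (Or.inl ⟨h1, ?_⟩)
      rcases h2 with ⟨h2, h3⟩ | ⟨h2, h3⟩
      · refine Or.inl ⟨h2, (hb x h3).resolve_right fun h => h (Or.inl hxC)⟩
      · refine Or.inr ⟨h2, (hb y h3).resolve_right fun h => h (Or.inr ?_)⟩
        rwa [show ((y.1 + 1, y.2) : Pt) = x from Prod.ext h2.symm h1.symm]
    · exact Or.inr (Or.inr hs)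
  exact fun x y h => ⟨key x y h, key y x h.symm⟩

lemma Uncrossed.compl (h : Λ.Uncrossed C d b) : Λ.Uncrossed Cᶜ d b :=
  fun x y hs => not_congr (h x y hs)

lemma Uncrossed.conn (h : Λ.Uncrossed C d b) (hc : Λ.Conn d b p q) (hp : p ∈ C) : q ∈ C :=
  Conn.induction (P := fun z => z ∈ C) hc hp fun x y _ hx hs => (h x y hs).1 hx

/-- Two configurations agree on `C`. -/
def AgreeOn (C d b d' b' : Set Pt) : Prop :=
  (∀ z ∈ C, z ∈ d ↔ z ∈ d') ∧ ∀ e ∈ C, (e.1 + 1, e.2) ∈ C → (e ∈ b ↔ e ∈ b')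

lemma AgreeOn.symm (h : AgreeOn C d b d' b') : AgreeOn C d' b' d b :=
  ⟨fun z hz => (h.1 z hz).symm, fun e he he' => (h.2 e he he').symm⟩

lemma AgreeOn.conn_of_conn (h : AgreeOn C d b d' b') (hu : Λ.Uncrossed C d b) (hp : p ∈ C)
    (hc : Λ.Conn d b p q) : Λ.Conn d' b' p q := by
  refine hc.transfer (fun z hz hd' => ?_) (fun e he h1 h2 => ?_)
  · exact hz.mem_right.2 ((h.1 z (hu.conn hz hp)).2 hd')
  · exact (h.2 e (hu.conn h1 hp) (hu.conn h2 hp)).1 he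

lemma AgreeOn.conn_iff (h : AgreeOn C d b d' b') (hu : Λ.Uncrossed C d b)
    (hu' : Λ.Uncrossed C d' b') (hp : p ∈ C) : Λ.Conn d b p q ↔ Λ.Conn d' b' p q :=
  ⟨h.conn_of_conn hu hp, h.symm.conn_of_conn hu' hp⟩

/-- The number of free clusters inside `C`. -/
noncomputable def countIn (Λ : Box) (C d b W : Set Pt) : ℕ :=
  {A ∈ Λ.freeClusters d b W | A ⊆ C}.ncard

lemma freeCount_eq_countIn_add (hd : d.Finite) (hu : Λ.Uncrossed C d b) :
    Λ.freeCount d b W = Λ.countIn C d b W + Λ.countIn Cᶜ d b W := by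
  have hfin := freeClusters_finite (Λ := Λ) (b := b) (W := W) hd
  unfold freeCount countIn
  have hdis : Disjoint {A ∈ Λ.freeClusters d b W | A ⊆ C}
      {A ∈ Λ.freeClusters d b W | A ⊆ Cᶜ} := by
    rw [Set.disjoint_left]
    rintro A ⟨⟨⟨p, hp, rfl⟩, -⟩, h1⟩ ⟨-, h2⟩
    exact h2 hp (h1 hp)
  rw [← Set.ncard_union_eq hdis (hfin.subset fun _ h => h.1) (hfin.subset fun _ h => h.1)]
  congr 1
  ext A
  constructor
  · intro hA
    obtain ⟨p, hp, rfl⟩ := hA.1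
    by_cases hpC : p ∈ C
    · exact Or.inl ⟨hA, fun q hq => hu.conn hq hpC⟩
    · exact Or.inr ⟨hA, fun q hq => hu.compl.conn hq hpC⟩
  · rintro (hA | hA) <;> exact hA.1

lemma AgreeOn.countIn_eq (h : AgreeOn C d b d' b') (hu : Λ.Uncrossed C d b)
    (hu' : Λ.Uncrossed C d' b') : Λ.countIn C d b W = Λ.countIn C d' b' W := by
  have key : ∀ {d b d' b' : Set Pt}, AgreeOn C d b d' b' → Λ.Uncrossed C d b →
      Λ.Uncrossed C d' b' → {A ∈ Λ.freeClusters d b W | A ⊆ C} ⊆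
        {A ∈ Λ.freeClusters d' b' W | A ⊆ C} := by
    rintro d b d' b' h hu hu' A ⟨⟨⟨p, hp, rfl⟩, hW⟩, hC⟩
    have hpC : p ∈ C := hC hp
    have e : {q | Λ.Conn d b p q} = {q | Λ.Conn d' b' p q} := by
      ext q
      exact h.conn_iff hu hu' hpC
    exact ⟨⟨⟨p, (h.conn_iff hu hu' hpC).1 hp, e⟩, hW⟩, hC⟩
  unfold countIn
  rw [Set.Subset.antisymm (key h hu hu') (key h.symm hu' hu)]

/-- Exchange of the parts inside and outside an uncrossed set. -/
lemma freeCount_exchange {d₃ d₄ b₃ b₄ : Set Pt} (f₁ : d₁.Finite) (f₂ : d₂.Finite)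
    (f₃ : d₃.Finite) (f₄ : d₄.Finite)
    (u₁ : Λ.Uncrossed C d₁ b₁) (u₂ : Λ.Uncrossed C d₂ b₂) (u₃ : Λ.Uncrossed C d₃ b₃)
    (u₄ : Λ.Uncrossed C d₄ b₄) (h13 : AgreeOn C d₁ b₁ d₃ b₃) (h24 : AgreeOn C d₂ b₂ d₄ b₄)
    (h14 : AgreeOn Cᶜ d₁ b₁ d₄ b₄) (h23 : AgreeOn Cᶜ d₂ b₂ d₃ b₃) :
    Λ.freeCount d₁ b₁ W + Λ.freeCount d₂ b₂ W = Λ.freeCount d₃ b₃ W + Λ.freeCount d₄ b₄ W := by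
  rw [freeCount_eq_countIn_add f₁ u₁, freeCount_eq_countIn_add f₂ u₂,
    freeCount_eq_countIn_add f₃ u₃, freeCount_eq_countIn_add f₄ u₄, h13.countIn_eq u₁ u₃,
    h24.countIn_eq u₂ u₄, h14.countIn_eq u₁.compl u₄.compl, h23.countIn_eq u₂.compl u₃.compl]
  ring

/-- What lies off the explored set cannot change it, so the exploration is recovered from the union
of the two parts. -/
lemma reach_union_of_off (h : Off (Λ.reach d₁ b₁ R) d₂ b₂) :
    Λ.reach (d₁ ∪ d₂) (b₁ ∪ b₂) R = Λ.reach d₁ b₁ R := by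
  apply Set.Subset.antisymm
  · rintro z ⟨γ, hγ, hc⟩
    have hu : Λ.Uncrossed (Λ.reach d₁ b₁ R) (d₁ ∪ d₂) (b₁ ∪ b₂) :=
      uncrossed_of_subset Set.subset_union_left fun e he =>
        he.imp id fun he => h.2 e he
    refine hu.conn hc ⟨γ, hγ, conn_refl hc.mem_left.1 fun h => hc.mem_left.2 (Or.inl h)⟩
  · rintro z ⟨γ, hγ, hc⟩
    refine ⟨γ, hγ, hc.transfer (fun w hw => ?_) fun e he _ _ => Or.inl he⟩
    rintro (h1 | h1)
    · exact hw.mem_right.2 h1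
    · exact h.1 w h1 ⟨γ, hγ, hw⟩

lemma mem_touchDeaths_of_nearest (hd : d.Finite) (hp : p ∈ Λ.reach d b R)
    (hpq : ∃ u ∈ Set.uIcc p.2 q.2, (p.1, u) ∈ d) :
    ∃ u ∈ Set.uIcc p.2 q.2, (p.1, u) ∈ Λ.touchDeaths R d b := by
  have hfin : ({u | u ∈ Set.uIcc p.2 q.2 ∧ (p.1, u) ∈ d}).Finite := by
    refine (hd.preimage (f := fun u : ℝ => ((p.1, u) : Pt)) fun a _ c _ h => by
      simpa using h).subset fun u hu => hu.2
  obtain ⟨w, hw, hmin⟩ := Set.exists_min_image _ (fun u => |u - p.2|) hfin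
    (by obtain ⟨u, hu, hud⟩ := hpq; exact ⟨u, hu, hud⟩)
  refine ⟨w, hw.1, hw.2, p, hp, rfl, fun u hu hud => ?_⟩
  have hu' : u ∈ Set.uIcc p.2 q.2 := Set.uIcc_subset_uIcc Set.left_mem_uIcc hw.1 hu
  have hle := hmin u ⟨hu', hud⟩
  simp only at hle hu
  rcases le_total p.2 w with h | h
  · rw [Set.uIcc_of_le h] at hu
    rw [abs_of_nonneg (by linarith), abs_of_nonneg (by linarith [hu.1])] at hle
    linarith [hu.2]
  · rw [Set.uIcc_of_ge h] at hu
    rw [abs_of_nonpos (by linarith), abs_of_nonpos (by linarith [hu.2])] at hle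
    linarith [hu.1]

/-- Only touching deaths and bridges matter for the exploration: if a vertical move from an explored
point met a death, then the nearest one met would be a touching death. General position takes care
of roots, bridge ends and the top/bottom identification. -/
lemma reach_touch (hg : Λ.Gen N d b) (hs : Λ.s ∈ N) (ht : Λ.t ∈ N) (hR : ∀ γ ∈ R, γ.2 ∈ N) :
    Λ.reach (Λ.touchDeaths R d b) (Λ.touchBridges R d b) R = Λ.reach d b R := by
  apply Set.Subset.antisymm
  · rintro z ⟨γ, hγ, hc⟩
    have hγd : γ ∉ d := fun h => hg.d_N γ h (hR γ hγ)
    refine Conn.induction (P := fun w => w ∈ Λ.reach d b R) hc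
      ⟨γ, hγ, conn_refl hc.mem_left.1 hγd⟩ ?_
    rintro x y - hx ⟨hxc, hyc, -, hyd, hst⟩
    have hxd : x ∉ d := notMem_of_mem_reach hx
    rcases hst with ⟨h1, h2⟩ | ⟨h1, h2⟩ | hst
    · refine mem_reach_of_conn hx (conn_vertical hxc hyc h1 fun u hu hud => ?_)
      obtain ⟨v, hv, hvt⟩ := mem_touchDeaths_of_nearest (q := y) hg.d_fin hx ⟨u, hu, hud⟩
      exact h2 v hv hvt
    · have hyd' : y ∉ d := by
        intro hy
        rcases h2 with ⟨-, h3⟩ | ⟨-, h3⟩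
        · exact hg.ne y hy x h3.1 h1.symm
        · exact hg.ne y hy y h3.1 rfl
      refine mem_reach_of_conn hx (.single ⟨hxc, hyc, hxd, hyd', Or.inr (Or.inl ⟨h1, ?_⟩)⟩)
      exact h2.imp (fun h => ⟨h.1, h.2.1⟩) (fun h => ⟨h.1, h.2.1⟩)
    · have hyd' : y ∉ d := by
        intro hy
        rcases hst.2 with ⟨-, h⟩ | ⟨-, h⟩
        · exact hg.d_N y hy (h ▸ ht)
        · exact hg.d_N y hy (h ▸ hs)
      exact mem_reach_of_conn hx (.single ⟨hxc, hyc, hxd, hyd', Or.inr (Or.inr hst)⟩)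
  · rintro z ⟨γ, hγ, hc⟩
    refine ⟨γ, hγ, hc.transfer (fun w hw h => hw.mem_right.2 h.1) fun e he h1 _ => ?_⟩
    exact ⟨he, Or.inl ⟨γ, hγ, h1⟩⟩

lemma expl_touch (hg : Λ.Gen N d b) (hs : Λ.s ∈ N) (ht : Λ.t ∈ N) (hR : ∀ γ ∈ R, γ.2 ∈ N) :
    Λ.Expl R (Λ.touchDeaths R d b) (Λ.touchBridges R d b) := by
  unfold Expl Touch
  rw [reach_touch hg hs ht hR]
  refine ⟨fun z hz => ?_, fun e he => he.2⟩
  obtain ⟨-, p, hp, h1, h2⟩ := hz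
  exact ⟨p, hp, h1, fun u hu h => h2 u hu h.1⟩

lemma off_touch (hg : Λ.Gen N d b) (hs : Λ.s ∈ N) (ht : Λ.t ∈ N) (hR : ∀ γ ∈ R, γ.2 ∈ N) :
    Off (Λ.reach (Λ.touchDeaths R d b) (Λ.touchBridges R d b) R)
      (d \ Λ.touchDeaths R d b) (b \ Λ.touchBridges R d b) := by
  rw [reach_touch hg hs ht hR]
  exact ⟨fun z hz h => notMem_of_mem_reach h hz.1, fun e he h => he.2 ⟨he.1, h⟩⟩

/-- Uniqueness of the decomposition into explored and unexplored parts. A touching death of `d₂`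
with no death of `d₁` in between would lie in the explored set, and no death of `d₂` can shield one
of `d₁` without lying there either. -/
lemma touchDeaths_union_of_expl (he : Λ.Expl R d₁ b₁) (ho : Off (Λ.reach d₁ b₁ R) d₂ b₂)
    (h2 : d₂ ⊆ Λ.carrier) (h1 : d₁ ⊆ Λ.carrier) :
    Λ.touchDeaths R (d₁ ∪ d₂) (b₁ ∪ b₂) = d₁ := by
  ext z
  unfold touchDeaths Touch
  rw [reach_union_of_off ho]
  constructor
  · rintro ⟨hz, p, hp, hpz, hfree⟩
    by_contra hz1
    have hz2 : z ∈ d₂ := hz.resolve_left hz1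
    refine ho.1 z hz2 (mem_reach_of_conn hp (conn_vertical (reach_subset_carrier hp)
      (h2 hz2) hpz fun u hu hud => hz1 ?_))
    rw [hpz] at hud
    have := hfree u hu (Or.inl hud)
    rwa [this] at hud
  · intro hz
    obtain ⟨p, hp, hpz, hfree⟩ := he.1 z hz
    refine ⟨Or.inl hz, p, hp, hpz, fun u hu hud => ?_⟩
    rcases hud with hud | hud
    · exact hfree u hu hud
    · by_contra hne
      refine ho.1 _ hud (mem_reach_of_conn hp ?_)
      have hpc := reach_subset_carrier hp
      rw [← hpz]
      refine conn_vertical hpc (Step.carrier_segment hpc (h1 hz) hu) rfl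
        fun v hv hvd => ?_
      have hv' := Set.uIcc_subset_uIcc Set.left_mem_uIcc hu hv
      rw [hpz] at hvd
      have hvz := hfree v hv' hvd
      subst hvz
      refine hne (le_antisymm ?_ ?_)
      · rw [Set.mem_uIcc] at hu hv
        simp only at hv
        rcases hu with hu | hu <;> rcases hv with hv | hv <;> linarith
      · rw [Set.mem_uIcc] at hu hv
        simp only at hv
        rcases hu with hu | hu <;> rcases hv with hv | hv <;> linarith

lemma touchBridges_union_of_expl (he : Λ.Expl R d₁ b₁) (ho : Off (Λ.reach d₁ b₁ R) d₂ b₂) :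
    Λ.touchBridges R (d₁ ∪ d₂) (b₁ ∪ b₂) = b₁ := by
  ext e
  unfold touchBridges
  rw [reach_union_of_off ho]
  constructor
  · rintro ⟨h1 | h1, h2⟩
    · exact h1
    · exact absurd h2 (ho.2 e h1)
  · intro h
    exact ⟨Or.inl h, he.2 e h⟩

lemma touchDeaths_of_expl (he : Λ.Expl R d₁ b₁) : Λ.touchDeaths R d₁ b₁ = d₁ :=
  Set.Subset.antisymm (fun _ h => h.1) fun z hz => ⟨hz, he.1 z hz⟩

/-- The deaths touching a smaller explored set either touch the larger one or lie inside it. -/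
lemma touchDeaths_subset (hd : d' ⊆ d) (hb : b ⊆ b') (hdc : d ⊆ Λ.carrier) :
    ∀ z ∈ Λ.touchDeaths R d b, z ∈ Λ.touchDeaths R d' b' ∨ z ∈ Λ.reach d' b' R := by
  rintro z ⟨hz, p, hp, hpz, hfree⟩
  have hp' := reach_mono (S := R) hd hb hp
  by_cases hzd : z ∈ d'
  · exact Or.inl ⟨hzd, p, hp', hpz, fun u hu h => hfree u hu (hd h)⟩
  · refine Or.inr (mem_reach_of_conn hp' (conn_vertical (reach_subset_carrier hp) (hdc hz) hpz
      fun u hu hud => hzd ?_))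
    rw [hpz] at hud
    have := hfree u hu (hd hud)
    rwa [this] at hud

/-- An open path from `Δ` to `Γ` passes through `D` or a glued copy of one of its points. In general
position the identification is never blocked by a death, so in either case `D` is connected to `Γ`.
-/
lemma disjoint_reach_of_separates {D Δ Γ : Set Pt} (hg : Λ.Gen N d b) (hs : Λ.s ∈ N)
    (ht : Λ.t ∈ N) (hD : D ⊆ Λ.carrier) (hsep : Λ.Separates D Δ Γ)
    (h : ¬ Λ.ConnSets d b D Γ) : Disjoint Δ (Λ.reach d b Γ) := by
  rw [Set.disjoint_left]
  rintro δ hδ ⟨γ, hγ, hc⟩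
  refine hsep ⟨δ, hδ, γ, hγ, hc.symm.transfer (fun z hz => ?_) fun _ _ _ _ => trivial⟩
  have hzγ : Λ.Conn d b z γ := hz.symm.trans hc.symm
  rintro (hzD | ⟨q, hq, hgl⟩)
  · exact h ⟨z, hzD, γ, hγ, hzγ⟩
  · have hqd : q ∉ d := by
      intro hqd
      rcases hgl.2 with ⟨-, h⟩ | ⟨-, h⟩
      · exact hg.d_N q hqd (h ▸ ht)
      · exact hg.d_N q hqd (h ▸ hs)
    have hst : Λ.Step d b q z := ⟨hD hq, hz.mem_right.1, hqd, hz.mem_right.2,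
      Or.inr (Or.inr hgl.symm)⟩
    exact h ⟨q, hq, γ, hγ, Relation.TransGen.head hst hzγ⟩

end Exploration

/-! ### Measurability of the exploration. -/

section ExplorationMeasurable

variable {Λ : Box} {R : Set Pt} {Ω : Type} [MeasurableSpace Ω] {S B S' B' : Ω → Set Pt}

/-- The approaching point can be moved slightly within its cluster into a countable dense set; the
condition on deaths then becomes a finite one. -/
lemma touch_iff_dense {d b Q : Set Pt} {z : Pt} (hd : d.Finite) (hQ : Q ⊆ Λ.carrier)
    (hQd : Λ.carrier ⊆ closure Q) : Λ.Touch R d b z ↔ ∃ q ∈ Q, q ∈ Λ.reach d b R ∧ q.1 = z.1 ∧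
      ∀ w ∈ d, ¬ (w.1 = z.1 ∧ (min q.2 z.2 ≤ w.2 ∧ w.2 ≤ max q.2 z.2) ∧ w.2 ≠ z.2) := by
  constructor
  · rintro ⟨p, hp, hpz, hfree⟩
    have hpc := reach_subset_carrier hp
    obtain ⟨ε, hε, h⟩ := exists_free_nhd hd (notMem_of_mem_reach hp)
    obtain ⟨q, hq, hq1, hq2⟩ := exists_near (hQd hpc) hε
    refine ⟨q, hq, mem_reach_of_conn hp (conn_vertical hpc (hQ hq) hq1.symm fun u hu =>
      h u (abs_sub_lt_of_mem_uIcc hu hq2)), hq1.trans hpz, ?_⟩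
    rintro w hw ⟨h1, h2, h3⟩
    have h2' : w.2 ∈ Set.uIcc q.2 z.2 := h2
    have hwz : ((z.1, w.2) : Pt) = w := Prod.ext h1.symm rfl
    rcases Set.uIcc_subset_uIcc_union_uIcc (b := p.2) h2' with h4 | h4
    · rw [Set.uIcc_comm] at h4
      refine h w.2 (abs_sub_lt_of_mem_uIcc h4 hq2) ?_
      rwa [hpz, hwz]
    · exact h3 (hfree w.2 h4 (by rwa [hwz]))
  · rintro ⟨q, hq, hqr, h1, h2⟩
    refine ⟨q, hqr, h1, fun u hu hud => ?_⟩
    by_contra hne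
    exact h2 _ hud ⟨rfl, hu, hne⟩

lemma measurable_touch (hR : R ⊆ Λ.carrier) (hS : MeasFam S) (hB : MeasFam B)
    (hSf : ∀ ω, (S ω).Finite) {z : Ω → Pt} (hz : Measurable z) :
    Measurable fun ω => Λ.Touch R (S ω) (B ω) (z ω) := by
  obtain ⟨Q, hQ, hc, hd⟩ := exists_countable_dense Λ.carrier
  have := hc.to_subtype
  have h : Measurable fun ω => ∃ q : Q, q.1 ∈ Λ.reach (S ω) (B ω) R ∧ q.1.1 = (z ω).1 ∧
      ∀ w ∈ S ω, ¬ (w.1 = (z ω).1 ∧ (min q.1.2 (z ω).2 ≤ w.2 ∧ w.2 ≤ max q.1.2 (z ω).2) ∧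
        w.2 ≠ (z ω).2) := by
    refine Measurable.exists fun q => Measurable.and
      (Λ.measurable_mem_reach hS hSf hB measurable_const hR)
      (Measurable.and (measurableSet_eq_fun measurable_const hz.fst).mem
      (hS.measurable_forall _ fun w hw => Measurable.not ?_))
    have h1 := measurableSet_le (measurable_const.min hz.snd : Measurable fun ω =>
      min q.1.2 (z ω).2) hw.snd
    have h2 := measurableSet_le hw.snd (measurable_const.max hz.snd : Measurable fun ω =>
      max q.1.2 (z ω).2)
    exact (measurableSet_eq_fun hw.fst hz.fst).mem.and
      ((h1.mem.and h2.mem).and (measurableSet_eq_fun hw.snd hz.snd).mem.not)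
  convert h using 2 with ω
  rw [touch_iff_dense (hSf ω) hQ hd]
  exact ⟨fun ⟨q, hq, h⟩ => ⟨⟨q, hq⟩, h⟩, fun ⟨q, h⟩ => ⟨q.1, q.2, h⟩⟩

lemma measurable_touchBr (hR : R ⊆ Λ.carrier) (hS : MeasFam S) (hB : MeasFam B)
    (hSf : ∀ ω, (S ω).Finite) {z : Ω → Pt} (hz : Measurable z) :
    Measurable fun ω => TouchBr (Λ.reach (S ω) (B ω) R) (z ω) :=
  (Λ.measurable_mem_reach hS hSf hB hz hR).or
    (Λ.measurable_mem_reach hS hSf hB ((hz.fst.add measurable_const).prodMk hz.snd) hR)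

lemma measFam_touchDeaths (hR : R ⊆ Λ.carrier) (hS : MeasFam S) (hB : MeasFam B)
    (hSf : ∀ ω, (S ω).Finite) : MeasFam fun ω => Λ.touchDeaths R (S ω) (B ω) :=
  hS.filter _ fun _ hz => measurable_touch hR hS hB hSf hz

lemma measEv_expl (hR : R ⊆ Λ.carrier) : MeasEv fun d b => Λ.Expl R d b :=
  fun _ _ _ _ hS hB hSf _ => (hS.measurable_forall _ fun _ hz => measurable_touch hR hS hB hSf hz).and
    (hB.measurable_forall _ fun _ hz => measurable_touchBr hR hS hB hSf hz)

lemma measurable_noTouchBr (hR : R ⊆ Λ.carrier) (hS : MeasFam S) (hB : MeasFam B)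
    (hSf : ∀ ω, (S ω).Finite) (hB' : MeasFam B') :
    Measurable fun ω => ∀ e ∈ B' ω, ¬ TouchBr (Λ.reach (S ω) (B ω) R) e :=
  hB'.measurable_forall _ fun _ hz => (measurable_touchBr hR hS hB hSf hz).not

lemma measurable_off (hR : R ⊆ Λ.carrier) (hS : MeasFam S) (hB : MeasFam B)
    (hSf : ∀ ω, (S ω).Finite) (hS' : MeasFam S') (hB' : MeasFam B') :
    Measurable fun ω => Off (Λ.reach (S ω) (B ω) R) (S' ω) (B' ω) :=
  (hS'.measurable_forall _ fun _ hz => (Λ.measurable_mem_reach hS hSf hB hz hR).not).and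
    (measurable_noTouchBr hR hS hB hSf hB')

end ExplorationMeasurable

end Box


/-! ### The conditional law outside an explored set. -/

namespace Box

variable (Λ : Box) (lam del : ℝ) (W : Set Pt)

open Classical in
/-- The random-cluster weight of a configuration, set to zero unless `P` holds. -/
noncomputable def wtOn (P : Prop) (d b : Set Pt) : ℕ := if P then 2 ^ Λ.freeCount d b W else 0

/-- The random-cluster integral over the configurations without bridges touching `C`. -/
noncomputable def xInt (C J : Set Pt) (A : Set Pt → Set Pt → Prop) : ℝ≥0∞ :=
  Λ.rcInt lam del W J fun d b => (∀ e ∈ b, ¬ TouchBr C e) ∧ A (d ∪ J) b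

/-- The random-cluster integral over the configurations off `C`, the part in `C` being given. -/
noncomputable def nInt (C J d₁ b₁ : Set Pt) (A : Set Pt → Set Pt → Prop) : ℝ≥0∞ :=
  ∫⁻ ω, (Λ.wtOn W (Off C ω.deaths ω.bridges ∧ A (d₁ ∪ ω.deaths ∪ J) (b₁ ∪ ω.bridges))
    (d₁ ∪ ω.deaths ∪ J) (b₁ ∪ ω.bridges) : ℝ≥0∞) ∂Λ.percolation lam del

/-- The event `A` depends on the part of the configuration outside `C` only. -/
def LocalOff (C : Set Pt) (A : Set Pt → Set Pt → Prop) : Prop :=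
  ∀ d b d' b', Λ.Uncrossed C d b → Λ.Uncrossed C d' b' → AgreeOn Cᶜ d b d' b' →
    (A d b ↔ A d' b')

section

variable {Λ W} {A B : Set Pt → Set Pt → Prop} {C R J J₀ d d' d₁ b b' b₁ : Set Pt} {N : Set ℝ}
  {Ω : Type} [MeasurableSpace Ω]

lemma wt_eq_wtOn {E : Set Pt → Set Pt → Prop} : Λ.wt W J E d b = Λ.wtOn W (E d b) (d ∪ J) b := rfl

lemma wtOn_pos {P : Prop} (h : P) : Λ.wtOn W P d b = 2 ^ Λ.freeCount d b W := if_pos h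

lemma wtOn_neg {P : Prop} (h : ¬ P) : Λ.wtOn W P d b = 0 := if_neg h

lemma measurable_wtOn (hW : W ⊆ Λ.carrier) {P : Ω → Prop} (hP : Measurable P) {S B : Ω → Set Pt}
    (hS : MeasFam S) (hB : MeasFam B) (hSf : ∀ ω, (S ω).Finite) :
    Measurable fun ω => (Λ.wtOn W (P ω) (S ω) (B ω) : ℝ≥0∞) := by
  classical
  have h2 : Measurable fun ω => Λ.wtOn W (P ω) (S ω) (B ω) := by
    unfold wtOn
    refine Measurable.ite (measurableSet_setOfPred.2 hP) ?_ measurable_const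
    exact (measurable_from_nat (f := fun n => 2 ^ n)).comp (Λ.measurable_freeCount hS hSf hB hW)
  exact (measurable_from_nat (f := fun n : ℕ => (n : ℝ≥0∞))).comp h2

lemma LocalOff.true : Λ.LocalOff C fun _ _ => True := fun _ _ _ _ _ _ _ => Iff.rfl

lemma localOff_not_connSets {U V : Set Pt} (hU : Disjoint U C) :
    Λ.LocalOff C fun d b => ¬ Λ.ConnSets d b U V := by
  intro d b d' b' hu hu' ha
  refine not_congr ⟨?_, ?_⟩
  · rintro ⟨p, hp, q, hq, h⟩
    exact ⟨p, hp, q, hq, (ha.conn_iff hu.compl hu'.compl (Set.disjoint_left.1 hU hp)).1 h⟩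
  · rintro ⟨p, hp, q, hq, h⟩
    exact ⟨p, hp, q, hq, (ha.conn_iff hu.compl hu'.compl (Set.disjoint_left.1 hU hp)).2 h⟩

/-- Exchanging the parts outside an explored set. -/
lemma wtOn_exchange {D₂ D₃ Din B₂ B₃ : Set Pt} (hC : C = Λ.reach d₁ b₁ R)
    (hbC : ∀ e ∈ b₁, TouchBr C e) (hd₁ : d₁.Finite)
    (hJ₀ : J₀.Finite) (hJ₀C : J₀ ⊆ C) (hJ : J.Finite) (hdJ : d₁ ⊆ J) (hJC : J ⊆ d₁ ∪ C)
    (hA : Λ.LocalOff C A) (f₂ : D₂.Finite) (f₃ : D₃.Finite) (fin : Din.Finite)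
    (h₂ : ∀ z ∈ D₂, z ∉ C) (h₃ : ∀ z ∈ D₃, z ∉ C) (hin : Din ⊆ C) :
    Λ.wtOn W (Off C D₂ B₂ ∧ A (d₁ ∪ D₂ ∪ J₀) (b₁ ∪ B₂)) (d₁ ∪ D₂ ∪ J₀) (b₁ ∪ B₂) *
      Λ.wtOn W ((∀ e ∈ B₃, ¬ TouchBr C e) ∧ True) (Din ∪ D₃ ∪ J) B₃ =
    Λ.wtOn W (Off C D₃ B₃ ∧ True) (d₁ ∪ D₃ ∪ J₀) (b₁ ∪ B₃) *
      Λ.wtOn W ((∀ e ∈ B₂, ¬ TouchBr C e) ∧ A (Din ∪ D₂ ∪ J) B₂) (Din ∪ D₂ ∪ J) B₂ := by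
  by_cases hB₂ : ∀ e ∈ B₂, ¬ TouchBr C e
  swap
  · rw [wtOn_neg (fun h => hB₂ h.1.2),
      wtOn_neg (P := (∀ e ∈ B₂, ¬ TouchBr C e) ∧ A (Din ∪ D₂ ∪ J) B₂) (fun h => hB₂ h.1),
      zero_mul, mul_zero]
  by_cases hB₃ : ∀ e ∈ B₃, ¬ TouchBr C e
  swap
  · rw [wtOn_neg (P := (∀ e ∈ B₃, ¬ TouchBr C e) ∧ True) (fun h => hB₃ h.1),
      wtOn_neg (P := Off C D₃ B₃ ∧ True) (fun h => hB₃ h.1.2), zero_mul, mul_zero]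
  have u : ∀ {d b}, d₁ ⊆ d → (∀ e ∈ b, e ∈ b₁ ∨ ¬ TouchBr C e) → Λ.Uncrossed C d b := by
    intro d b h1 h2
    subst hC
    exact uncrossed_of_subset h1 h2
  have hsub : ∀ {X Y : Set Pt}, d₁ ⊆ d₁ ∪ X ∪ Y := fun {X Y} z hz => Or.inl (Or.inl hz)
  have hsub' : ∀ {X : Set Pt}, d₁ ⊆ X ∪ J := fun {X} z hz => Or.inr (hdJ hz)
  have u₁ : Λ.Uncrossed C (d₁ ∪ D₂ ∪ J₀) (b₁ ∪ B₂) := u hsub fun e he => he.imp id (hB₂ e)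
  have u₂ : Λ.Uncrossed C (Din ∪ D₃ ∪ J) B₃ := u hsub' fun e he => Or.inr (hB₃ e he)
  have u₃ : Λ.Uncrossed C (d₁ ∪ D₃ ∪ J₀) (b₁ ∪ B₃) := u hsub fun e he => he.imp id (hB₃ e)
  have u₄ : Λ.Uncrossed C (Din ∪ D₂ ∪ J) B₂ := u hsub' fun e he => Or.inr (hB₂ e he)
  have tb : ∀ {e}, e ∈ C → TouchBr C e := fun h => Or.inl h
  have out : ∀ {X B : Set Pt}, AgreeOn Cᶜ (d₁ ∪ X ∪ J₀) (b₁ ∪ B) (Din ∪ X ∪ J) B := by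
    intro X B
    refine ⟨fun z hz => ?_, fun e he he' => ?_⟩
    · have h1 : z ∉ J₀ := fun h => hz (hJ₀C h)
      have h2 : z ∉ Din := fun h => hz (hin h)
      have h3 : z ∈ J → z ∈ d₁ := fun h => (hJC h).resolve_right hz
      have h4 : z ∈ d₁ → z ∈ J := fun h => hdJ h
      simp only [Set.mem_union]
      tauto
    · have h1 : e ∉ b₁ := fun h => (hbC e h).elim he he'
      simp only [Set.mem_union]
      tauto
  have key := freeCount_exchange (W := W) ((hd₁.union f₂).union hJ₀) ((fin.union f₃).union hJ)
    ((hd₁.union f₃).union hJ₀) ((fin.union f₂).union hJ) u₁ u₂ u₃ u₄ ?_ ?_ out out.symm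
  · have hAA := hA _ _ _ _ u₁ u₄ out
    by_cases hAt : A (d₁ ∪ D₂ ∪ J₀) (b₁ ∪ B₂)
    · rw [wtOn_pos ⟨⟨h₂, hB₂⟩, hAt⟩, wtOn_pos ⟨hB₃, trivial⟩, wtOn_pos ⟨⟨h₃, hB₃⟩, trivial⟩,
        wtOn_pos ⟨hB₂, hAA.1 hAt⟩, ← pow_add, ← pow_add, key]
    · rw [wtOn_neg (fun h => hAt h.2),
        wtOn_neg (P := (∀ e ∈ B₂, ¬ TouchBr C e) ∧ A (Din ∪ D₂ ∪ J) B₂)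
          (fun h => hAt (hAA.2 h.2)), zero_mul, mul_zero]
  · refine ⟨fun z hz => ?_, fun e he he' => ?_⟩
    · have h1 : z ∉ D₂ := fun h => h₂ z h hz
      have h2 : z ∉ D₃ := fun h => h₃ z h hz
      simp only [Set.mem_union]
      tauto
    · have h1 : e ∉ B₂ := fun h => hB₂ e h (tb he)
      have h2 : e ∉ B₃ := fun h => hB₃ e h (tb he)
      simp only [Set.mem_union]
      tauto
  · refine ⟨fun z hz => ?_, fun e he he' => ?_⟩
    · have h1 : z ∉ D₂ := fun h => h₂ z h hz
      have h2 : z ∉ D₃ := fun h => h₃ z h hz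
      simp only [Set.mem_union]
      tauto
    · have h1 : e ∉ B₂ := fun h => hB₂ e h (tb he)
      have h2 : e ∉ B₃ := fun h => hB₃ e h (tb he)
      tauto

/-- Spatial Markov property: given the explored part, the law outside `C` is that of the
random-cluster measure with deaths forced at `J` and no bridge touching `C`. The latter is defined
on the whole box and conditioned on a decreasing event, which makes it accessible to FKG. Deaths
inside `C` remain free there; their contribution to the cluster count factors out. -/
lemma nInt_mul_xInt (hW : W ⊆ Λ.carrier) (hR : R ⊆ Λ.carrier) (hC : C = Λ.reach d₁ b₁ R)
    (hbC : ∀ e ∈ b₁, TouchBr C e) (hd₁ : d₁.Finite) (hb₁ : b₁.Finite)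
    (hJ₀ : J₀.Finite) (hJ₀C : J₀ ⊆ C) (hJ : J.Finite) (hdJ : d₁ ⊆ J) (hJC : J ⊆ d₁ ∪ C)
    (hA : Λ.LocalOff C A) (mA : MeasEv A) :
    Λ.nInt lam del W C J₀ d₁ b₁ A * Λ.xInt lam del W C J (fun _ _ => True) =
      Λ.nInt lam del W C J₀ d₁ b₁ (fun _ _ => True) * Λ.xInt lam del W C J A := by
  have hmem : ∀ {Ω : Type} [MeasurableSpace Ω] {S B : Ω → Set Pt}, MeasFam S → MeasFam B →
      Measurable fun ω => Off C (S ω) (B ω) := by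
    intro Ω _ S B hS hB
    subst hC
    exact measurable_off hR (MeasFam.const hd₁.countable) (MeasFam.const hb₁.countable)
      (fun _ => hd₁) hS hB
  have hmem' : ∀ {Ω : Type} [MeasurableSpace Ω] {B : Ω → Set Pt}, MeasFam B →
      Measurable fun ω => ∀ e ∈ B ω, ¬ TouchBr C e := by
    intro Ω _ B hB
    subst hC
    exact measurable_noTouchBr hR (MeasFam.const hd₁.countable) (MeasFam.const hb₁.countable)
      (fun _ => hd₁) hB
  have hn : ∀ {A : Set Pt → Set Pt → Prop}, MeasEv A → Measurable fun ω : Config =>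
      (Λ.wtOn W (Off C ω.deaths ω.bridges ∧ A (d₁ ∪ ω.deaths ∪ J₀) (b₁ ∪ ω.bridges))
        (d₁ ∪ ω.deaths ∪ J₀) (b₁ ∪ ω.bridges) : ℝ≥0∞) := by
    intro A mA
    have hS : MeasFam fun ω : Config => d₁ ∪ ω.deaths ∪ J₀ :=
      ((MeasFam.const hd₁.countable).union MeasFam.deaths).union (MeasFam.const hJ₀.countable)
    have hB : MeasFam fun ω : Config => b₁ ∪ ω.bridges :=
      (MeasFam.const hb₁.countable).union MeasFam.bridges
    have hSf : ∀ ω : Config, (d₁ ∪ ω.deaths ∪ J₀).Finite := fun ω =>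
      (hd₁.union ω.finite_deaths).union hJ₀
    exact measurable_wtOn hW ((hmem MeasFam.deaths MeasFam.bridges).and
      (mA _ _ _ hS hB hSf fun ω => hb₁.union ω.finite_bridges)) hS hB hSf
  have hx : ∀ {A : Set Pt → Set Pt → Prop}, MeasEv A → Measurable fun ω : Config =>
      (Λ.wtOn W ((∀ e ∈ ω.bridges, ¬ TouchBr C e) ∧ A (ω.deaths ∪ J) ω.bridges)
        (ω.deaths ∪ J) ω.bridges : ℝ≥0∞) := by
    intro A mA
    have hS : MeasFam fun ω : Config => ω.deaths ∪ J :=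
      MeasFam.deaths.union (MeasFam.const hJ.countable)
    have hSf : ∀ ω : Config, (ω.deaths ∪ J).Finite := fun ω => ω.finite_deaths.union hJ
    exact measurable_wtOn hW ((hmem' MeasFam.bridges).and
      (mA _ _ _ hS MeasFam.bridges hSf fun ω => ω.finite_bridges)) hS MeasFam.bridges hSf
  have hprod : ∀ {A A' : Set Pt → Set Pt → Prop}, MeasEv A → MeasEv A' →
      Λ.nInt lam del W C J₀ d₁ b₁ A * Λ.xInt lam del W C J A' =
      Λ.splitConst lam del * ∫⁻ ω, ∑ I : Finset (Fin ω.1.1), ∑ K : Finset (Fin ω.2.1),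
        ((Λ.wtOn W (Off C (ω.1.2 '' I) (ω.2.2 '' K) ∧ A (d₁ ∪ ω.1.2 '' I ∪ J₀) (b₁ ∪ (ω.2.2 '' K)))
          (d₁ ∪ ω.1.2 '' I ∪ J₀) (b₁ ∪ (ω.2.2 '' K)) *
          Λ.wtOn W ((∀ e ∈ (ω.2.2 '' (Kᶜ : Finset (Fin ω.2.1))), ¬ TouchBr C e) ∧ A' (ω.1.2 '' (Iᶜ : Finset (Fin ω.1.1)) ∪ J) (ω.2.2 '' (Kᶜ : Finset (Fin ω.2.1)))) (ω.1.2 '' (Iᶜ : Finset (Fin ω.1.1)) ∪ J) (ω.2.2 '' (Kᶜ : Finset (Fin ω.2.1))) : ℕ) : ℝ≥0∞)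
          ∂Λ.percolation lam del := by
    intro A A' mA mA'
    rw [← Λ.lintegral_percolation_split lam del (g := fun D₂ B₂ D₃ B₃ =>
      ((Λ.wtOn W (Off C D₂ B₂ ∧ A (d₁ ∪ D₂ ∪ J₀) (b₁ ∪ B₂))
          (d₁ ∪ D₂ ∪ J₀) (b₁ ∪ B₂) *
          Λ.wtOn W ((∀ e ∈ B₃, ¬ TouchBr C e) ∧ A' (D₃ ∪ J) B₃) (D₃ ∪ J) B₃ : ℕ) : ℝ≥0∞))]
    · unfold nInt xInt rcInt
      simp only [wt_eq_wtOn]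
      push_cast
      rw [← lintegral_mul_const _ (hn mA)]
      refine lintegral_congr fun ω => ?_
      rw [lintegral_const_mul _ (hx mA')]
    · push_cast
      exact ((hn mA).comp measurable_fst).mul ((hx mA').comp measurable_snd)
  rw [hprod mA MeasEv.true, hprod MeasEv.true mA]
  congr 1
  refine lintegral_congr fun ω => ?_
  classical
  -- Swap the parts outside `C` of the two configurations. For deaths this is the symmetric
  -- difference with the set of indices outside `C`, and for bridges the complement, since no bridge
  -- touches `C`. Deaths inside `C` stay with the second configuration.
  set off : Finset (Fin ω.1.1) := Finset.univ.filter fun i => ω.1.2 i ∉ C with hoff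
  refine Fintype.sum_equiv (Equiv.mk (fun I => symmDiff I off) (fun I => symmDiff I off)
    (fun I => symmDiff_symmDiff_cancel_right _ _) fun I => symmDiff_symmDiff_cancel_right _ _)
    _ _ fun I => ?_
  refine Fintype.sum_equiv (Equiv.mk compl compl compl_compl compl_compl) _ _ fun K => ?_
  simp only [Equiv.coe_fn_mk, compl_compl]
  by_cases hI : I ⊆ off
  · have e1 : symmDiff I off = off \ I := symmDiff_of_le hI
    have e2 : ω.1.2 '' (Iᶜ : Finset (Fin ω.1.1)) =
        ω.1.2 '' (offᶜ : Finset (Fin ω.1.1)) ∪ ω.1.2 '' (off \ I : Finset (Fin ω.1.1)) := by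
      rw [← Set.image_union, ← Finset.coe_union]
      congr 2
      ext i
      have := @hI i
      simp only [Finset.mem_compl, Finset.mem_union, Finset.mem_sdiff]
      tauto
    have e3 : ω.1.2 '' ((off \ I)ᶜ : Finset (Fin ω.1.1)) =
        ω.1.2 '' (offᶜ : Finset (Fin ω.1.1)) ∪ ω.1.2 '' I := by
      rw [← Set.image_union, ← Finset.coe_union]
      congr 2
      ext i
      have := @hI i
      simp only [Finset.mem_compl, Finset.mem_union, Finset.mem_sdiff]
      tauto
    rw [e1, e2, e3]
    have hmo : ∀ i ∈ off, ω.1.2 i ∉ C := fun i hi => by simpa [hoff] using hi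
    rw [wtOn_exchange hC hbC hd₁ hJ₀ hJ₀C hJ hdJ hJC hA (Set.toFinite _) (Set.toFinite _)
      (Set.toFinite _)]
    · rintro _ ⟨i, hi, rfl⟩
      exact hmo i (hI hi)
    · rintro _ ⟨i, hi, rfl⟩
      exact hmo i (Finset.mem_sdiff.1 hi).1
    · rintro _ ⟨i, hi, rfl⟩
      by_contra h
      exact Finset.mem_compl.1 hi (by simpa [hoff] using h)
  -- If the first configuration has a death inside `C`, it keeps it under the swap, so both weights
  -- vanish.
  · obtain ⟨i, hi, hio⟩ := Finset.not_subset.1 hI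
    have hiC : ω.1.2 i ∈ C := by
      by_contra h
      exact hio (by simpa [hoff] using h)
    have hi' : i ∈ symmDiff I off := by
      rw [Finset.mem_symmDiff]
      exact Or.inl ⟨hi, hio⟩
    rw [wtOn_neg, wtOn_neg (P := Off C (ω.1.2 '' ↑(symmDiff I off)) _ ∧ True)]
    · simp
    · exact fun h => h.1.1 _ ⟨i, hi', rfl⟩ hiC
    · exact fun h => h.1.1 _ ⟨i, hi, rfl⟩ hiC

end

end Box


/-! ### Positivity, and disintegration along the exploration. -/

lemma poissonProcess_image_pos {X : Type} [MeasurableSpace X] (μ : Measure X) [IsFiniteMeasure μ]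
    {n : ℕ} (T : Fin n → Set X) (hT : ∀ i, 0 < μ (T i)) :
    0 < poissonProcess μ ((fun x => (⟨n, x⟩ : PointList X)) '' Set.univ.pi T) := by
  refine lt_of_lt_of_le ?_ (Measure.le_sum _ n _)
  rw [Measure.smul_apply, (measurableEmbedding_sigma_mk n).map_apply,
    Set.preimage_image_eq _ (measurableEmbedding_sigma_mk n).injective, Measure.pi_pi, smul_eq_mul]
  refine ENNReal.mul_pos ?_ (Finset.prod_ne_zero_iff.2 fun i _ => (hT i).ne')
  simp only [ne_eq, ENNReal.ofReal_eq_zero, not_le]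
  positivity

namespace Box

variable (Λ : Box) (lam del : ℝ) (W : Set Pt)

section

variable {Λ W} {A B : Set Pt → Set Pt → Prop} {C R J J₀ d d' d₁ b b' b₁ : Set Pt} {N : Set ℝ}

lemma rcInt_pos_of_pos (hW : W ⊆ Λ.carrier) (hJ : J.Finite) (hA : MeasEv A)
    {Td Tb : Set (PointList Pt)} (hd : 0 < poissonProcess (Λ.deathInt del) Td)
    (hb : 0 < poissonProcess (Λ.bridgeInt lam) Tb)
    (h : ∀ c ∈ Td, ∀ c' ∈ Tb, A c.points c'.points) : 0 < Λ.rcInt lam del W J A := by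
  have h1 : Λ.percolation lam del (Td ×ˢ Tb) ≤ Λ.rcInt lam del W J A := by
    refine meas_le_lintegral₀ (measurable_wt_config hW hJ hA).aemeasurable ?_
    rintro ω ⟨hω, hω'⟩
    have hAω : A ω.deaths ω.bridges := h ω.1 hω ω.2 hω'
    rw [wt_of_mem hAω]
    exact_mod_cast Nat.one_le_two_pow
  refine lt_of_lt_of_le ?_ h1
  rw [percolation_eq, Measure.prod_prod]
  exact ENNReal.mul_pos hd.ne' hb.ne'

lemma poissonProcess_empty_pos {X : Type} [MeasurableSpace X] (μ : Measure X)
    [IsFiniteMeasure μ] : 0 < poissonProcess μ {c | c.points = ∅} := by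
  refine lt_of_lt_of_le (poissonProcess_image_pos μ (n := 0) (fun i => i.elim0)
    fun i => i.elim0) (measure_mono ?_)
  rintro _ ⟨x, -, rfl⟩
  exact Set.range_eq_empty x

lemma rcInt_pos_of_empty (hW : W ⊆ Λ.carrier) (hJ : J.Finite) (hA : MeasEv A) (h : A ∅ ∅) :
    0 < Λ.rcInt lam del W J A := by
  refine rcInt_pos_of_pos lam del hW hJ hA (poissonProcess_empty_pos _)
    (poissonProcess_empty_pos _) fun c hc c' hc' => ?_
  rw [Set.mem_ofPred_eq] at hc hc'
  rwa [hc, hc']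

/-- A set `R` of roots of the exploration, with times in the countable set `N`. -/
structure Roots (Λ : Box) (N : Set ℝ) (R : Set Pt) : Prop where
  countable : N.Countable
  s_mem : Λ.s ∈ N
  t_mem : Λ.t ∈ N
  subset : R ⊆ Λ.carrier
  time_mem : ∀ γ ∈ R, γ.2 ∈ N

open Classical in
/-- Integration by means of the exploration of the points connected to `R`. -/
lemma lintegral_explore (hr : Roots Λ N R) {Φ : Set Pt → Set Pt → ℝ≥0∞}
    (hΦ : Measurable fun ω : Config × Config =>
      Φ (ω.1.deaths ∪ ω.2.deaths) (ω.1.bridges ∪ ω.2.bridges)) :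
    ∫⁻ ω, ∫⁻ ω', (if Λ.Expl R ω.deaths ω.bridges ∧
        Off (Λ.reach ω.deaths ω.bridges R) ω'.deaths ω'.bridges then
        Φ (ω.deaths ∪ ω'.deaths) (ω.bridges ∪ ω'.bridges) else 0)
        ∂Λ.percolation lam del ∂Λ.percolation lam del =
      Λ.splitConst lam del * ∫⁻ ω, Φ ω.deaths ω.bridges ∂Λ.percolation lam del := by
  rw [Λ.lintegral_percolation_split lam del (g := fun d b d' b' =>
    if Λ.Expl R d b ∧ Off (Λ.reach d b R) d' b' then Φ (d ∪ d') (b ∪ b') else 0)]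
  · congr 1
    refine lintegral_congr_ae ?_
    filter_upwards [Λ.ae_gen lam del hr.countable] with ω hω
    obtain ⟨hg, hid, hib⟩ := hω
    have ed : ∀ I : Finset (Fin ω.1.1), ω.1.2 '' I ∪ ω.1.2 '' (Iᶜ : Finset (Fin ω.1.1)) =
        ω.deaths := by
      intro I
      rw [← Set.image_union, Finset.coe_compl, Set.union_compl_self, Set.image_univ]
      rfl
    have eb : ∀ K : Finset (Fin ω.2.1), ω.2.2 '' K ∪ ω.2.2 '' (Kᶜ : Finset (Fin ω.2.1)) =
        ω.bridges := by
      intro K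
      rw [← Set.image_union, Finset.coe_compl, Set.union_compl_self, Set.image_univ]
      rfl
    simp only [ed, eb]
    set T := Λ.touchDeaths R ω.deaths ω.bridges with hT
    set T' := Λ.touchBridges R ω.deaths ω.bridges with hT'
    set I₀ : Finset (Fin ω.1.1) := Finset.univ.filter fun i => ω.1.2 i ∈ T with hI₀
    set K₀ : Finset (Fin ω.2.1) := Finset.univ.filter fun i => ω.2.2 i ∈ T' with hK₀
    have hIT : ω.1.2 '' I₀ = T := by
      ext z
      constructor
      · rintro ⟨i, hi, rfl⟩
        simpa [hI₀] using hi
      · intro hz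
        obtain ⟨i, rfl⟩ := hz.1
        exact ⟨i, by simpa [hI₀] using hz, rfl⟩
    have hKT : ω.2.2 '' K₀ = T' := by
      ext z
      constructor
      · rintro ⟨i, hi, rfl⟩
        simpa [hK₀] using hi
      · intro hz
        obtain ⟨i, rfl⟩ := hz.1
        exact ⟨i, by simpa [hK₀] using hz, rfl⟩
    have hIT' : ω.1.2 '' (I₀ᶜ : Finset (Fin ω.1.1)) = ω.deaths \ T := by
      rw [Finset.coe_compl, Set.image_compl_eq_range_sdiff_image hid, hIT]
      rfl
    have hKT' : ω.2.2 '' (K₀ᶜ : Finset (Fin ω.2.1)) = ω.bridges \ T' := by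
      rw [Finset.coe_compl, Set.image_compl_eq_range_sdiff_image hib, hKT]
      rfl
    -- Among all splittings exactly one survives: the touching deaths and bridges against the
    -- others.
    have huniq : ∀ (I : Finset (Fin ω.1.1)) (K : Finset (Fin ω.2.1)), Λ.Expl R (ω.1.2 '' I) (ω.2.2 '' K) ∧
        Off (Λ.reach (ω.1.2 '' I) (ω.2.2 '' K) R) (ω.1.2 '' (Iᶜ : Finset (Fin ω.1.1)))
          (ω.2.2 '' (Kᶜ : Finset (Fin ω.2.1))) → I = I₀ ∧ K = K₀ := by
      rintro I K ⟨he, ho⟩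
      have h1 := touchDeaths_union_of_expl he ho
        ((Set.image_subset_range _ _).trans hg.d_mem) ((Set.image_subset_range _ _).trans hg.d_mem)
      have h2 := touchBridges_union_of_expl he ho
      rw [ed, eb] at h1 h2
      have h3 : ω.1.2 '' (I : Set _) = ω.1.2 '' (I₀ : Set _) := by rw [hIT, ← h1]
      have h4 : ω.2.2 '' (K : Set _) = ω.2.2 '' (K₀ : Set _) := by rw [hKT, ← h2]
      exact ⟨Finset.coe_injective (hid.image_injective h3),
        Finset.coe_injective (hib.image_injective h4)⟩
    rw [Finset.sum_eq_single I₀, Finset.sum_eq_single K₀, if_pos]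
    · rw [hIT, hKT, hIT', hKT']
      exact ⟨expl_touch hg hr.s_mem hr.t_mem hr.time_mem,
        off_touch hg hr.s_mem hr.t_mem hr.time_mem⟩
    · intro K _ hK
      exact if_neg fun h => hK (huniq _ _ h).2
    · simp
    · intro I _ hI
      exact Finset.sum_eq_zero fun K _ => if_neg fun h => hI (huniq _ _ h).1
    · simp
  · refine Measurable.ite (measurableSet_setOfPred.2 (Measurable.and ?_ ?_)) hΦ measurable_const
    · exact measEv_expl hr.subset _ _ _ (MeasFam.deaths.comp measurable_fst)
        (MeasFam.bridges.comp measurable_fst) (fun ω => ω.1.finite_deaths)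
        (fun ω => ω.1.finite_bridges)
    · exact measurable_off hr.subset (MeasFam.deaths.comp measurable_fst)
        (MeasFam.bridges.comp measurable_fst) (fun ω => ω.1.finite_deaths)
        (MeasFam.deaths.comp measurable_snd) (MeasFam.bridges.comp measurable_snd)

open Classical in
-- The disintegration formula applied to a random-cluster weight. An event determined by the
-- exploration leaves the inner integral.
lemma rcInt_explore (hr : Roots Λ N R) (hW : W ⊆ Λ.carrier) (hJ : J.Finite) (mA : MeasEv A)
    (mB : MeasEv B)
    (hB : ∀ d₁ b₁ d₂ b₂, Λ.Gen N d₁ b₁ → Λ.Gen N d₂ b₂ → Λ.Expl R d₁ b₁ →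
      Off (Λ.reach d₁ b₁ R) d₂ b₂ → (B (d₁ ∪ d₂) (b₁ ∪ b₂) ↔ B d₁ b₁)) :
    Λ.splitConst lam del * Λ.rcInt lam del W J (fun d b => A (d ∪ J) b ∧ B d b) =
      ∫⁻ ω, (if Λ.Expl R ω.deaths ω.bridges ∧ B ω.deaths ω.bridges then
        Λ.nInt lam del W (Λ.reach ω.deaths ω.bridges R) J ω.deaths ω.bridges A else 0)
        ∂Λ.percolation lam del := by
  unfold rcInt
  rw [← lintegral_explore lam del hr (Φ := fun d b =>
    (Λ.wt W J (fun d b => A (d ∪ J) b ∧ B d b) d b : ℝ≥0∞))]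
  · refine lintegral_congr_ae ?_
    filter_upwards [Λ.ae_gen lam del hr.countable] with ω hω
    by_cases he : Λ.Expl R ω.deaths ω.bridges
    swap
    · simp [he]
    unfold nInt
    by_cases hBω : B ω.deaths ω.bridges
    · rw [if_pos ⟨he, hBω⟩]
      refine lintegral_congr_ae ?_
      filter_upwards [Λ.ae_gen lam del hr.countable] with ω' hω'
      by_cases ho : Off (Λ.reach ω.deaths ω.bridges R) ω'.deaths ω'.bridges
      · rw [if_pos ⟨he, ho⟩, wt_eq_wtOn]
        have hBu := (hB _ _ _ _ hω.1 hω'.1 he ho).2 hBω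
        by_cases hAu : A (ω.deaths ∪ ω'.deaths ∪ J) (ω.bridges ∪ ω'.bridges)
        · rw [wtOn_pos ⟨hAu, hBu⟩, wtOn_pos ⟨ho, hAu⟩]
        · rw [wtOn_neg fun h => hAu h.1, wtOn_neg fun h => hAu h.2]
      · rw [if_neg fun h => ho h.2, wtOn_neg fun h => ho h.1]
        simp
    · rw [if_neg fun h => hBω h.2]
      refine (lintegral_congr_ae ?_).trans lintegral_zero
      filter_upwards [Λ.ae_gen lam del hr.countable] with ω' hω'
      split_ifs with h
      · rw [wt_of_not]
        · simp
        · exact fun h' => hBω ((hB _ _ _ _ hω.1 hω'.1 h.1 h.2).1 h'.2)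
      · rfl
  · refine measurable_wt hW hJ (MeasEv.and (mA.comp_union hJ) mB)
      ((MeasFam.deaths.comp measurable_fst).union (MeasFam.deaths.comp measurable_snd))
      ((MeasFam.bridges.comp measurable_fst).union (MeasFam.bridges.comp measurable_snd))
      (fun ω => ω.1.finite_deaths.union ω.2.finite_deaths)
      (fun ω => ω.1.finite_bridges.union ω.2.finite_bridges)

/-- The random-cluster integral over configurations compatible with an explored set. -/
noncomputable def xOf (Λ : Box) (lam del : ℝ) (W R : Set Pt) (A : Set Pt → Set Pt → Prop)
    (d b : Set Pt) : ℝ≥0∞ :=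
  Λ.xInt lam del W (Λ.reach d b R) (Λ.touchDeaths R d b) A

lemma measEv_noTouch (hR : R ⊆ Λ.carrier) (hd : d.Finite) (hb : b.Finite) :
    MeasEv fun _ b' => ∀ e ∈ b', ¬ TouchBr (Λ.reach d b R) e :=
  fun _ _ _ _ _ hB _ _ => measurable_noTouchBr hR (MeasFam.const hd.countable)
    (MeasFam.const hb.countable) (fun _ => hd) hB

lemma xInt_true_pos (hW : W ⊆ Λ.carrier) (hR : R ⊆ Λ.carrier) (hd : d.Finite) (hb : b.Finite)
    (hJ : J.Finite) : 0 < Λ.xInt lam del W (Λ.reach d b R) J fun _ _ => True := by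
  refine rcInt_pos_of_empty lam del hW hJ (MeasEv.and (measEv_noTouch hR hd hb) MeasEv.true) ⟨?_, trivial⟩
  exact fun _ h => h.elim

lemma xInt_lt_top (hJ : J.Finite) : Λ.xInt lam del W C J A < ∞ := rcInt_lt_top lam del hJ

lemma xOf_true_pos (hW : W ⊆ Λ.carrier) (hR : R ⊆ Λ.carrier) (hd : d.Finite) (hb : b.Finite) :
    0 < Λ.xOf lam del W R (fun _ _ => True) d b :=
  xInt_true_pos lam del hW hR hd hb (hd.subset fun _ h => h.1)

lemma xOf_lt_top (hd : d.Finite) : Λ.xOf lam del W R A d b < ∞ :=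
  xInt_lt_top lam del (hd.subset fun _ h => h.1)

/-- Comparison of random-cluster integrals conditionally on the explored part. -/
lemma rcInt_le_of_xOf_le (hr : Roots Λ N R) (hW : W ⊆ Λ.carrier) (hJ : J.Finite)
    (hJR : ∀ d b, Λ.Gen N d b → J ⊆ Λ.reach d b R) {A' : Set Pt → Set Pt → Prop}
    (mA : MeasEv A) (mA' : MeasEv A') (mB : MeasEv B)
    (hB : ∀ d₁ b₁ d₂ b₂, Λ.Gen N d₁ b₁ → Λ.Gen N d₂ b₂ → Λ.Expl R d₁ b₁ →
      Off (Λ.reach d₁ b₁ R) d₂ b₂ → (B (d₁ ∪ d₂) (b₁ ∪ b₂) ↔ B d₁ b₁))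
    (hA : ∀ d b, Λ.Gen N d b → B d b → Λ.LocalOff (Λ.reach d b R) A)
    (hA' : ∀ d b, Λ.Gen N d b → B d b → Λ.LocalOff (Λ.reach d b R) A')
    {c c' : ℝ≥0∞} (hc : c ≠ ∞) (hc' : c' ≠ ∞)
    (hX : ∀ d b, Λ.Gen N d b → B d b →
      c * Λ.xOf lam del W R A d b ≤ c' * Λ.xOf lam del W R A' d b) :
    c * Λ.rcInt lam del W J (fun d b => A (d ∪ J) b ∧ B d b) ≤
      c' * Λ.rcInt lam del W J (fun d b => A' (d ∪ J) b ∧ B d b) := by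
  classical
  have hκ := Λ.splitConst_pos lam del
  have hκ' := Λ.splitConst_ne_top lam del
  rw [← ENNReal.mul_le_mul_iff_right hκ hκ', mul_left_comm, mul_left_comm _ c',
    rcInt_explore lam del hr hW hJ mA mB hB, rcInt_explore lam del hr hW hJ mA' mB hB,
    ← lintegral_const_mul' _ _ hc, ← lintegral_const_mul' _ _ hc']
  refine lintegral_mono_ae ?_
  filter_upwards [Λ.ae_gen lam del hr.countable] with ω hω
  split_ifs with h
  swap
  · simp
  obtain ⟨he, hBω⟩ := h
  have hd := ω.finite_deaths
  have hb := ω.finite_bridges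
  -- Both conditional integrals are rewritten through `xInt` with the same factor `nInt (True)`,
  -- which reduces the claim to the assumed comparison of `xOf`.
  have e1 := nInt_mul_xInt lam del hW hr.subset rfl he.2 hd hb hJ (hJR _ _ hω.1) hd
    subset_rfl Set.subset_union_left (hA _ _ hω.1 hBω) mA
  have e2 := nInt_mul_xInt lam del hW hr.subset rfl he.2 hd hb hJ (hJR _ _ hω.1) hd
    subset_rfl Set.subset_union_left (hA' _ _ hω.1 hBω) mA'
  have h1 := hX _ _ hω.1 hBω
  unfold xOf at h1
  rw [touchDeaths_of_expl he] at h1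
  have hp := xInt_true_pos (Λ := Λ) lam del hW hr.subset hd hb hd
  have hf := xInt_lt_top (Λ := Λ) (W := W) (C := Λ.reach ω.deaths ω.bridges R)
    (A := fun _ _ => True) lam del hd
  rw [← ENNReal.mul_le_mul_iff_left hp.ne' hf.ne, mul_assoc, mul_assoc, e1, e2, mul_left_comm,
    mul_left_comm c']
  exact mul_le_mul' le_rfl h1

end

end Box


/-! ### Conditional probabilities of decreasing events. -/

/-- Events that are preserved when deaths are added and bridges are removed. -/
def Decr (A : Set Pt → Set Pt → Prop) : Prop :=
  ∀ d b d' b', d ⊆ d' → b' ⊆ b → A d b → A d' b'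

namespace Box

variable (Λ : Box) (lam del : ℝ) (W : Set Pt)

section

variable {Λ W} {A B E : Set Pt → Set Pt → Prop} {C D R J J₀ d d' d₁ b b' b₁ : Set Pt} {N : Set ℝ}

lemma decr_not_connSets {U V : Set Pt} : Decr fun d b => ¬ Λ.ConnSets d b U V :=
  fun _ _ _ _ hd hb h h' => h (h'.mono hd hb)

lemma nInt_lt_top (hd : d₁.Finite) (hJ : J.Finite) : Λ.nInt lam del W C J d₁ b₁ A < ∞ := by
  obtain ⟨K, hK⟩ := exists_two_pow_bound Λ (hd.union hJ)
  refine (lintegral_mono fun ω => ?_).trans_lt (Λ.lintegral_two_pow_lt_top lam del K)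
  have h := hK ω (b₁ ∪ ω.bridges) W
  rw [show ω.deaths ∪ (d₁ ∪ J) = d₁ ∪ ω.deaths ∪ J by ac_rfl] at h
  have h' : Λ.wtOn W (Off C ω.deaths ω.bridges ∧ A (d₁ ∪ ω.deaths ∪ J) (b₁ ∪ ω.bridges))
      (d₁ ∪ ω.deaths ∪ J) (b₁ ∪ ω.bridges) ≤ 2 ^ K * 2 ^ ω.1.1 := by
    unfold wtOn
    split_ifs
    · exact h
    · exact Nat.zero_le _
  refine (Nat.cast_le (α := ℝ≥0∞).2 h').trans (le_of_eq ?_)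
  push_cast
  rfl

lemma nInt_true_pos : 0 < Λ.nInt lam del W C J d₁ b₁ fun _ _ => True := by
  have hm : MeasurableSet {ω : Config | ω.1.1 = 0 ∧ ω.2.1 = 0} := by
    have h : Measurable fun c : PointList Pt => c.1 :=
      measurable_sigma_iff.2 fun n => measurable_const (a := n)
    exact ((h.comp measurable_fst) (measurableSet_singleton 0)).inter
      ((h.comp measurable_snd) (measurableSet_singleton 0))
  have h1 : Λ.percolation lam del {ω | ω.1.1 = 0 ∧ ω.2.1 = 0} ≤
      Λ.nInt lam del W C J d₁ b₁ fun _ _ => True := by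
    rw [← lintegral_indicator_one hm]
    refine lintegral_mono fun ω => ?_
    by_cases hω : ω ∈ {ω : Config | ω.1.1 = 0 ∧ ω.2.1 = 0}
    · rw [Set.indicator_of_mem hω, wtOn_pos]
      · exact (Nat.cast_one (R := ℝ≥0∞)).symm.le.trans (Nat.cast_le.2 Nat.one_le_two_pow)
      · refine ⟨⟨?_, ?_⟩, trivial⟩
        · rintro _ ⟨i, -⟩
          exact absurd i.2 (by simp [hω.1])
        · rintro _ ⟨i, -⟩
          exact absurd i.2 (by simp [hω.2])
    · rw [Set.indicator_of_notMem hω]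
      exact zero_le
  refine lt_of_lt_of_le ?_ h1
  have h2 : {ω : Config | ω.1.1 = 0 ∧ ω.2.1 = 0} =
      {c : PointList Pt | c.points = ∅} ×ˢ {c : PointList Pt | c.points = ∅} := by
    have : ∀ c : PointList Pt, c.points = ∅ ↔ c.1 = 0 := by
      rintro ⟨n, x⟩
      simp only [PointList.points, Set.range_eq_empty_iff]
      constructor
      · intro h
        by_contra hn
        exact h.elim ⟨0, Nat.pos_of_ne_zero hn⟩
      · rintro rfl
        infer_instance
    ext ω
    simp [this]
  rw [h2, percolation_eq, Measure.prod_prod]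
  exact ENNReal.mul_pos (poissonProcess_empty_pos _).ne' (poissonProcess_empty_pos _).ne'

/-- The conditional probability of a decreasing event given the explored set is monotone. -/
lemma xOf_mul_le (hr : Roots Λ N R) (hW : W ⊆ Λ.carrier) (mA : MeasEv A) (dA : Decr A)
    (hg : Λ.Gen N d b) (hg' : Λ.Gen N d' b') (hd : d' ⊆ d) (hb : b ⊆ b')
    (hA : Λ.LocalOff (Λ.reach d' b' R) A) :
    Λ.xOf lam del W R A d b * Λ.xOf lam del W R (fun _ _ => True) d' b' ≤
      Λ.xOf lam del W R (fun _ _ => True) d b * Λ.xOf lam del W R A d' b' := by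
  set T := Λ.touchDeaths R d b with hT
  set T' := Λ.touchDeaths R d' b' with hT'
  have hTd : T ⊆ d := fun _ h => h.1
  have hTd' : T' ⊆ d := fun _ h => hd h.1
  have hTf := hg.d_fin.subset hTd
  have hTf' := hg.d_fin.subset hTd'
  have hCC := reach_mono (S := R) (Λ := Λ) hd hb
  have sat : ∀ S ⊆ d, Λ.Sat S := fun S hS =>
    (hg.subset hS subset_rfl).sat hr.s_mem hr.t_mem
  -- The deaths of `d` are now forced, so their times must be avoided by the random points.
  set N' : Set ℝ := N ∪ (fun z : Pt => z.2) '' d with hN'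
  -- FKG compares forcing `T` and forbidding bridges at the smaller explored set with forcing `T ∪
  -- T'` and forbidding bridges at the larger one.
  have key := rcInt_fkg (Λ := Λ) (W := W) lam del (J := T) (J' := T ∪ T') (N := N') hW
    (hr.countable.union (hg.d_fin.image _).countable) (Or.inl hr.s_mem) (Or.inl hr.t_mem)
    (hTf.union hTf') (fun z hz => Or.inr ⟨z, Set.union_subset hTd hTd' hz, rfl⟩)
    Set.subset_union_left (sat _ hTd) (sat _ (Set.union_subset hTd hTd'))
    (E₁ := fun d₂ b₂ => (∀ e ∈ b₂, ¬ TouchBr (Λ.reach d' b' R) e) ∧ True)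
    (E₂ := fun d₂ b₂ => (∀ e ∈ b₂, ¬ TouchBr (Λ.reach d b R) e) ∧ A (d₂ ∪ T) b₂)
    (E₃ := fun d₂ b₂ => (∀ e ∈ b₂, ¬ TouchBr (Λ.reach d b R) e) ∧ True)
    (E₄ := fun d₂ b₂ => (∀ e ∈ b₂, ¬ TouchBr (Λ.reach d' b' R) e) ∧ A (d₂ ∪ (T ∪ T')) b₂)
    (MeasEv.and (measEv_noTouch hr.subset hg'.d_fin hg'.b_fin) MeasEv.true)
    (MeasEv.and (measEv_noTouch hr.subset hg.d_fin hg.b_fin) (mA.comp_union hTf))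
    (MeasEv.and (measEv_noTouch hr.subset hg.d_fin hg.b_fin) MeasEv.true)
    (MeasEv.and (measEv_noTouch hr.subset hg'.d_fin hg'.b_fin) (mA.comp_union (hTf.union hTf')))
    (by
      rintro d₂ d₃ b₂ b₃ - ⟨h1, -⟩ ⟨h2, h3⟩
      refine ⟨⟨?_, trivial⟩, fun e he => h1 e he.1, dA _ _ _ _ ?_ Set.inter_subset_right h3⟩
      · rintro e (he | he)
        · exact fun h => h1 e he (h.imp (fun h => hCC h) fun h => hCC h)
        · exact h2 e he
      · exact Set.union_subset_union Set.subset_union_right Set.subset_union_left)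
  change Λ.xInt lam del W (Λ.reach d' b' R) (T ∪ T') (fun _ _ => True) * Λ.xOf lam del W R A d b ≤
    Λ.xOf lam del W R (fun _ _ => True) d b * Λ.xInt lam del W (Λ.reach d' b' R) (T ∪ T') A at key
  have hC := reach_touch hg' hr.s_mem hr.t_mem hr.time_mem
  have hex := expl_touch hg' hr.s_mem hr.t_mem hr.time_mem
  have hbf := hg'.b_fin.subset (fun _ h => h.1 : Λ.touchBridges R d' b' ⊆ b')
  have hbC : ∀ e ∈ Λ.touchBridges R d' b', TouchBr (Λ.reach d' b' R) e := fun e he => he.2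
  -- Points of `T` outside `T'` lie inside the larger explored set, so forcing deaths there does not
  -- affect the law outside it: forcing `T'` and forcing `T ∪ T'` give the same conditional
  -- probability.
  have e1 := nInt_mul_xInt (J₀ := ∅) lam del hW hr.subset hC.symm hbC hTf' hbf Set.finite_empty
    (Set.empty_subset _) hTf' subset_rfl Set.subset_union_left hA mA
  have e2 := nInt_mul_xInt (J₀ := ∅) lam del hW hr.subset hC.symm hbC hTf' hbf Set.finite_empty
    (Set.empty_subset _) (hTf.union hTf') Set.subset_union_right
    (Set.union_subset (fun z hz => touchDeaths_subset hd hb hg.d_mem z hz)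
      Set.subset_union_left) hA mA
  set n₁ := Λ.nInt lam del W (Λ.reach d' b' R) ∅ T' (Λ.touchBridges R d' b') fun _ _ => True
  set nA := Λ.nInt lam del W (Λ.reach d' b' R) ∅ T' (Λ.touchBridges R d' b') A
  have hn₁ : n₁ ≠ 0 := (nInt_true_pos lam del).ne'
  have hn₁' : n₁ ≠ ∞ := (nInt_lt_top lam del hTf' Set.finite_empty).ne
  have hx : Λ.xInt lam del W (Λ.reach d' b' R) (T ∪ T') (fun _ _ => True) ≠ 0 :=
    (xInt_true_pos lam del hW hr.subset hg'.d_fin hg'.b_fin (hTf.union hTf')).ne'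
  have hx' : Λ.xInt lam del W (Λ.reach d' b' R) (T ∪ T') (fun _ _ => True) ≠ ∞ :=
    (xInt_lt_top lam del (hTf.union hTf')).ne
  unfold xOf at key ⊢
  rw [← hT, ← hT'] at *
  set x₁ := Λ.xInt lam del W (Λ.reach d b R) T fun _ _ => True
  set xA := Λ.xInt lam del W (Λ.reach d b R) T A
  set y₁ := Λ.xInt lam del W (Λ.reach d' b' R) T' fun _ _ => True
  set yA := Λ.xInt lam del W (Λ.reach d' b' R) T' A
  set z₁ := Λ.xInt lam del W (Λ.reach d' b' R) (T ∪ T') fun _ _ => True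
  set zA := Λ.xInt lam del W (Λ.reach d' b' R) (T ∪ T') A
  have e3 : zA * y₁ = yA * z₁ := by
    rw [← ENNReal.mul_right_inj hn₁ hn₁', ← mul_assoc, ← mul_assoc, ← e1, ← e2]
    ring
  rw [← ENNReal.mul_le_mul_iff_right hx hx']
  calc z₁ * (xA * y₁) = (z₁ * xA) * y₁ := by ring
    _ ≤ (x₁ * zA) * y₁ := mul_le_mul' key le_rfl
    _ = x₁ * (zA * y₁) := by ring
    _ = z₁ * (x₁ * yA) := by rw [e3]; ring

/-- A decreasing event is at least as likely given an explored set. -/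
lemma rcInt_mul_xOf_le (hr : Roots Λ N R) (hW : W ⊆ Λ.carrier) (mA : MeasEv A) (dA : Decr A)
    (hg : Λ.Gen N d b) :
    Λ.rcInt lam del W ∅ A * Λ.xOf lam del W R (fun _ _ => True) d b ≤
      Λ.rcInt lam del W ∅ (fun _ _ => True) * Λ.xOf lam del W R A d b := by
  set T := Λ.touchDeaths R d b with hT
  have hTd : T ⊆ d := fun _ h => h.1
  have hTf := hg.d_fin.subset hTd
  have key := rcInt_fkg (Λ := Λ) (W := W) lam del (J := ∅) (J' := T)
    (N := N ∪ (fun z : Pt => z.2) '' d) hW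
    (hr.countable.union (hg.d_fin.image _).countable) (Or.inl hr.s_mem) (Or.inl hr.t_mem)
    hTf (fun z hz => Or.inr ⟨z, hTd hz, rfl⟩)
    (Set.empty_subset _) (fun _ _ h => h.elim)
    ((hg.subset hTd subset_rfl).sat hr.s_mem hr.t_mem)
    (E₁ := fun d₂ b₂ => (∀ e ∈ b₂, ¬ TouchBr (Λ.reach d b R) e) ∧ True)
    (E₂ := A) (E₃ := fun d₂ b₂ => True)
    (E₄ := fun d₂ b₂ => (∀ e ∈ b₂, ¬ TouchBr (Λ.reach d b R) e) ∧ A (d₂ ∪ T) b₂)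
    (MeasEv.and (measEv_noTouch hr.subset hg.d_fin hg.b_fin) MeasEv.true) mA MeasEv.true
    (MeasEv.and (measEv_noTouch hr.subset hg.d_fin hg.b_fin) (mA.comp_union hTf))
    (by
      rintro d₂ d₃ b₂ b₃ - ⟨h1, -⟩ h3
      refine ⟨trivial, fun e he => h1 e he.1, dA _ _ _ _ ?_ Set.inter_subset_right h3⟩
      exact Set.subset_union_right.trans Set.subset_union_left)
  rw [mul_comm]
  exact key

lemma measurable_xOf (hW : W ⊆ Λ.carrier) (hR : R ⊆ Λ.carrier) (mA : MeasEv A) {Ω : Type}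
    [MeasurableSpace Ω] {S B : Ω → Set Pt} (hS : MeasFam S) (hB : MeasFam B)
    (hSf : ∀ ω, (S ω).Finite) :
    Measurable fun ω => Λ.xOf lam del W R A (S ω) (B ω) := by
  have hS1 : MeasFam fun q : Ω × Config => S q.1 := hS.comp measurable_fst
  have hB1 : MeasFam fun q : Ω × Config => B q.1 := hB.comp measurable_fst
  have hB2 : MeasFam fun q : Ω × Config => q.2.bridges := MeasFam.bridges.comp measurable_snd
  have hT : MeasFam fun q : Ω × Config => q.2.deaths ∪ Λ.touchDeaths R (S q.1) (B q.1) :=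
    (MeasFam.deaths.comp measurable_snd).union (measFam_touchDeaths hR hS1 hB1 fun q => hSf q.1)
  have hTf : ∀ q : Ω × Config, (q.2.deaths ∪ Λ.touchDeaths R (S q.1) (B q.1)).Finite := fun q =>
    q.2.finite_deaths.union ((hSf q.1).subset fun _ h => h.1)
  have h : Measurable fun q : Ω × Config =>
      (Λ.wtOn W ((∀ e ∈ q.2.bridges, ¬ TouchBr (Λ.reach (S q.1) (B q.1) R) e) ∧
        A (q.2.deaths ∪ Λ.touchDeaths R (S q.1) (B q.1)) q.2.bridges)
        (q.2.deaths ∪ Λ.touchDeaths R (S q.1) (B q.1)) q.2.bridges : ℝ≥0∞) :=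
    measurable_wtOn hW ((measurable_noTouchBr hR hS1 hB1 (fun q => hSf q.1) hB2).and
      (mA _ _ _ hT hB2 hTf fun q => q.2.finite_bridges)) hT hB2 hTf
  exact h.lintegral_prod_right'

/-- The explored set avoids `D`, and the event `A` is not too likely given the explored set. -/
def Tame (Λ : Box) (lam del : ℝ) (W R D : Set Pt) (A : Set Pt → Set Pt → Prop) (c : ℝ≥0∞)
    (d b : Set Pt) : Prop :=
  ¬ Λ.ConnSets d b D R ∧ Λ.rcInt lam del W ∅ (fun _ _ => True) * Λ.xOf lam del W R A d b ≤
    c * Λ.xOf lam del W R (fun _ _ => True) d b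

lemma measEv_tame (hW : W ⊆ Λ.carrier) (hR : R ⊆ Λ.carrier) (hD : D ⊆ Λ.carrier) (mA : MeasEv A)
    (c : ℝ≥0∞) : MeasEv (Λ.Tame lam del W R D A c) :=
  fun Ω _ S B hS hB hSf hBf => Measurable.and (MeasEv.not (MeasEv.connSets Λ hD hR) Ω S B hS hB hSf hBf)
    (measurableSet_le ((measurable_xOf lam del hW hR mA hS hB hSf).const_mul _)
      ((measurable_xOf lam del hW hR MeasEv.true hS hB hSf).const_mul _)).mem

/-- More deaths and fewer bridges shrink the explored set. This preserves the avoidance of `D` and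
can only lower the conditional probability of the decreasing event `A`. -/
lemma Tame.decr (hr : Roots Λ N R) (hW : W ⊆ Λ.carrier) (mA : MeasEv A) (dA : Decr A)
    (hA : ∀ d b, Λ.Gen N d b → ¬ Λ.ConnSets d b D R → Λ.LocalOff (Λ.reach d b R) A) {c : ℝ≥0∞}
    (hg : Λ.Gen N d b) (hg' : Λ.Gen N d' b') (hd : d ⊆ d') (hb : b' ⊆ b)
    (h : Λ.Tame lam del W R D A c d b) : Λ.Tame lam del W R D A c d' b' := by
  refine ⟨decr_not_connSets _ _ _ _ hd hb h.1, ?_⟩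
  have h1 := xOf_mul_le lam del hr hW mA dA hg' hg hd hb (hA d b hg h.1)
  have hp := (xOf_true_pos (Λ := Λ) lam del hW hr.subset hg.d_fin hg.b_fin).ne'
  have hf := (xOf_lt_top (Λ := Λ) (W := W) (R := R) (A := fun _ _ => True) (b := b)
    lam del hg.d_fin).ne
  rw [← ENNReal.mul_le_mul_iff_left hp hf]
  set Z := Λ.rcInt lam del W ∅ fun _ _ => True
  calc _ = Z * (Λ.xOf lam del W R A d' b' * Λ.xOf lam del W R (fun _ _ => True) d b) := by ring
    _ ≤ Z * (Λ.xOf lam del W R (fun _ _ => True) d' b' * Λ.xOf lam del W R A d b) :=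
      mul_le_mul' le_rfl h1
    _ = Λ.xOf lam del W R (fun _ _ => True) d' b' * (Z * Λ.xOf lam del W R A d b) := by ring
    _ ≤ Λ.xOf lam del W R (fun _ _ => True) d' b' *
        (c * Λ.xOf lam del W R (fun _ _ => True) d b) := mul_le_mul' le_rfl h.2
    _ = _ := by ring

end

end Box


/-! ### Screening of a decreasing event by the explored set. -/

namespace Box

variable (Λ : Box) (lam del : ℝ) (W : Set Pt)

section

variable {Λ W} {A B E F : Set Pt → Set Pt → Prop} {C D R J d d' d₁ d₂ b b' b₁ b₂ : Set Pt}
  {N : Set ℝ}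

lemma rcInt_split (hW : W ⊆ Λ.carrier) (hJ : J.Finite) (mE : MeasEv E) (mF : MeasEv F) :
    Λ.rcInt lam del W J E = Λ.rcInt lam del W J (fun d b => E d b ∧ F d b) +
      Λ.rcInt lam del W J (fun d b => E d b ∧ ¬ F d b) := by
  unfold rcInt
  rw [← lintegral_add_left (measurable_wt_config hW hJ (mE.and mF))]
  refine lintegral_congr fun ω => ?_
  by_cases h1 : E ω.deaths ω.bridges
  · by_cases h2 : F ω.deaths ω.bridges
    · rw [wt_of_mem h1, wt_of_mem ⟨h1, h2⟩, wt_of_not fun h => h.2 h2]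
      simp
    · rw [wt_of_mem h1, wt_of_mem (E := fun d b => E d b ∧ ¬ F d b) ⟨h1, h2⟩,
        wt_of_not fun h => h2 h.2]
      simp
  · rw [wt_of_not h1, wt_of_not fun h => h1 h.1, wt_of_not fun h => h1 h.1]
    simp

/-- The event `B` is determined by the explored part of the configuration. -/
def Explored (Λ : Box) (N : Set ℝ) (R : Set Pt) (B : Set Pt → Set Pt → Prop) : Prop :=
  ∀ d₁ b₁ d₂ b₂, Λ.Gen N d₁ b₁ → Λ.Gen N d₂ b₂ → Λ.Expl R d₁ b₁ →
    Off (Λ.reach d₁ b₁ R) d₂ b₂ → (B (d₁ ∪ d₂) (b₁ ∪ b₂) ↔ B d₁ b₁)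

lemma Explored.and (hE : Λ.Explored N R E) (hF : Λ.Explored N R F) :
    Λ.Explored N R fun d b => E d b ∧ F d b :=
  fun d₁ b₁ d₂ b₂ h1 h2 h3 h4 =>
    and_congr (hE d₁ b₁ d₂ b₂ h1 h2 h3 h4) (hF d₁ b₁ d₂ b₂ h1 h2 h3 h4)

lemma Explored.not (hE : Λ.Explored N R E) : Λ.Explored N R fun d b => ¬ E d b :=
  fun d₁ b₁ d₂ b₂ h1 h2 h3 h4 => not_congr (hE d₁ b₁ d₂ b₂ h1 h2 h3 h4)

lemma explored_not_connSets : Λ.Explored N R fun d b => ¬ Λ.ConnSets d b D R := by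
  intro d₁ b₁ d₂ b₂ _ _ _ ho
  beta_reduce
  rw [connSets_iff_reach, connSets_iff_reach, reach_union_of_off ho]

/-- The conditional probability is a function of the explored set and the touching deaths, neither
of which changes when points off that set are added. -/
lemma explored_tame {c : ℝ≥0∞} : Λ.Explored N R (Λ.Tame lam del W R D A c) := by
  intro d₁ b₁ d₂ b₂ g₁ g₂ he ho
  unfold Tame xOf
  rw [connSets_iff_reach, connSets_iff_reach, reach_union_of_off ho,
    touchDeaths_union_of_expl he ho g₂.d_mem g₁.d_mem, touchDeaths_of_expl he]

/-- Random-cluster bounds for an event `E` which, when `R` is not connected to `D`, is the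
intersection of an event `B` determined by the exploration and a decreasing event `A` that depends
on the unexplored part. -/
theorem rcInt_screening (hr : Roots Λ N R) (hW : W ⊆ Λ.carrier) (hD : D ⊆ Λ.carrier)
    (hJ : J.Finite) (hJN : ∀ z ∈ J, z.2 ∈ N) (hJs : Λ.Sat J)
    (hJR : ∀ d b, Λ.Gen N d b → J ⊆ Λ.reach d b R)
    (mA : MeasEv A) (dA : Decr A)
    (lA : ∀ d b, Λ.Gen N d b → ¬ Λ.ConnSets d b D R → Λ.LocalOff (Λ.reach d b R) A)
    (mB : MeasEv B) (dB : Decr B) (xB : Λ.Explored N R B) (mE : MeasEv E) (dE : Decr E)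
    (hE : ∀ d b, Λ.Gen N d b → ¬ Λ.ConnSets d b D R → (E d b ↔ A (d ∪ J) b ∧ B d b))
    (hA : Λ.rcInt lam del W ∅ A ≠ 0) :
    Λ.rcInt lam del W ∅ A * (Λ.rcInt lam del W J B *
        Λ.rcInt lam del W ∅ fun d b => ¬ Λ.ConnSets d b D R) ≤
      (Λ.rcInt lam del W ∅ fun _ _ => True) * ((Λ.rcInt lam del W ∅ fun _ _ => True) *
        Λ.rcInt lam del W J E) ∧
    ∀ s : ℝ≥0∞, s ≠ ∞ → ∃ h : ℝ≥0∞,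
      (1 + s) * (Λ.rcInt lam del W ∅ fun d b => ¬ Λ.ConnSets d b D R) ≤
        s * h + Λ.rcInt lam del W ∅ (fun _ _ => True) ∧
      Λ.rcInt lam del W J E * h ≤
        (1 + s) * Λ.rcInt lam del W ∅ A * Λ.rcInt lam del W J B := by
  set Z := Λ.rcInt lam del W ∅ fun _ _ => True with hZ
  set a := Λ.rcInt lam del W ∅ A with ha
  set g := Λ.rcInt lam del W ∅ fun d b => ¬ Λ.ConnSets d b D R with hg
  have hZt : Z ≠ ∞ := (rcInt_lt_top lam del Set.finite_empty).ne
  have hat : a ≠ ∞ := (rcInt_lt_top lam del Set.finite_empty).ne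
  have mG : MeasEv fun d b => ¬ Λ.ConnSets d b D R := (MeasEv.connSets Λ hD hr.subset).not
  have hJR' : ∀ d b, Λ.Gen N d b → (∅ : Set Pt) ⊆ Λ.reach d b R := fun _ _ _ => Set.empty_subset _
  have hT : ∀ {B : Set Pt → Set Pt → Prop} {J : Set Pt},
      Λ.rcInt lam del W J (fun d b => True ∧ B d b) = Λ.rcInt lam del W J B := by
    intro B J
    simp only [true_and]
  have cmp : ∀ {J : Set Pt} {B : Set Pt → Set Pt → Prop} (c : ℝ≥0∞), J.Finite →
      (∀ d b, Λ.Gen N d b → J ⊆ Λ.reach d b R) → MeasEv B → Λ.Explored N R B →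
      (∀ d b, Λ.Gen N d b → B d b → ¬ Λ.ConnSets d b D R) → c ≠ ∞ →
      (∀ d b, Λ.Gen N d b → B d b →
        c * Λ.xOf lam del W R (fun _ _ => True) d b ≤ Z * Λ.xOf lam del W R A d b) →
      c * Λ.rcInt lam del W J B ≤ Z * Λ.rcInt lam del W J (fun d b => A (d ∪ J) b ∧ B d b) := by
    intro J B c hJ hJR mB xB hG hc hx
    have := rcInt_le_of_xOf_le lam del hr hW hJ hJR MeasEv.true mA mB xB
      (fun d b _ _ => LocalOff.true) (fun d b h h' => lA d b h (hG d b h h')) hc hZt hx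
    rwa [hT] at this
  refine ⟨?_, fun s hs => ?_⟩
  -- Lower bound: FKG for `B` and the event that `D` is not connected to `R`, then the conditional
  -- lower bound for `A`.
  · have h1 := rcInt_fkg (Λ := Λ) (W := W) lam del (J := ∅) (J' := J) hW hr.countable hr.s_mem
      hr.t_mem hJ hJN (Set.empty_subset _) (fun _ _ h => h.elim) hJs (E₁ := B)
      (E₂ := fun d b => ¬ Λ.ConnSets d b D R) (E₃ := fun _ _ => True)
      (E₄ := fun d b => B d b ∧ ¬ Λ.ConnSets d b D R) mB mG MeasEv.true (mB.and mG)
      (fun d d' b b' _ h1 h2 => ⟨trivial, dB _ _ _ _ Set.subset_union_left Set.inter_subset_left h1,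
        decr_not_connSets _ _ _ _ Set.subset_union_right Set.inter_subset_right h2⟩)
    have h2 := cmp a hJ hJR (mB.and mG) (xB.and explored_not_connSets) (fun d b _ h => h.2) hat
      fun d b hg _ => rcInt_mul_xOf_le lam del hr hW mA dA hg
    have h3 : Λ.rcInt lam del W J (fun d b => A (d ∪ J) b ∧ B d b ∧ ¬ Λ.ConnSets d b D R) ≤
        Λ.rcInt lam del W J E :=
      rcInt_mono lam del hr.countable fun d b hg h => (hE d b hg h.2.2).2 ⟨h.1, h.2.1⟩
    calc _ ≤ a * (Z * Λ.rcInt lam del W J fun d b => B d b ∧ ¬ Λ.ConnSets d b D R) :=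
          mul_le_mul' le_rfl h1
      _ = Z * (a * Λ.rcInt lam del W J fun d b => B d b ∧ ¬ Λ.ConnSets d b D R) := by ring
      _ ≤ _ := mul_le_mul' le_rfl (h2.trans (mul_le_mul' le_rfl h3))
  · have h1s : 1 + s ≠ ∞ := by finiteness
    -- With this `c`, tameness says that the conditional probability of `A` is at most `(1 + s) a /
    -- Z`.
    set c := (1 + s) * a with hc
    have hct : c ≠ ∞ := ENNReal.mul_ne_top h1s hat
    set H := Λ.Tame lam del W R D A c with hH
    have mH : MeasEv H := measEv_tame lam del hW hr.subset hD mA c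
    have xH : Λ.Explored N R H := explored_tame lam del
    have hHG : ∀ d b, H d b → ¬ Λ.ConnSets d b D R := fun d b h => h.1
    set h := Λ.rcInt lam del W ∅ H with hh
    set q := Λ.rcInt lam del W ∅ fun d b => ¬ Λ.ConnSets d b D R ∧ ¬ H d b with hq
    refine ⟨h, ?_, ?_⟩
    · have e1 : g = h + q := by
        rw [hg, rcInt_split lam del hW Set.finite_empty mG mH]
        congr 1
        exact rcInt_congr lam del hr.countable fun d b _ => ⟨fun h => h.2, fun h => ⟨h.1, h⟩⟩
      have e2 := cmp c Set.finite_empty hJR' (mG.and mH.not) (explored_not_connSets.and xH.not)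
        (fun d b _ h => h.1) hct fun d b _ hQ => by
          by_contra hcon
          exact hQ.2 ⟨hQ.1, (not_le.1 hcon).le⟩
      have e3 := cmp a Set.finite_empty hJR' mH xH (fun d b _ h => h.1) hat
        fun d b hg _ => rcInt_mul_xOf_le lam del hr hW mA dA hg
      have e4 : Λ.rcInt lam del W ∅ (fun d b => A (d ∪ ∅) b ∧ H d b) +
          Λ.rcInt lam del W ∅ (fun d b => A (d ∪ ∅) b ∧ ¬ Λ.ConnSets d b D R ∧ ¬ H d b) ≤ a := by
        rw [ha, rcInt_split lam del hW Set.finite_empty mA mH]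
        simp only [Set.union_empty]
        exact add_le_add le_rfl (rcInt_mono lam del hr.countable fun d b _ h => ⟨h.1, h.2.2⟩)
      -- Markov's argument: `A` has conditional probability at least `a / Z` on tame outcomes and
      -- more than `(1 + s) a / Z` on the others that avoid `D`, and its total mass is `a`.
      have e5 : a * (h + (1 + s) * q) ≤ a * Z := by
        calc a * (h + (1 + s) * q) = a * h + c * q := by rw [hc]; ring
          _ ≤ _ := add_le_add e3 e2
          _ ≤ Z * a := by
            rw [← mul_add]
            exact mul_le_mul' le_rfl e4
          _ = a * Z := mul_comm _ _
      rw [ENNReal.mul_le_mul_iff_right hA hat] at e5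
      calc (1 + s) * g = (h + (1 + s) * q) + s * h := by rw [e1]; ring
        _ ≤ Z + s * h := add_le_add e5 le_rfl
        _ = _ := add_comm _ _
    -- Tameness is decreasing, so FKG bounds `i h` by `Z` times the mass of their intersection, on
    -- which `E` factors and `A` is controlled by `c`.
    · have h1 := rcInt_fkg (Λ := Λ) (W := W) lam del (J := ∅) (J' := J) hW hr.countable hr.s_mem
        hr.t_mem hJ hJN (Set.empty_subset _) (fun _ _ h => h.elim) hJs (E₁ := E)
        (E₂ := H) (E₃ := fun _ _ => True) (E₄ := fun d b => E d b ∧ H d b) mE mH MeasEv.true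
        (mE.and mH) (fun d d' b b' hg h1 h2 => ⟨trivial,
          dE _ _ _ _ Set.subset_union_left Set.inter_subset_left h1,
          Tame.decr lam del hr hW mA dA lA
            (hg.subset Set.subset_union_right Set.subset_union_right)
            (hg.subset subset_rfl (Set.inter_subset_left.trans Set.subset_union_left))
            Set.subset_union_right Set.inter_subset_right h2⟩)
      have h2 : Λ.rcInt lam del W J (fun d b => E d b ∧ H d b) =
          Λ.rcInt lam del W J (fun d b => A (d ∪ J) b ∧ B d b ∧ H d b) :=
        rcInt_congr lam del hr.countable fun d b hg => by
          constructor
          · rintro ⟨h, h'⟩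
            have := (hE d b hg (hHG d b h')).1 h
            exact ⟨this.1, this.2, h'⟩
          · rintro ⟨h, h', h''⟩
            exact ⟨(hE d b hg (hHG d b h'')).2 ⟨h, h'⟩, h''⟩
      have h3 := rcInt_le_of_xOf_le lam del hr hW hJ hJR mA MeasEv.true (mB.and mH)
        (Explored.and xB xH) (fun d b h h' => lA d b h (hHG d b h'.2))
        (fun d b _ _ => LocalOff.true) hZt hct fun d b _ h => h.2.2
      rw [hT] at h3
      refine h1.trans ?_
      rw [h2]
      refine h3.trans (mul_le_mul' le_rfl ?_)
      exact rcInt_mono lam del hr.countable fun d b _ h => h.1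

end

end Box


/-! ### Spin probabilities as random-cluster integrals. -/

namespace Box

variable {Λ : Box} {d b Γ Δ W J : Set Pt} {τ α ρ : Pt → ℤˣ}

lemma units_ne_one {u : ℤˣ} (h : u ≠ 1) : u = -1 := (Int.units_eq_one_or u).resolve_left h

/-- The number of spin allocations compatible with the spins prescribed on `W`. -/
lemma card_alloc (hd : d.Finite) :
    Nat.card {f : Λ.clusters d b → ℤˣ // ∀ C, ∀ p ∈ C.1 ∩ W, f C = ρ p} =
      Λ.wtOn W (¬ Λ.ConnSets d b (spinPart W ρ 1) (spinPart W ρ (-1))) d b := by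
  classical
  by_cases h : Λ.ConnSets d b (spinPart W ρ 1) (spinPart W ρ (-1))
  · rw [wtOn_neg (not_not.2 h)]
    obtain ⟨p, hp, q, hq, hc⟩ := h
    have : IsEmpty {f : Λ.clusters d b → ℤˣ // ∀ C, ∀ p ∈ C.1 ∩ W, f C = ρ p} := by
      refine ⟨fun f => ?_⟩
      have hpp : Λ.Conn d b p p := hc.trans hc.symm
      have h1 := f.2 ⟨{z | Λ.Conn d b p z}, p, hpp, rfl⟩ p ⟨hpp, hp.1⟩
      have h2 := f.2 ⟨{z | Λ.Conn d b p z}, p, hpp, rfl⟩ q ⟨hc, hq.1⟩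
      rw [h1, hp.2, hq.2] at h2
      exact absurd h2 (by decide)
    exact Nat.card_of_isEmpty
  · rw [wtOn_pos h]
    have hfin : Finite (Λ.freeClusters d b W) := (freeClusters_finite hd).to_subtype
    have hcons : ∀ C ∈ Λ.clusters d b, ∀ p ∈ C ∩ W, ∀ q ∈ C ∩ W, ρ p = ρ q := by
      rintro C ⟨z, hz, rfl⟩ p hp q hq
      have hpq : Λ.Conn d b p q := hp.1.symm.trans hq.1
      by_contra hne
      rcases Int.units_eq_one_or (ρ p) with h1 | h1
      · exact h ⟨p, ⟨hp.2, h1⟩, q, ⟨hq.2, units_ne_one fun h2 => hne (h1.trans h2.symm)⟩, hpq⟩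
      · rcases Int.units_eq_one_or (ρ q) with h2 | h2
        · exact h ⟨q, ⟨hq.2, h2⟩, p, ⟨hp.2, h1⟩, hpq.symm⟩
        · exact hne (h1.trans h2.symm)
    let e : {f : Λ.clusters d b → ℤˣ // ∀ C, ∀ p ∈ C.1 ∩ W, f C = ρ p} ≃
        (Λ.freeClusters d b W → ℤˣ) :=
      { toFun := fun f C => f.1 ⟨C.1, C.2.1⟩
        invFun := fun g => ⟨fun C => if hC : (C.1 ∩ W).Nonempty then ρ hC.some else
            g ⟨C.1, C.2, Set.disjoint_iff_inter_eq_empty.2 (Set.not_nonempty_iff_eq_empty.1 hC)⟩, by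
          intro C p hp
          have hne : (C.1 ∩ W).Nonempty := ⟨p, hp⟩
          exact (dif_pos hne).trans (hcons C.1 C.2 _ hne.some_mem _ hp)⟩
        left_inv := by
          intro f
          ext C
          simp only
          split_ifs with hC
          · rw [f.2 C _ hC.some_mem]
          · rfl
        right_inv := by
          intro g
          funext C
          have : ¬ (C.1 ∩ W).Nonempty := by
            rw [Set.not_nonempty_iff_eq_empty]
            exact Set.disjoint_iff_inter_eq_empty.1 C.2.2
          exact dif_neg this }
    rw [Nat.card_congr e, Nat.card_fun, freeCount, Set.ncard_def, Nat.card_eq_fintype_card (α := ℤˣ)]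
    rfl

open Classical in
/-- The boundary condition `τ` on `Γ` extended by `α`. -/
noncomputable def joinSpin (Γ : Set Pt) (τ α : Pt → ℤˣ) : Pt → ℤˣ := fun p =>
  if p ∈ Γ then τ p else α p

lemma joinSpin_of_mem {p : Pt} (h : p ∈ Γ) : joinSpin Γ τ α p = τ p := if_pos h

lemma joinSpin_of_notMem {p : Pt} (h : p ∉ Γ) : joinSpin Γ τ α p = α p := if_neg h

/-- The boundary condition `τ` on `Γ` is compatible with the configuration with deaths `d ∪ J`. -/
def Compat (Λ : Box) (J Γ : Set Pt) (τ : Pt → ℤˣ) (d b : Set Pt) : Prop :=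
  ¬ Λ.ConnSets (d ∪ J) b (spinPart Γ τ 1) (spinPart Γ τ (-1))

lemma card_spinAlloc (hJ : (Λ.forcedJumps Γ τ).Finite) (ω : Config) :
    Nat.card (Λ.SpinAlloc Γ τ ω) = Λ.wtOn Γ
      (Λ.Compat (Λ.forcedJumps Γ τ) Γ τ ω.deaths ω.bridges) (Λ.deathsWith Γ τ ω) ω.bridges :=
  card_alloc (ω.finite_deaths.union hJ)

/-- Prescribing `α` on `Δ` in addition to `τ` on `Γ` amounts to a single boundary condition on `Δ ∪
Γ`; this is where the wiring on `Δ ∪ Γ` comes from. -/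
lemma card_spinAlloc_join (hJ : (Λ.forcedJumps Γ τ).Finite) (hΔΓ : Disjoint Δ Γ) (ω : Config) :
    Nat.card {f : Λ.SpinAlloc Γ τ ω // ∀ C, ∀ p ∈ C.1 ∩ Δ, f.1 C = α p} = Λ.wtOn (Δ ∪ Γ)
      (Λ.Compat (Λ.forcedJumps Γ τ) (Δ ∪ Γ) (joinSpin Γ τ α) ω.deaths ω.bridges)
      (Λ.deathsWith Γ τ ω) ω.bridges := by
  rw [show Λ.wtOn (Δ ∪ Γ)
      (Λ.Compat (Λ.forcedJumps Γ τ) (Δ ∪ Γ) (joinSpin Γ τ α) ω.deaths ω.bridges)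
      (Λ.deathsWith Γ τ ω) ω.bridges = _ from (card_alloc (ω.finite_deaths.union hJ)).symm]
  refine Nat.card_congr ⟨fun f => ⟨f.1.1, ?_⟩, fun f => ⟨⟨f.1, ?_⟩, ?_⟩, fun f => rfl,
    fun f => rfl⟩
  · rintro C p ⟨hpC, hp | hp⟩
    · rw [joinSpin_of_notMem (Set.disjoint_left.1 hΔΓ hp)]
      exact f.2 C p ⟨hpC, hp⟩
    · rw [joinSpin_of_mem hp]
      exact f.1.2 C p ⟨hpC, hp⟩
  · rintro C p ⟨hpC, hp⟩
    rw [f.2 C p ⟨hpC, Or.inr hp⟩, joinSpin_of_mem hp]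
  · rintro C p ⟨hpC, hp⟩
    exact (f.2 C p ⟨hpC, Or.inl hp⟩).trans (joinSpin_of_notMem (Set.disjoint_left.1 hΔΓ hp))

open Classical in
/-- The extension by `1` of spins on `Δ`. -/
noncomputable def extendSpin (Δ : Set Pt) (a : Δ → ℤˣ) : Pt → ℤˣ := fun p =>
  if h : p ∈ Δ then a ⟨p, h⟩ else 1

/-- When no point of `Δ` is dead, each of them lies in a cluster, so an allocation determines a spin
pattern on `Δ`. -/
lemma sum_card_spinAlloc_join [Fintype Δ] [DecidableEq Δ] (hJ : (Λ.forcedJumps Γ τ).Finite)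
    (hΔΛ : Δ ⊆ Λ.carrier) {ω : Config} (hΔ : Disjoint Δ (Λ.deathsWith Γ τ ω)) :
    Nat.card (Λ.SpinAlloc Γ τ ω) = ∑ a : Δ → ℤˣ,
      Nat.card {f : Λ.SpinAlloc Γ τ ω // ∀ C, ∀ p ∈ C.1 ∩ Δ, f.1 C = extendSpin Δ a p} := by
  classical
  have hfin : Finite (Λ.clusters (Λ.deathsWith Γ τ ω) ω.bridges) :=
    (clusters_finite (ω.finite_deaths.union hJ)).to_subtype
  have : Finite (Λ.SpinAlloc Γ τ ω) := by
    unfold SpinAlloc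
    infer_instance
  have hself : ∀ p : Δ, Λ.Conn (Λ.deathsWith Γ τ ω) ω.bridges p.1 p.1 := fun p =>
    conn_refl (hΔΛ p.2) (Set.disjoint_left.1 hΔ p.2)
  let F : Λ.SpinAlloc Γ τ ω → (Δ → ℤˣ) := fun f p =>
    f.1 ⟨{q | Λ.Conn (Λ.deathsWith Γ τ ω) ω.bridges p.1 q}, p.1, hself p, rfl⟩
  rw [← Nat.card_congr (Equiv.sigmaFiberEquiv F), Nat.card_sigma]
  refine Finset.sum_congr rfl fun a _ => Nat.card_congr (Equiv.subtypeEquivRight fun f => ?_)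
  constructor
  · rintro rfl ⟨C, z, hz, rfl⟩ p ⟨hpC, hp⟩
    simp only [extendSpin, dif_pos hp, F]
    refine congrArg f.1 (Subtype.ext ?_)
    ext q
    exact ⟨fun h => hpC.symm.trans h, fun h => hpC.trans h⟩
  · intro h
    funext p
    have := h ⟨{q | Λ.Conn (Λ.deathsWith Γ τ ω) ω.bridges p.1 q}, p.1, hself p, rfl⟩ p.1
      ⟨hself p, p.2⟩
    simp only [extendSpin, dif_pos p.2] at this
    exact this

end Box


namespace Box

variable {Λ : Box} (lam del : ℝ) {d b Γ Δ W J : Set Pt} {τ α ρ : Pt → ℤˣ}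

lemma spinPart_subset {i : ℤˣ} : spinPart Γ τ i ⊆ Γ := fun _ h => h.1

lemma measEv_compat (hΓ : Γ ⊆ Λ.carrier) (hJ : J.Finite) : MeasEv (Λ.Compat J Γ τ) :=
  MeasEv.comp_union (E := fun d b => ¬ Λ.ConnSets d b (spinPart Γ τ 1) (spinPart Γ τ (-1)))
    (MeasEv.not (MeasEv.connSets Λ (spinPart_subset.trans hΓ) (spinPart_subset.trans hΓ))) hJ

lemma decr_compat : Decr (Λ.Compat J Γ τ) :=
  fun _ _ _ _ hd hb h h' => h (h'.mono (Set.union_subset_union_left _ hd) hb)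

lemma ConnSets.mono_sets {S S' T T' : Set Pt} (hS : S ⊆ S') (hT : T ⊆ T')
    (h : Λ.ConnSets d b S T) : Λ.ConnSets d b S' T' := by
  obtain ⟨p, hp, q, hq, h⟩ := h
  exact ⟨p, hS hp, q, hT hq, h⟩

lemma Compat.of_join (h : Λ.Compat J (Δ ∪ Γ) (joinSpin Γ τ α) d b) : Λ.Compat J Γ τ d b :=
  fun h' => h (h'.mono_sets
    (fun _ hp => ⟨Or.inr hp.1, (joinSpin_of_mem hp.1).trans hp.2⟩)
    (fun _ hp => ⟨Or.inr hp.1, (joinSpin_of_mem hp.1).trans hp.2⟩))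

open Classical in
lemma measurable_clusterCount (hW : W ⊆ Λ.carrier) (hJ : J.Finite) : Measurable fun ω : Config =>
    (2 : ℝ≥0∞) ^ Λ.clusterCount (ω.deaths ∪ J) ω.bridges W := by
  have h := Λ.measurable_freeCount (MeasFam.deaths.union (MeasFam.const hJ.countable))
    (fun ω : Config => ω.finite_deaths.union hJ) MeasFam.bridges hW
  exact (measurable_from_nat (f := fun n => (2 : ℝ≥0∞) ^ (n + if W.Nonempty then 1 else 0))).comp h

open Classical in
lemma rcWeight_apply {E : Set Pt → Set Pt → Prop}
    (mE : MeasEv E) : Λ.rcWeight lam del J W {ω | E ω.deaths ω.bridges} =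
      2 ^ (if W.Nonempty then 1 else 0) * Λ.rcInt lam del W J E := by
  have hS : MeasurableSet {ω : Config | E ω.deaths ω.bridges} := measurableSet_setOfPred.2
    (mE _ _ _ MeasFam.deaths MeasFam.bridges Config.finite_deaths Config.finite_bridges)
  unfold rcWeight rcInt
  rw [withDensity_apply _ hS, ← lintegral_indicator hS, ← lintegral_const_mul' _ _ (by finiteness)]
  refine lintegral_congr fun ω => ?_
  by_cases h : E ω.deaths ω.bridges
  · rw [Set.indicator_of_mem (by exact h), wt_of_mem h, clusterCount_eq, pow_add, mul_comm]
    push_cast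
    rfl
  · rw [Set.indicator_of_notMem (by exact h), wt_of_not h]
    simp

/-- On compatible configurations the number of allocations is exactly the cluster weight wired on
`Γ`, so it cancels against the density and leaves the weight wired on `Δ ∪ Γ`. -/
lemma lintegral_spinProbGiven (hΓ : Γ ⊆ Λ.carrier) (hΔΓ : Disjoint Δ Γ)
    (hJ : (Λ.forcedJumps Γ τ).Finite) :
    ∫⁻ ω, Λ.spinProbGiven Γ τ Δ α ω ∂Λ.boundaryMeasure lam del Γ τ =
      (Λ.rcInt lam del Γ (Λ.forcedJumps Γ τ) (Λ.Compat (Λ.forcedJumps Γ τ) Γ τ))⁻¹ *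
        Λ.rcInt lam del (Δ ∪ Γ) (Λ.forcedJumps Γ τ)
          (Λ.Compat (Λ.forcedJumps Γ τ) (Δ ∪ Γ) (joinSpin Γ τ α)) := by
  classical
  set J := Λ.forcedJumps Γ τ with hJdef
  have mC : MeasEv (Λ.Compat J Γ τ) := measEv_compat hΓ hJ
  have hS : MeasurableSet {ω : Config | Λ.Compat J Γ τ ω.deaths ω.bridges} :=
    measurableSet_setOfPred.2
      (mC _ _ _ MeasFam.deaths MeasFam.bridges Config.finite_deaths Config.finite_bridges)
  have hb : Λ.boundaryMeasure lam del Γ τ = ProbabilityTheory.cond (Λ.rcWeight lam del J Γ)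
      {ω : Config | Λ.Compat J Γ τ ω.deaths ω.bridges} := rfl
  set κ : ℝ≥0∞ := 2 ^ (if Γ.Nonempty then 1 else 0) with hκ
  have hκ0 : κ ≠ 0 := by rw [hκ]; positivity
  have hκt : κ ≠ ∞ := by rw [hκ]; finiteness
  rw [hb, ProbabilityTheory.cond, lintegral_smul_measure, rcWeight_apply lam del mC]
  unfold rcWeight
  rw [restrict_withDensity hS, lintegral_withDensity_eq_lintegral_mul_non_measurable _
    (measurable_clusterCount hΓ hJ) (ae_of_all _ fun ω => by finiteness),
    ← lintegral_indicator hS]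
  have e : ∫⁻ ω, Set.indicator {ω : Config | Λ.Compat J Γ τ ω.deaths ω.bridges}
      ((fun ω : Config => (2 : ℝ≥0∞) ^ Λ.clusterCount (ω.deaths ∪ J) ω.bridges Γ) *
        fun ω => Λ.spinProbGiven Γ τ Δ α ω) ω ∂Λ.percolation lam del =
      κ * Λ.rcInt lam del (Δ ∪ Γ) J (Λ.Compat J (Δ ∪ Γ) (joinSpin Γ τ α)) := by
    unfold rcInt
    rw [← lintegral_const_mul' _ _ hκt]
    refine lintegral_congr fun ω => ?_
    by_cases h : Λ.Compat J Γ τ ω.deaths ω.bridges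
    · rw [Set.indicator_of_mem (by exact h), Pi.mul_apply, spinProbGiven,
        card_spinAlloc hJ, card_spinAlloc_join hJ hΔΓ, wtOn_pos h, clusterCount_eq, pow_add,
        wt_eq_wtOn]
      simp only [deathsWith, ← hJdef, ← hκ]
      push_cast
      set m := (2 : ℝ≥0∞) ^ Λ.freeCount (ω.deaths ∪ J) ω.bridges Γ with hm
      have hm0 : m ≠ 0 := by rw [hm]; positivity
      have hmt : m ≠ ∞ := by rw [hm]; finiteness
      rw [mul_comm m κ, mul_assoc, ENNReal.mul_div_cancel hm0 hmt]
    · rw [Set.indicator_of_notMem (by exact h), wt_of_not fun h' => h h'.of_join]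
      simp
  rw [e, smul_eq_mul, ENNReal.mul_inv (Or.inl hκ0) (Or.inl hκt)]
  calc _ = (κ⁻¹ * κ) * ((Λ.rcInt lam del Γ J (Λ.Compat J Γ τ))⁻¹ *
        Λ.rcInt lam del (Δ ∪ Γ) J (Λ.Compat J (Δ ∪ Γ) (joinSpin Γ τ α))) := by ring
    _ = _ := by rw [ENNReal.inv_mul_cancel hκ0 hκt, one_mul]

/-- This rewrites the normalizing constant, wired on `Γ` alone, with the wiring on `Δ ∪ Γ` used
everywhere else. -/
lemma rcInt_compat_eq_sum [Fintype Δ] [DecidableEq Δ] {N : Set ℝ} (hN : N.Countable)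
    (hΓ : Γ ⊆ Λ.carrier) (hΔΛ : Δ ⊆ Λ.carrier) (hΔΓ : Disjoint Δ Γ)
    (hJ : (Λ.forcedJumps Γ τ).Finite) (hΔN : ∀ p ∈ Δ, p.2 ∈ N)
    (hΔJ : Disjoint Δ (Λ.forcedJumps Γ τ)) :
    Λ.rcInt lam del Γ (Λ.forcedJumps Γ τ) (Λ.Compat (Λ.forcedJumps Γ τ) Γ τ) =
      ∑ a : Δ → ℤˣ, Λ.rcInt lam del (Δ ∪ Γ) (Λ.forcedJumps Γ τ)
        (Λ.Compat (Λ.forcedJumps Γ τ) (Δ ∪ Γ) (joinSpin Γ τ (extendSpin Δ a))) := by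
  have hW : Δ ∪ Γ ⊆ Λ.carrier := Set.union_subset hΔΛ hΓ
  unfold rcInt
  rw [← lintegral_finsetSum _ fun a _ => measurable_wt_config hW hJ (measEv_compat hW hJ)]
  refine lintegral_congr_ae ?_
  filter_upwards [Λ.ae_gen lam del hN] with ω hω
  have h := sum_card_spinAlloc_join hJ hΔΛ (ω := ω) (Set.disjoint_union_right.2
    ⟨Set.disjoint_left.2 fun p hp hpd => hω.1.d_N p hpd (hΔN p hp), hΔJ⟩)
  rw [card_spinAlloc hJ] at h
  simp only [card_spinAlloc_join hJ hΔΓ] at h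
  exact_mod_cast h

lemma wired_apply {E : Set Pt → Set Pt → Prop} (mE : MeasEv E) :
    Λ.wired lam del W {ω | E ω.deaths ω.bridges} =
      (Λ.rcInt lam del W ∅ fun _ _ => True)⁻¹ * Λ.rcInt lam del W ∅ E := by
  classical
  have h1 := rcWeight_apply (Λ := Λ) (W := W) (J := ∅) lam del mE
  have h2 := rcWeight_apply (Λ := Λ) (W := W) (J := ∅) lam del MeasEv.true
  rw [show {ω : Config | True} = Set.univ from Set.eq_univ_of_forall fun _ => trivial] at h2
  set κ : ℝ≥0∞ := 2 ^ (if W.Nonempty then 1 else 0) with hκ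
  have hκ0 : κ ≠ 0 := by rw [hκ]; positivity
  have hκt : κ ≠ ∞ := by rw [hκ]; finiteness
  rw [wired, Measure.smul_apply, h1, h2, smul_eq_mul, ENNReal.mul_inv (Or.inl hκ0) (Or.inl hκt)]
  calc _ = (κ⁻¹ * κ) * ((Λ.rcInt lam del W ∅ fun _ _ => True)⁻¹ * Λ.rcInt lam del W ∅ E) := by ring
    _ = _ := by rw [ENNReal.inv_mul_cancel hκ0 hκt, one_mul]

end Box


/-! ### Forced jumps and screening for spin boundary conditions. -/

namespace Box

variable {Λ : Box} (lam del : ℝ) {d b Γ Δ D R W J S : Set Pt} {N : Set ℝ} {τ α σ : Pt → ℤˣ}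
  {p q z : Pt}

lemma Glued.mem_carrier (h : Λ.Glued p q) (hq : q ∈ Λ.carrier) : p ∈ Λ.carrier := by
  obtain ⟨h1, h2⟩ := h
  refine ⟨h1 ▸ hq.1, h1 ▸ hq.2.1, ?_⟩
  rcases h2 with ⟨h, -⟩ | ⟨h, -⟩ <;> rw [h]
  · exact ⟨le_rfl, Λ.hst⟩
  · exact ⟨Λ.hst, le_rfl⟩

lemma sat_sat : Λ.Sat (Λ.sat S) := by
  rintro p q (hp | ⟨r, hr, h1⟩) h2
  · exact Or.inr ⟨p, hp, h2.symm⟩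
  · refine Or.inl ?_
    have : q = r := by
      refine Prod.ext (h2.1.symm.trans h1.1) ?_
      rcases h1.2 with ⟨h3, h4⟩ | ⟨h3, h4⟩ <;> rcases h2.2 with ⟨h5, h6⟩ | ⟨h5, h6⟩ <;> linarith
    rwa [this]

lemma finite_sat (hS : S.Finite) : (Λ.sat S).Finite := by
  refine ((hS.union (hS.image fun q => ((q.1, Λ.s) : Pt))).union
    (hS.image fun q => ((q.1, Λ.t) : Pt))).subset ?_
  rintro p (hp | ⟨q, hq, h1, h2⟩)
  · exact Or.inl (Or.inl hp)
  · rcases h2 with ⟨h2, -⟩ | ⟨h2, -⟩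
    · exact Or.inl (Or.inr ⟨q, hq, Prod.ext h1.symm h2.symm⟩)
    · exact Or.inr ⟨q, hq, Prod.ext h1.symm h2.symm⟩

lemma isClosed_carrier : IsClosed Λ.carrier := by
  have : Λ.carrier = Set.Icc Λ.a Λ.b ×ˢ Set.Icc Λ.s Λ.t := by
    ext p
    simp only [carrier, Set.mem_ofPred_eq, Set.mem_prod, Set.mem_Icc]
    tauto
  rw [this]
  exact isClosed_Icc.prod isClosed_Icc

lemma closure_subset_carrier (hS : S ⊆ Λ.carrier) : closure S ⊆ Λ.carrier :=
  closure_minimal hS isClosed_carrier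

/-- Away from the jump set of an extension of `τ`, the spin is locally constant, so a point cannot
be a limit of both spin parts. Finiteness of the set of forced jumps follows. -/
lemma forcedJumps_subset (hΓ : Γ ⊆ Λ.carrier) (hσ : Set.EqOn τ σ Γ)
    (hglue : ∀ p q, Λ.Glued p q → σ p = σ q) (hJ : J.Finite)
    (hconn : ∀ p q, Λ.Conn J ∅ p q → σ p = σ q) : Λ.forcedJumps Γ τ ⊆ Λ.sat J := by
  rintro z ⟨h1, h2⟩
  by_contra hz
  have near : ∀ i, ∀ q ∈ closure (spinPart Γ τ i), q ∉ J → σ q = i := by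
    intro i q hq hqJ
    obtain ⟨ε, hε, h⟩ := exists_conn_nhd (b := ∅) hJ
      (closure_subset_carrier (spinPart_subset.trans hΓ) hq) hqJ
    obtain ⟨p, hp, hp1, hp2⟩ := exists_near hq hε
    rw [hconn q p (h p (hΓ hp.1) hp1 hp2), ← hσ hp.1, hp.2]
  have key : ∀ i, z ∈ Λ.sat (closure (spinPart Γ τ i)) → σ z = i := by
    rintro i (h | ⟨q, hq, hg⟩)
    · exact near i z h fun h' => hz (Or.inl h')
    · rw [hglue z q hg]
      exact near i q hq fun h' => hz (Or.inr ⟨q, h', hg⟩)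
  have := (key 1 h1).symm.trans (key (-1) h2)
  exact absurd this (by decide)

lemma finite_forcedJumps (hΓ : Γ ⊆ Λ.carrier) (hτ : τ ∈ Λ.spinConfigs Γ) :
    (Λ.forcedJumps Γ τ).Finite := by
  obtain ⟨σ, hσ, hglue, J, hJ, hconn⟩ := hτ
  exact (finite_sat hJ).subset (forcedJumps_subset hΓ hσ hglue hJ hconn)

lemma sat_forcedJumps : Λ.Sat (Λ.forcedJumps Γ τ) :=
  fun p q hp hg => ⟨sat_sat p q hp.1 hg, sat_sat p q hp.2 hg⟩

lemma mem_reach_of_mem_closure (hR : R ⊆ Λ.carrier) (hΓR : Γ ⊆ closure R)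
    (hd : d.Finite) (hq : q ∈ closure Γ) (hqd : q ∉ d) : q ∈ Λ.reach d b R := by
  have hq' : q ∈ closure R := closure_minimal hΓR isClosed_closure hq
  obtain ⟨r, hr, -, hc⟩ := exists_conn_dense (S := closure R) (b := b) hd subset_rfl hR hq'
    (conn_refl (closure_subset_carrier hR hq') hqd)
  exact ⟨r, hr, hc.symm⟩

lemma Gen.glued_notMem (hg : Λ.Gen N d b) (hs : Λ.s ∈ N) (ht : Λ.t ∈ N) (h : Λ.Glued p q) :
    q ∉ d := by
  intro hq
  rcases h.2 with ⟨-, h⟩ | ⟨-, h⟩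
  · exact hg.d_N q hq (h ▸ ht)
  · exact hg.d_N q hq (h ▸ hs)

/-- Forced jumps are limits of `Γ`, up to the identification, and in general position they are not
deaths; hence they lie in clusters of the roots. -/
lemma forcedJumps_subset_reach (hr : Roots Λ N R) (hΓR : Γ ⊆ closure R)
    (hJN : ∀ z ∈ Λ.forcedJumps Γ τ, z.2 ∈ N) (hg : Λ.Gen N d b) :
    Λ.forcedJumps Γ τ ⊆ Λ.reach d b R := by
  rintro z hz
  have hzd : z ∉ d := fun h => hg.d_N z h (hJN z hz)
  rcases hz.1 with h | ⟨q, hq, hgl⟩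
  · exact mem_reach_of_mem_closure hr.subset hΓR hg.d_fin (closure_mono spinPart_subset h) hzd
  · have hqd := hg.glued_notMem hr.s_mem hr.t_mem hgl
    have hqr := mem_reach_of_mem_closure (b := b) hr.subset hΓR hg.d_fin
      (closure_mono spinPart_subset hq) hqd
    have hqc := reach_subset_carrier hqr
    exact mem_reach_of_conn hqr (.single ⟨hqc, hgl.mem_carrier hqc, hqd, hzd,
      Or.inr (Or.inr hgl.symm)⟩)

/-- Every living point of `Γ` is explored, so connections between points of `Γ` take place inside
the explored set, even after the forced deaths have cut it further. -/
lemma explored_compat (hR : R ⊆ Γ) (hΓ : Γ ⊆ Λ.carrier) (hΓR : Γ ⊆ closure R) :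
    Λ.Explored N R (Λ.Compat J Γ τ) := by
  intro d₁ b₁ d₂ b₂ g₁ g₂ he ho
  set C := Λ.reach d₁ b₁ R with hC
  have u₁ : Λ.Uncrossed C (d₁ ∪ d₂ ∪ J) (b₁ ∪ b₂) :=
    uncrossed_of_subset (Set.subset_union_left.trans Set.subset_union_left)
      fun e he => he.imp id (ho.2 e)
  have u₂ : Λ.Uncrossed C (d₁ ∪ J) b₁ :=
    uncrossed_of_subset Set.subset_union_left fun e he => Or.inl he
  have ha : AgreeOn C (d₁ ∪ d₂ ∪ J) (b₁ ∪ b₂) (d₁ ∪ J) b₁ := by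
    refine ⟨fun z hz => ?_, fun e he _ => ?_⟩
    · have : z ∉ d₂ := fun h => ho.1 z h hz
      simp only [Set.mem_union]
      tauto
    · have : e ∉ b₂ := fun h => ho.2 e h (Or.inl he)
      simp only [Set.mem_union]
      tauto
  have hmem : ∀ p ∈ Γ, p ∉ d₁ → p ∈ C := fun p hp hpd =>
    mem_reach_of_mem_closure (hR.trans hΓ) hΓR g₁.d_fin (subset_closure hp) hpd
  refine not_congr ⟨?_, ?_⟩
  · rintro ⟨p, hp, q, hq, h⟩
    refine ⟨p, hp, q, hq, (ha.conn_iff u₁ u₂ (hmem p hp.1 fun h' => ?_)).1 h⟩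
    exact h.mem_left.2 (Or.inl (Or.inl h'))
  · rintro ⟨p, hp, q, hq, h⟩
    refine ⟨p, hp, q, hq, (ha.conn_iff u₁ u₂ (hmem p hp.1 fun h' => ?_)).2 h⟩
    exact h.mem_left.2 (Or.inl h')

/-- Without connections between `Δ` and `Γ`, a conflict of spins occurs within `Δ` or within `Γ`. -/
lemma compat_join_iff (hΔΓ : Disjoint Δ Γ) (h : Disjoint Δ (Λ.reach d b Γ)) :
    Λ.Compat J (Δ ∪ Γ) (joinSpin Γ τ α) d b ↔
      ¬ Λ.ConnSets (d ∪ J) b (spinPart Δ α 1) (spinPart Δ α (-1)) ∧ Λ.Compat J Γ τ d b := by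
  constructor
  · refine fun h' => ⟨fun hc => h' (hc.mono_sets ?_ ?_), h'.of_join⟩ <;>
      exact fun p hp => ⟨Or.inl hp.1,
        (joinSpin_of_notMem (Set.disjoint_left.1 hΔΓ hp.1)).trans hp.2⟩
  · rintro ⟨h1, h2⟩ ⟨p, ⟨hp, hpi⟩, q, ⟨hq, hqi⟩, hc⟩
    have hc' : Λ.Conn d b p q := hc.mono Set.subset_union_left subset_rfl
    rcases hp with hp | hp <;> rcases hq with hq | hq
    · rw [joinSpin_of_notMem (Set.disjoint_left.1 hΔΓ hp)] at hpi
      rw [joinSpin_of_notMem (Set.disjoint_left.1 hΔΓ hq)] at hqi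
      exact h1 ⟨p, ⟨hp, hpi⟩, q, ⟨hq, hqi⟩, hc⟩
    · exact Set.disjoint_left.1 h hp ⟨q, hq, hc'.symm⟩
    · exact Set.disjoint_left.1 h hq ⟨p, hp, hc'⟩
    · rw [joinSpin_of_mem hp] at hpi
      rw [joinSpin_of_mem hq] at hqi
      exact h2 ⟨p, ⟨hp, hpi⟩, q, ⟨hq, hqi⟩, hc⟩

/-- A countable set of times and a countable dense subset of `Γ` for the exploration. -/
lemma exists_roots (hΓ : Γ ⊆ Λ.carrier) (hΔ : Δ.Finite) (hJ : J.Finite) :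
    ∃ N R, Roots Λ N R ∧ R ⊆ Γ ∧ Γ ⊆ closure R ∧ (∀ z ∈ J, z.2 ∈ N) ∧ ∀ z ∈ Δ, z.2 ∈ N := by
  obtain ⟨R, hR, hRc, hΓR⟩ := exists_countable_dense Γ
  refine ⟨insert Λ.s (insert Λ.t ((fun z : Pt => z.2) '' (R ∪ J ∪ Δ))), R,
    ⟨?_, ?_, ?_, hR.trans hΓ, fun γ hγ => ?_⟩, hR, hΓR, fun z hz => ?_, fun z hz => ?_⟩
  · exact ((((hRc.union hJ.countable).union hΔ.countable).image _).insert _).insert _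
  · exact Set.mem_insert _ _
  · exact Set.mem_insert_of_mem _ (Set.mem_insert _ _)
  · exact Set.mem_insert_of_mem _ (Set.mem_insert_of_mem _ ⟨γ, Or.inl (Or.inl hγ), rfl⟩)
  · exact Set.mem_insert_of_mem _ (Set.mem_insert_of_mem _ ⟨z, Or.inl (Or.inr hz), rfl⟩)
  · exact Set.mem_insert_of_mem _ (Set.mem_insert_of_mem _ ⟨z, Or.inr hz, rfl⟩)

lemma connSets_dense_iff (hR : R ⊆ Γ) (hΓ : Γ ⊆ Λ.carrier) (hΓR : Γ ⊆ closure R)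
    (hd : d.Finite) : Λ.ConnSets d b D R ↔ Λ.ConnSets d b D Γ := by
  rw [connSets_iff_reach, connSets_iff_reach, reach_eq_of_dense hd hΓR hR hΓ]

/-- A forced jump in `Δ` would be connected to `Γ` in almost every configuration, and by separation
so would `D`; the event that `D` is not connected to `Γ` would then be null. -/
lemma disjoint_forcedJumps (hΓ : Γ ⊆ Λ.carrier) (hΔ : Δ.Finite) (hD : D ⊆ Λ.carrier)
    (hsep : Λ.Separates D Δ Γ) (hτ : τ ∈ Λ.spinConfigs Γ)
    (hg : (Λ.rcInt lam del W ∅ fun d b => ¬ Λ.ConnSets d b D Γ) ≠ 0) :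
    Disjoint Δ (Λ.forcedJumps Γ τ) := by
  obtain ⟨N, R, hr, hRΓ, hΓR, hJN, -⟩ :=
    exists_roots (J := Λ.forcedJumps Γ τ) hΓ hΔ (finite_forcedJumps hΓ hτ)
  rw [Set.disjoint_left]
  intro z hzΔ hzJ
  refine hg (le_antisymm ?_ zero_le)
  have : (Λ.rcInt lam del W ∅ fun d b => ¬ Λ.ConnSets d b D Γ) ≤
      Λ.rcInt lam del W ∅ fun _ _ => False := by
    refine rcInt_mono lam del hr.countable fun d b hg h => ?_
    refine Set.disjoint_left.1 (disjoint_reach_of_separates hg hr.s_mem hr.t_mem hD hsep h) hzΔ ?_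
    rw [← reach_eq_of_dense hg.d_fin hΓR hRΓ hΓ]
    exact forcedJumps_subset_reach hr hΓR hJN hg hzJ
  refine this.trans (le_of_eq ?_)
  unfold rcInt
  simp [wt_of_not]

/-- Random-cluster bounds for the joint compatibility with spins on `Δ` and `Γ`. -/
theorem compat_screening (hΓ : Γ ⊆ Λ.carrier) (hΔΛ : Δ ⊆ Λ.carrier) (hΔ : Δ.Finite)
    (hΔΓ : Disjoint Δ Γ) (hD : D ⊆ Λ.carrier) (hsep : Λ.Separates D Δ Γ)
    (hτ : τ ∈ Λ.spinConfigs Γ)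
    (hA : (Λ.rcInt lam del (Δ ∪ Γ) ∅ fun d b =>
      ¬ Λ.ConnSets d b (spinPart Δ α 1) (spinPart Δ α (-1))) ≠ 0) :
    (Λ.rcInt lam del (Δ ∪ Γ) ∅ fun d b =>
        ¬ Λ.ConnSets d b (spinPart Δ α 1) (spinPart Δ α (-1))) *
      (Λ.rcInt lam del (Δ ∪ Γ) (Λ.forcedJumps Γ τ) (Λ.Compat (Λ.forcedJumps Γ τ) Γ τ) *
        Λ.rcInt lam del (Δ ∪ Γ) ∅ fun d b => ¬ Λ.ConnSets d b D Γ) ≤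
      (Λ.rcInt lam del (Δ ∪ Γ) ∅ fun _ _ => True) *
        ((Λ.rcInt lam del (Δ ∪ Γ) ∅ fun _ _ => True) *
        Λ.rcInt lam del (Δ ∪ Γ) (Λ.forcedJumps Γ τ)
          (Λ.Compat (Λ.forcedJumps Γ τ) (Δ ∪ Γ) (joinSpin Γ τ α))) ∧
    ∀ s : ℝ≥0∞, s ≠ ∞ → ∃ h : ℝ≥0∞,
      (1 + s) * (Λ.rcInt lam del (Δ ∪ Γ) ∅ fun d b => ¬ Λ.ConnSets d b D Γ) ≤
        s * h + Λ.rcInt lam del (Δ ∪ Γ) ∅ (fun _ _ => True) ∧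
      Λ.rcInt lam del (Δ ∪ Γ) (Λ.forcedJumps Γ τ)
          (Λ.Compat (Λ.forcedJumps Γ τ) (Δ ∪ Γ) (joinSpin Γ τ α)) * h ≤
        (1 + s) * (Λ.rcInt lam del (Δ ∪ Γ) ∅ fun d b =>
          ¬ Λ.ConnSets d b (spinPart Δ α 1) (spinPart Δ α (-1))) *
          Λ.rcInt lam del (Δ ∪ Γ) (Λ.forcedJumps Γ τ) (Λ.Compat (Λ.forcedJumps Γ τ) Γ τ) := by
  have hJ := finite_forcedJumps hΓ hτ
  have hW : Δ ∪ Γ ⊆ Λ.carrier := Set.union_subset hΔΛ hΓ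
  obtain ⟨N, R, hr, hRΓ, hΓR, hJN, -⟩ := exists_roots (J := Λ.forcedJumps Γ τ) hΓ hΔ hJ
  have hG : (Λ.rcInt lam del (Δ ∪ Γ) ∅ fun d b => ¬ Λ.ConnSets d b D Γ) =
      Λ.rcInt lam del (Δ ∪ Γ) ∅ fun d b => ¬ Λ.ConnSets d b D R :=
    rcInt_congr lam del hr.countable fun d b hg =>
      not_congr (connSets_dense_iff hRΓ hΓ hΓR hg.d_fin).symm
  have hdis : ∀ d b, Λ.Gen N d b → ¬ Λ.ConnSets d b D R → Disjoint Δ (Λ.reach d b Γ) :=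
    fun d b hg h => disjoint_reach_of_separates hg hr.s_mem hr.t_mem hD hsep
      fun h' => h ((connSets_dense_iff hRΓ hΓ hΓR hg.d_fin).2 h')
  rw [hG]
  refine rcInt_screening lam del hr hW hD hJ hJN sat_forcedJumps
    (fun d b hg => forcedJumps_subset_reach hr hΓR hJN hg)
    (MeasEv.not (MeasEv.connSets Λ (spinPart_subset.trans hΔΛ) (spinPart_subset.trans hΔΛ)))
    decr_not_connSets (fun d b hg h => localOff_not_connSets ?_) (measEv_compat hΓ hJ) decr_compat
    (explored_compat hRΓ hΓ hΓR) (measEv_compat hW hJ) decr_compat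
    (fun d b hg h => compat_join_iff hΔΓ (hdis d b hg h)) hA
  rw [reach_eq_of_dense hg.d_fin hΓR hRΓ hΓ]
  exact (hdis d b hg h).mono_left spinPart_subset

end Box


/-! ### Positive weight of compatibility. -/

namespace Box

variable {Λ : Box} (lam del : ℝ) {d b Γ Δ D R W J S : Set Pt} {N : Set ℝ} {τ α σ : Pt → ℤˣ}
  {p q z : Pt} {x : ℤ} {u v w : ℝ}

/-- The interval between `u` and `v` on the time-line `x` contains no point of `d`. -/
def FreeSeg (d : Set Pt) (x : ℤ) (u v : ℝ) : Prop := ∀ w ∈ Set.uIcc u v, (x, w) ∉ d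

lemma FreeSeg.trans (h : FreeSeg d x u v) (h' : FreeSeg d x v w) : FreeSeg d x u w :=
  fun y hy => (Set.uIcc_subset_uIcc_union_uIcc hy).elim (h y) (h' y)

lemma FreeSeg.symm (h : FreeSeg d x u v) : FreeSeg d x v u :=
  fun y hy => h y (by rwa [Set.uIcc_comm])

lemma freeSeg_self (h : (x, u) ∉ d) : FreeSeg d x u u := by
  intro w hw
  rw [Set.uIcc_self, Set.mem_singleton_iff] at hw
  rwa [hw]

/-- Without bridges a connection stays on one time-line and crosses the top/bottom identification at
most once after shortening. -/
lemma Conn.freeSeg (h : Λ.Conn d ∅ p q) : p.1 = q.1 ∧ (FreeSeg d p.1 p.2 q.2 ∨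
    (FreeSeg d p.1 p.2 Λ.s ∧ FreeSeg d p.1 Λ.t q.2) ∨
    (FreeSeg d p.1 p.2 Λ.t ∧ FreeSeg d p.1 Λ.s q.2)) := by
  refine Conn.induction (P := fun q => p.1 = q.1 ∧ (FreeSeg d p.1 p.2 q.2 ∨
    (FreeSeg d p.1 p.2 Λ.s ∧ FreeSeg d p.1 Λ.t q.2) ∨
    (FreeSeg d p.1 p.2 Λ.t ∧ FreeSeg d p.1 Λ.s q.2))) h
    ⟨rfl, Or.inl (freeSeg_self h.mem_left.2)⟩ ?_
  rintro x y - ⟨h1, h2⟩ ⟨-, -, hx, hy, hs | hs | hs⟩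
  · have hxy : FreeSeg d p.1 x.2 y.2 := fun u hu => by
      rw [h1]
      exact hs.2 u hu
    refine ⟨h1.trans hs.1, ?_⟩
    rcases h2 with h2 | h2 | h2
    · exact Or.inl (h2.trans hxy)
    · exact Or.inr (Or.inl ⟨h2.1, h2.2.trans hxy⟩)
    · exact Or.inr (Or.inr ⟨h2.1, h2.2.trans hxy⟩)
  · rcases hs.2 with h | h <;> exact h.2.elim
  · have hpy : p.1 = y.1 := h1.trans hs.1
    have hyy : FreeSeg d p.1 y.2 y.2 := freeSeg_self (by rw [hpy]; exact hy)
    refine ⟨hpy, ?_⟩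
    rcases hs.2 with ⟨h3, h4⟩ | ⟨h3, h4⟩
    · rw [h3] at h2
      rw [h4] at hyy ⊢
      rcases h2 with h2 | h2 | h2
      · exact Or.inr (Or.inl ⟨h2, hyy⟩)
      · exact Or.inr (Or.inl ⟨h2.1, hyy⟩)
      · exact Or.inl h2.1
    · rw [h3] at h2
      rw [h4] at hyy ⊢
      rcases h2 with h2 | h2 | h2
      · exact Or.inr (Or.inr ⟨h2, hyy⟩)
      · exact Or.inl h2.1
      · exact Or.inr (Or.inr ⟨h2.1, hyy⟩)

/-- On every time-line there is a death in each of `n` successive intervals of equal length. -/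
def OnGrid (Λ : Box) (n : ℕ) (d : Set Pt) : Prop :=
  ∀ x : ℤ, Λ.a ≤ x → x ≤ Λ.b → ∀ k < n, ∃ u ∈ Set.Ioo (Λ.s + k * ((Λ.t - Λ.s) / n))
    (Λ.s + (k + 1) * ((Λ.t - Λ.s) / n)), (x, u) ∈ d

lemma poissonProcess_onGrid_pos (hdel : 0 < del) (hst : Λ.s < Λ.t) {n : ℕ} (hn : 0 < n) :
    0 < poissonProcess (Λ.deathInt del) {c | Λ.OnGrid n c.points} := by
  classical
  set h := (Λ.t - Λ.s) / n with hh
  have hn' : (0 : ℝ) < n := Nat.cast_pos.2 hn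
  have hpos : 0 < h := div_pos (sub_pos.2 hst) hn'
  have hnh : n * h = Λ.t - Λ.s := by rw [hh]; field_simp
  let ι := Finset.Icc Λ.a Λ.b × Fin n
  let e := Fintype.equivFin ι
  let T : ι → Set Pt := fun i => {(i.1 : ℤ)} ×ˢ Set.Ioo (Λ.s + (i.2 : ℕ) * h)
    (Λ.s + ((i.2 : ℕ) + 1) * h)
  have hT : ∀ i, T i ⊆ Λ.carrier := by
    rintro i ⟨y, u⟩ ⟨hy, hu1, hu2⟩
    simp only [Set.mem_singleton_iff] at hy
    have hi := Finset.mem_Icc.1 i.1.2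
    have h1 : (0 : ℝ) ≤ (i.2 : ℕ) * h := by positivity
    have h2 : ((i.2 : ℕ) + 1 : ℝ) * h ≤ n * h :=
      mul_le_mul_of_nonneg_right (by exact_mod_cast i.2.2) hpos.le
    simp only at hu1 hu2
    exact ⟨hy ▸ hi.1, hy ▸ hi.2, by simp only; linarith, by simp only; linarith⟩
  have hpT : ∀ i, 0 < Λ.deathInt del (T i) := by
    intro i
    unfold deathInt
    rw [Measure.smul_apply, Measure.restrict_apply
      ((measurableSet_singleton _).prod measurableSet_Ioo),
      Set.inter_eq_self_of_subset_left (hT i), lineMeasure, Measure.prod_prod,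
      Measure.count_singleton, Real.volume_Ioo, smul_eq_mul, one_mul]
    refine ENNReal.mul_pos (ENNReal.ofReal_pos.2 hdel).ne' (ENNReal.ofReal_pos.2 ?_).ne'
    linarith
  refine (poissonProcess_image_pos (Λ.deathInt del) (fun i => T (e.symm i))
    fun i => hpT _).trans_le (measure_mono ?_)
  rintro _ ⟨c, hc, rfl⟩ y hy1 hy2 k hk
  have := hc (e ⟨⟨y, Finset.mem_Icc.2 ⟨hy1, hy2⟩⟩, ⟨k, hk⟩⟩) trivial
  simp only [Equiv.symm_apply_apply] at this
  refine ⟨_, this.2, _, Prod.ext this.1 rfl⟩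

lemma OnGrid.length_le {n : ℕ} (hd : Λ.OnGrid n d) (hst : Λ.s < Λ.t) (hn : 0 < n)
    (hx : Λ.a ≤ x) (hx' : x ≤ Λ.b) (hu : u ∈ Set.Icc Λ.s Λ.t) (hv : v ∈ Set.Icc Λ.s Λ.t)
    (hf : FreeSeg d x u v) : |u - v| ≤ 2 * ((Λ.t - Λ.s) / n) := by
  wlog huv : u ≤ v generalizing u v
  · rw [abs_sub_comm]
    exact this hv hu hf.symm (le_of_not_ge huv)
  set h := (Λ.t - Λ.s) / n with hh
  have hn' : (0 : ℝ) < n := Nat.cast_pos.2 hn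
  have hpos : 0 < h := div_pos (sub_pos.2 hst) hn'
  have hnh : n * h = Λ.t - Λ.s := by rw [hh]; field_simp
  by_contra hcon
  rw [abs_sub_comm, abs_of_nonneg (sub_nonneg.2 huv), not_le] at hcon
  -- The first grid interval starting at or above `u` ends before `u + 2h`, hence lies in any longer
  -- segment.
  set k := ⌈(u - Λ.s) / h⌉₊ with hk
  have h0 : 0 ≤ (u - Λ.s) / h := div_nonneg (sub_nonneg.2 hu.1) hpos.le
  have h1 : u - Λ.s ≤ k * h := (div_le_iff₀ hpos).1 (Nat.le_ceil _)
  have h2 : (k : ℝ) * h < u - Λ.s + h := by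
    have := Nat.ceil_lt_add_one h0
    rw [← hk] at this
    have h3 := mul_lt_mul_of_pos_right this hpos
    rwa [add_mul, div_mul_cancel₀ _ hpos.ne', one_mul] at h3
  have hkn : k < n := by
    have : (k : ℝ) * h < n * h := by linarith [hv.2]
    exact_mod_cast (mul_lt_mul_iff_of_pos_right hpos).1 this
  obtain ⟨w, hw, hwd⟩ := hd x hx hx' k hkn
  rw [← hh] at hw
  refine hf w ?_ hwd
  rw [Set.uIcc_of_le huv]
  exact ⟨by linarith [hw.1], by linarith [hw.2]⟩

lemma exists_far_of_notMem_closure (h : z ∉ closure S) :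
    ∃ ε > 0, ∀ p ∈ S, p.1 = z.1 → ε ≤ |p.2 - z.2| := by
  rw [Metric.mem_closure_iff] at h
  push Not at h
  obtain ⟨ε, hε, h⟩ := h
  refine ⟨ε, hε, fun p hp hpz => (h p hp).trans (le_of_eq ?_)⟩
  rw [Prod.dist_eq, hpz, dist_self, dist_comm, Real.dist_eq]
  exact max_eq_right (abs_nonneg _)

/-- A point off the forced jumps is at positive distance from one of the spin parts. -/
lemma exists_far_of_notMem_forcedJumps (h : z ∉ Λ.forcedJumps Γ τ) :
    ∃ ε > 0, ∃ i : ℤˣ, ∀ p ∈ spinPart Γ τ i, p.1 = z.1 →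
      ε ≤ |p.2 - z.2| ∧ (z.2 = Λ.s → ε ≤ |p.2 - Λ.t|) := by
  have : ∃ i : ℤˣ, z ∉ Λ.sat (closure (spinPart Γ τ i)) := by
    by_contra hcon
    push Not at hcon
    exact h ⟨hcon 1, hcon (-1)⟩
  obtain ⟨i, hi⟩ := this
  obtain ⟨ε, hε, h1⟩ := exists_far_of_notMem_closure fun h => hi (Or.inl h)
  by_cases hz : z.2 = Λ.s
  · obtain ⟨ε', hε', h2⟩ := exists_far_of_notMem_closure (z := (z.1, Λ.t))
      fun h => hi (Or.inr ⟨_, h, rfl, Or.inl ⟨hz, rfl⟩⟩)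
    exact ⟨min ε ε', lt_min hε hε', i, fun p hp hpz =>
      ⟨(min_le_left _ _).trans (h1 p hp hpz), fun _ => (min_le_right _ _).trans (h2 p hp hpz)⟩⟩
  · exact ⟨ε, hε, i, fun p hp hpz => ⟨h1 p hp hpz, fun h => absurd h hz⟩⟩

/-- A jump of an extension of `τ` that is not forced keeps a positive distance from one of the spin
parts. If all free segments are shorter than the least such distance and there are no bridges, then
no connection can join the two parts. -/
lemma compat_of_onGrid (hΓ : Γ ⊆ Λ.carrier) (hτ : τ ∈ Λ.spinConfigs Γ) (hst : Λ.s < Λ.t) :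
    ∃ n : ℕ, 0 < n ∧ ∀ d, Λ.OnGrid n d →
      Λ.Compat (Λ.forcedJumps Γ τ) Γ τ d ∅ := by
  classical
  obtain ⟨σ, hσ, hglue, J', hJ', hconn⟩ := hτ
  -- The bottoms of the time-lines are included to treat connections through the identification.
  set K : Set Pt := J' ∪ (fun x : ℤ => ((x, Λ.s) : Pt)) '' Set.Icc Λ.a Λ.b with hK
  have hKf : K.Finite := hJ'.union ((Set.finite_Icc _ _).image _)
  have hKne : K.Nonempty := ⟨(Λ.a, Λ.s), Or.inr ⟨Λ.a, ⟨le_rfl, Λ.hab⟩, rfl⟩⟩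
  have hf : ∀ z : Pt, ∃ ε : ℝ, 0 < ε ∧ (z ∉ Λ.forcedJumps Γ τ → ∃ i : ℤˣ,
      ∀ p ∈ spinPart Γ τ i, p.1 = z.1 → ε ≤ |p.2 - z.2| ∧ (z.2 = Λ.s → ε ≤ |p.2 - Λ.t|)) := by
    intro z
    by_cases hz : z ∈ Λ.forcedJumps Γ τ
    · exact ⟨1, one_pos, fun h => absurd hz h⟩
    · obtain ⟨ε, hε, h⟩ := exists_far_of_notMem_forcedJumps hz
      exact ⟨ε, hε, fun _ => h⟩
  choose f hfpos hf using hf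
  obtain ⟨z₀, -, hmin⟩ := Set.exists_min_image K f hKf hKne
  set ε := f z₀ with hε
  have hεpos : 0 < ε := hfpos z₀
  obtain ⟨n, hn⟩ := exists_nat_gt (2 * (Λ.t - Λ.s) / ε)
  have hn0 : 0 < n := by
    have : (0 : ℝ) < n := lt_of_le_of_lt (by have := sub_pos.2 hst; positivity) hn
    exact_mod_cast this
  have hn' : (0 : ℝ) < n := Nat.cast_pos.2 hn0
  have hshort : 2 * ((Λ.t - Λ.s) / n) < ε := by
    rw [div_lt_iff₀ hεpos] at hn
    rw [← mul_div_assoc, div_lt_iff₀ hn']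
    linarith
  refine ⟨n, hn0, fun d hd => ?_⟩
  rintro ⟨p, hp, q, hq, hc⟩
  have hpc := hΓ hp.1
  have hqc := hΓ hq.1
  have hpt : p.2 ∈ Set.Icc Λ.s Λ.t := hpc.2.2
  have hqt : q.2 ∈ Set.Icc Λ.s Λ.t := hqc.2.2
  have hs : Λ.s ∈ Set.Icc Λ.s Λ.t := ⟨le_rfl, hst.le⟩
  have ht : Λ.t ∈ Set.Icc Λ.s Λ.t := ⟨hst.le, le_rfl⟩
  have hlen : ∀ {u v : ℝ}, u ∈ Set.Icc Λ.s Λ.t → v ∈ Set.Icc Λ.s Λ.t →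
      FreeSeg (d ∪ Λ.forcedJumps Γ τ) p.1 u v → |u - v| < ε := fun hu hv h =>
    (hd.length_le hst hn0 hpc.1 hpc.2.1 hu hv fun w hw hwd => h w hw (Or.inl hwd)).trans_lt hshort
  have far : ∀ {w : ℝ}, (p.1, w) ∈ K → (p.1, w) ∉ Λ.forcedJumps Γ τ → ∃ i : ℤˣ,
      ∀ y ∈ spinPart Γ τ i, y.1 = p.1 → ε ≤ |y.2 - w| ∧ (w = Λ.s → ε ≤ |y.2 - Λ.t|) := by
    intro w hwK hwJ
    obtain ⟨i, hi⟩ := hf (p.1, w) hwJ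
    exact ⟨i, fun y hy hyp => ⟨(hmin _ hwK).trans (hi y hy hyp).1,
      fun h => (hmin _ hwK).trans ((hi y hy hyp).2 h)⟩⟩
  have hsK : (p.1, Λ.s) ∈ K := Or.inr ⟨p.1, ⟨hpc.1, hpc.2.1⟩, rfl⟩
  obtain ⟨hpq, h⟩ := hc.freeSeg
  rcases h with h | ⟨h1, h2⟩ | ⟨h1, h2⟩
  · have hne : σ p ≠ σ q := by
      rw [← hσ hp.1, ← hσ hq.1, hp.2, hq.2]
      decide
    -- The extension changes its spin between `p` and `q`, so it jumps at some `w` in between. The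
    -- segment avoids forced jumps, so `w` is far from one of the spin parts, that is, from `p` or
    -- from `q`.
    have : ∃ w ∈ Set.uIcc p.2 q.2, (p.1, w) ∈ J' := by
      by_contra hcon
      push Not at hcon
      exact hne (hconn p q (conn_vertical hpc hqc hpq hcon))
    obtain ⟨w, hw, hwJ⟩ := this
    obtain ⟨i, hi⟩ := far (Or.inl hwJ) fun h' => h w hw (Or.inr h')
    have hl := hlen hpt hqt h
    rcases Int.units_eq_one_or i with rfl | rfl
    · have h3 := (hi p hp rfl).1
      have h4 := Set.abs_sub_left_of_mem_uIcc hw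
      rw [abs_sub_comm] at h3 hl
      linarith
    · have h3 := (hi q hq hpq.symm).1
      have h4 := Set.abs_sub_right_of_mem_uIcc hw
      rw [abs_sub_comm] at hl
      linarith
  · obtain ⟨i, hi⟩ := far hsK fun h' => h1 _ Set.right_mem_uIcc (Or.inr h')
    rcases Int.units_eq_one_or i with rfl | rfl
    · exact absurd (hlen hpt hs h1) (not_lt.2 (hi p hp rfl).1)
    · exact absurd (hlen hqt ht h2.symm) (not_lt.2 ((hi q hq hpq.symm).2 rfl))
  · obtain ⟨i, hi⟩ := far hsK fun h' => h2 _ Set.left_mem_uIcc (Or.inr h')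
    rcases Int.units_eq_one_or i with rfl | rfl
    · exact absurd (hlen hpt ht h1) (not_lt.2 ((hi p hp rfl).2 rfl))
    · exact absurd (hlen hqt hs h2.symm) (not_lt.2 (hi q hq hpq.symm).1)

lemma compat_of_eq (hΓ : Γ ⊆ Λ.carrier) (hst : Λ.s = Λ.t) : Λ.Compat J Γ τ ∅ ∅ := by
  rintro ⟨p, hp, q, hq, hc⟩
  have h1 := hc.freeSeg.1
  have hpc := hΓ hp.1
  have hqc := hΓ hq.1
  have : p = q := Prod.ext h1 (le_antisymm (hpc.2.2.2.trans (hst ▸ hqc.2.2.1))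
    (hqc.2.2.2.trans (hst ▸ hpc.2.2.1)))
  subst this
  exact absurd (hp.2.symm.trans hq.2) (by decide)

/-- Compatibility with a boundary condition has positive weight. -/
theorem rcInt_compat_pos (hdel : 0 < del) (hW : W ⊆ Λ.carrier) (hΓ : Γ ⊆ Λ.carrier)
    (hτ : τ ∈ Λ.spinConfigs Γ) :
    0 < Λ.rcInt lam del W (Λ.forcedJumps Γ τ) (Λ.Compat (Λ.forcedJumps Γ τ) Γ τ) := by
  have hJ := finite_forcedJumps hΓ hτ
  rcases Λ.hst.lt_or_eq with hst | hst
  · obtain ⟨n, hn, h⟩ := compat_of_onGrid hΓ hτ hst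
    refine rcInt_pos_of_pos lam del hW hJ (measEv_compat hΓ hJ)
      (poissonProcess_onGrid_pos del hdel hst hn) (poissonProcess_empty_pos _)
      fun c hc c' hc' => ?_
    rw [Set.mem_ofPred_eq] at hc'
    rw [hc']
    exact h _ hc
  · exact rcInt_pos_of_empty lam del hW hJ (measEv_compat hΓ hJ) (compat_of_eq hΓ hst)

lemma mem_spinConfigs_of_finite (hΔ : Δ.Finite)
    (h : ∀ p ∈ Δ, ∀ q ∈ Δ, Λ.Glued p q → α p = α q) : α ∈ Λ.spinConfigs Δ := by
  classical
  have huniq : ∀ {p q r : Pt}, Λ.Glued p q → Λ.Glued p r → q = r := by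
    intro p q r h2 h1
    refine Prod.ext (h2.1.symm.trans h1.1) ?_
    rcases h1.2 with ⟨h3, h4⟩ | ⟨h3, h4⟩ <;> rcases h2.2 with ⟨h5, h6⟩ | ⟨h5, h6⟩ <;> linarith
  let σ : Pt → ℤˣ := fun p => if h : ∃ q ∈ Δ, q = p ∨ Λ.Glued p q then α h.choose else 1
  have hσ : ∀ p, ∀ q ∈ Δ, (q = p ∨ Λ.Glued p q) → σ p = α q := by
    intro p q hq hpq
    have hex : ∃ q ∈ Δ, q = p ∨ Λ.Glued p q := ⟨q, hq, hpq⟩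
    have e : σ p = α hex.choose := dif_pos hex
    obtain ⟨hr, hpr⟩ := hex.choose_spec
    rw [e]
    generalize hex.choose = r at hr hpr
    rcases hpq with rfl | hpq <;> rcases hpr with rfl | hpr
    · rfl
    · exact (h _ hq _ hr hpr).symm
    · exact h _ hr _ hq hpq
    · rw [huniq hpq hpr]
  have hσ' : ∀ p, (¬ ∃ q ∈ Δ, q = p ∨ Λ.Glued p q) → σ p = 1 := fun p hp => dif_neg hp
  -- The extension equals `1` off the finite set of representatives of `Δ`, which serves as its jump
  -- set.
  refine ⟨σ, fun p hp => (hσ p p hp (Or.inl rfl)).symm, fun p p' hpp => ?_, Λ.sat Δ,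
    finite_sat hΔ, fun p q hc => ?_⟩
  · have tr : ∀ {p p'}, Λ.Glued p p' → ∀ q ∈ Δ, (q = p ∨ Λ.Glued p q) →
        (q = p' ∨ Λ.Glued p' q) := by
      rintro p p' hpp q hq (rfl | h')
      · exact Or.inr hpp.symm
      · exact Or.inl (huniq h' hpp)
    by_cases hex : ∃ q ∈ Δ, q = p ∨ Λ.Glued p q
    · obtain ⟨q, hq, hpq⟩ := hex
      rw [hσ p q hq hpq, hσ p' q hq (tr hpp q hq hpq)]
    · rw [hσ' p hex, hσ' p']
      rintro ⟨q, hq, hpq⟩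
      exact hex ⟨q, hq, tr hpp.symm q hq hpq⟩
  · have off : ∀ {p}, p ∉ Λ.sat Δ → σ p = 1 := by
      intro p hp
      refine hσ' p ?_
      rintro ⟨q, hq, rfl | h'⟩
      · exact hp (Or.inl hq)
      · exact hp (Or.inr ⟨q, hq, h'⟩)
    rw [off hc.mem_left.2, off hc.mem_right.2]

lemma forcedJumps_eq_empty (hΔ : Δ.Finite) (hα : α ∈ Λ.spinConfigs Δ) :
    Λ.forcedJumps Δ α = ∅ := by
  obtain ⟨σ, hσ, hglue, -⟩ := hα
  refine Set.eq_empty_of_forall_notMem fun z hz => ?_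
  have key : ∀ i, z ∈ Λ.sat (closure (spinPart Δ α i)) → σ z = i := by
    intro i hi
    rw [(hΔ.subset spinPart_subset).isClosed.closure_eq] at hi
    rcases hi with h | ⟨q, hq, hg⟩
    · rw [← hσ h.1, h.2]
    · rw [hglue z q hg, ← hσ hq.1, hq.2]
  exact absurd ((key 1 hz.1).symm.trans (key (-1) hz.2)) (by decide)

lemma rcInt_free_pos (hdel : 0 < del) (hW : W ⊆ Λ.carrier) (hΔΛ : Δ ⊆ Λ.carrier) (hΔ : Δ.Finite)
    (hα : α ∈ Λ.spinConfigs Δ) : 0 < Λ.rcInt lam del W ∅ fun d b =>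
      ¬ Λ.ConnSets d b (spinPart Δ α 1) (spinPart Δ α (-1)) := by
  have h := rcInt_compat_pos lam del hdel hW hΔΛ hα
  rw [forcedJumps_eq_empty hΔ hα] at h
  unfold Compat at h
  simpa only [Set.union_empty] using h

end Box


/-! ### Comparison of boundary conditions. -/

namespace Box

variable {Λ : Box} (lam del : ℝ) {d b Γ Δ D R W J S : Set Pt} {N : Set ℝ} {τ τ' α σ : Pt → ℤˣ}

lemma IsLinear.subset_carrier (hD : Λ.IsLinear D) : D ⊆ Λ.carrier := by
  obtain ⟨I, hI, rfl⟩ := hD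
  rintro p ⟨i, hi, h1, h2⟩
  obtain ⟨-, h3, h4⟩ := hI i hi
  exact ⟨h1 ▸ h3.1, h1 ▸ h3.2.1, h3.2.2.1.trans h2.1, h2.2.trans h4.2.2.2⟩

lemma rcInt_eq_zero (hN : N.Countable) {E : Set Pt → Set Pt → Prop}
    (h : ∀ d b, Λ.Gen N d b → ¬ E d b) : Λ.rcInt lam del W J E = 0 := by
  unfold rcInt
  refine (lintegral_congr_ae ?_).trans lintegral_zero
  filter_upwards [Λ.ae_gen lam del hN] with ω hω
  rw [wt_of_not (h _ _ hω.1), Nat.cast_zero]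

/-- The choice `s = t` gives `h ≥ (1 - t - t²) Z`, because `(1 + t)(1 - t²) - 1 = t (1 - t - t²)`.
For `t = 0` the bound is obtained in the limit `s → 0`. -/
lemma real_bounds_of_screening {a β g Z i : ℝ≥0∞} {t : ℝ} (ha : a ≠ ∞) (hβ : β ≠ ∞)
    (hZ : Z ≠ ∞) (hi : i ≠ ∞) (ht : 0 ≤ t)
    (hgt : g.toReal = (1 - t ^ 2) * Z.toReal) (hlow : a * (β * g) ≤ Z * (Z * i))
    (hup : ∀ s : ℝ≥0∞, s ≠ ∞ → ∃ h : ℝ≥0∞, (1 + s) * g ≤ s * h + Z ∧ i * h ≤ (1 + s) * a * β)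
    (hZ0 : 0 < Z.toReal) :
    (1 - t ^ 2) * (a.toReal * β.toReal) ≤ Z.toReal * i.toReal ∧
      (1 - t - t ^ 2) * (Z.toReal * i.toReal) ≤ (1 + t) * (a.toReal * β.toReal) := by
  have ha0 : 0 ≤ a.toReal := ENNReal.toReal_nonneg
  have hβ0 : 0 ≤ β.toReal := ENNReal.toReal_nonneg
  have hi0 : 0 ≤ i.toReal := ENNReal.toReal_nonneg
  have haβ : 0 ≤ a.toReal * β.toReal := mul_nonneg ha0 hβ0
  constructor
  · have h := ENNReal.toReal_mono (by finiteness) hlow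
    simp only [ENNReal.toReal_mul, hgt] at h
    have h' : Z.toReal * ((1 - t ^ 2) * (a.toReal * β.toReal)) ≤
        Z.toReal * (Z.toReal * i.toReal) := by linarith
    exact le_of_mul_le_mul_left h' hZ0
  · have key : ∀ s : ℝ, 0 < s → ((1 + s) * (1 - t ^ 2) - 1) * (Z.toReal * i.toReal) ≤
        s * ((1 + s) * (a.toReal * β.toReal)) := by
      intro s hs
      obtain ⟨h, h1, h2⟩ := hup (ENNReal.ofReal s) ENNReal.ofReal_ne_top
      rcases eq_or_ne i 0 with rfl | hi'
      · simp only [ENNReal.toReal_zero, mul_zero]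
        positivity
      have hh : h ≠ ∞ := by
        rintro rfl
        rw [ENNReal.mul_top hi', top_le_iff] at h2
        exact absurd h2 (by finiteness)
      have h1' := ENNReal.toReal_mono (by finiteness) h1
      have h2' := ENNReal.toReal_mono (by finiteness) h2
      rw [ENNReal.toReal_add (by finiteness) hZ] at h1'
      simp only [ENNReal.toReal_mul, ENNReal.toReal_add ENNReal.one_ne_top ENNReal.ofReal_ne_top,
        ENNReal.toReal_one, ENNReal.toReal_ofReal hs.le, hgt] at h1' h2'
      calc ((1 + s) * (1 - t ^ 2) - 1) * (Z.toReal * i.toReal) =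
          ((1 + s) * ((1 - t ^ 2) * Z.toReal) - Z.toReal) * i.toReal := by ring
        _ ≤ (s * h.toReal) * i.toReal := mul_le_mul_of_nonneg_right (by linarith) hi0
        _ = s * (i.toReal * h.toReal) := by ring
        _ ≤ s * ((1 + s) * (a.toReal * β.toReal)) :=
          mul_le_mul_of_nonneg_left (by linarith) hs.le
    rcases ht.lt_or_eq with ht | rfl
    · have := key t ht
      have h' : t * ((1 - t - t ^ 2) * (Z.toReal * i.toReal)) ≤
          t * ((1 + t) * (a.toReal * β.toReal)) := by
        calc _ = ((1 + t) * (1 - t ^ 2) - 1) * (Z.toReal * i.toReal) := by ring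
          _ ≤ _ := this
      exact le_of_mul_le_mul_left h' ht
    · have key' : ∀ s : ℝ, 0 < s → Z.toReal * i.toReal ≤
          a.toReal * β.toReal + s * (a.toReal * β.toReal) := by
        intro s hs
        have := key s hs
        have h' : s * (Z.toReal * i.toReal) ≤ s * ((1 + s) * (a.toReal * β.toReal)) := by
          calc _ = ((1 + s) * (1 - 0 ^ 2) - 1) * (Z.toReal * i.toReal) := by ring
            _ ≤ _ := this
        linarith [le_of_mul_le_mul_left h' hs]
      have : Z.toReal * i.toReal ≤ a.toReal * β.toReal := by
        refine le_of_forall_pos_le_add fun ε hε => ?_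
        have h1 := key' (ε / (a.toReal * β.toReal + 1)) (by positivity)
        refine h1.trans (add_le_add le_rfl ?_)
        rw [div_mul_eq_mul_div, div_le_iff₀ (by positivity)]
        nlinarith
      linarith

/-- The bounds for the weights of the spins on `Δ` under the boundary condition `τ`. -/
lemma compat_bounds (hdel : 0 < del) (hΓ : Γ ⊆ Λ.carrier) (hΔΛ : Δ ⊆ Λ.carrier) (hΔ : Δ.Finite)
    (hΔΓ : Disjoint Δ Γ) (hD : D ⊆ Λ.carrier) (hsep : Λ.Separates D Δ Γ)
    (hτ : τ ∈ Λ.spinConfigs Γ) {t : ℝ} (ht : 0 ≤ t)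
    (hΔJ : Disjoint Δ (Λ.forcedJumps Γ τ))
    (hgt : (Λ.rcInt lam del (Δ ∪ Γ) ∅ fun d b => ¬ Λ.ConnSets d b D Γ).toReal =
      (1 - t ^ 2) * (Λ.rcInt lam del (Δ ∪ Γ) ∅ fun _ _ => True).toReal) (α : Pt → ℤˣ) :
    (1 - t ^ 2) * ((Λ.rcInt lam del (Δ ∪ Γ) ∅ fun d b =>
        ¬ Λ.ConnSets d b (spinPart Δ α 1) (spinPart Δ α (-1))).toReal *
      (Λ.rcInt lam del (Δ ∪ Γ) (Λ.forcedJumps Γ τ)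
        (Λ.Compat (Λ.forcedJumps Γ τ) Γ τ)).toReal) ≤
      (Λ.rcInt lam del (Δ ∪ Γ) ∅ fun _ _ => True).toReal *
        (Λ.rcInt lam del (Δ ∪ Γ) (Λ.forcedJumps Γ τ)
          (Λ.Compat (Λ.forcedJumps Γ τ) (Δ ∪ Γ) (joinSpin Γ τ α))).toReal ∧
    (1 - t - t ^ 2) * ((Λ.rcInt lam del (Δ ∪ Γ) ∅ fun _ _ => True).toReal *
        (Λ.rcInt lam del (Δ ∪ Γ) (Λ.forcedJumps Γ τ)
          (Λ.Compat (Λ.forcedJumps Γ τ) (Δ ∪ Γ) (joinSpin Γ τ α))).toReal) ≤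
      (1 + t) * ((Λ.rcInt lam del (Δ ∪ Γ) ∅ fun d b =>
        ¬ Λ.ConnSets d b (spinPart Δ α 1) (spinPart Δ α (-1))).toReal *
      (Λ.rcInt lam del (Δ ∪ Γ) (Λ.forcedJumps Γ τ)
        (Λ.Compat (Λ.forcedJumps Γ τ) Γ τ)).toReal) := by
  have hJ := finite_forcedJumps hΓ hτ
  have hW : Δ ∪ Γ ⊆ Λ.carrier := Set.union_subset hΔΛ hΓ
  by_cases hα : ∀ p ∈ Δ, ∀ q ∈ Δ, Λ.Glued p q → α p = α q
  · have hpos := rcInt_free_pos lam del hdel hW hΔΛ hΔ (mem_spinConfigs_of_finite hΔ hα)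
    have h := compat_screening lam del hΓ hΔΛ hΔ hΔΓ hD hsep hτ hpos.ne'
    have hZ : 0 < Λ.rcInt lam del (Δ ∪ Γ) ∅ fun _ _ => True :=
      rcInt_pos_of_empty lam del hW Set.finite_empty MeasEv.true trivial
    have hf : ∀ {E}, Λ.rcInt lam del (Δ ∪ Γ) ∅ E ≠ ∞ :=
      (rcInt_lt_top lam del Set.finite_empty).ne
    have hf' : ∀ {E}, Λ.rcInt lam del (Δ ∪ Γ) (Λ.forcedJumps Γ τ) E ≠ ∞ :=
      (rcInt_lt_top lam del hJ).ne
    exact real_bounds_of_screening hf hf' hf hf' ht hgt h.1 h.2 (ENNReal.toReal_pos hZ.ne' hf)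
  -- If `α` differs at two identified points of `Δ`, it is compatible with almost no configuration
  -- and both integrals vanish. Such patterns do occur in the sum over all spins on `Δ`.
  · push Not at hα
    obtain ⟨p, hp, q, hq, hg, hne⟩ := hα
    obtain ⟨N, R, hr, -⟩ := exists_roots (J := Λ.forcedJumps Γ τ) hΓ hΔ hJ
    have hconn : ∀ J : Set Pt, Disjoint Δ J → ∀ d b, Λ.Gen N d b →
        Λ.ConnSets (d ∪ J) b (spinPart Δ α 1) (spinPart Δ α (-1)) := by
      intro J hJ d b hgen
      have hpd : p ∉ d ∪ J := fun h => h.elim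
        (hgen.glued_notMem hr.s_mem hr.t_mem hg.symm) (Set.disjoint_left.1 hJ hp)
      have hqd : q ∉ d ∪ J := fun h => h.elim
        (hgen.glued_notMem hr.s_mem hr.t_mem hg) (Set.disjoint_left.1 hJ hq)
      have hc : Λ.Conn (d ∪ J) b p q :=
        .single ⟨hΔΛ hp, hΔΛ hq, hpd, hqd, Or.inr (Or.inr hg)⟩
      rcases Int.units_eq_one_or (α p) with h1 | h1
      · exact ⟨p, ⟨hp, h1⟩, q, ⟨hq, units_ne_one fun h2 => hne (h1.trans h2.symm)⟩, hc⟩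
      · rcases Int.units_eq_one_or (α q) with h2 | h2
        · exact ⟨q, ⟨hq, h2⟩, p, ⟨hp, h1⟩, hc.symm⟩
        · exact absurd (h1.trans h2.symm) hne
    have e1 : (Λ.rcInt lam del (Δ ∪ Γ) ∅ fun d b =>
        ¬ Λ.ConnSets d b (spinPart Δ α 1) (spinPart Δ α (-1))) = 0 := by
      refine rcInt_eq_zero lam del hr.countable fun d b hgen h => h ?_
      simpa only [Set.union_empty] using hconn ∅ (Set.disjoint_empty _) d b hgen
    have e2 : Λ.rcInt lam del (Δ ∪ Γ) (Λ.forcedJumps Γ τ)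
        (Λ.Compat (Λ.forcedJumps Γ τ) (Δ ∪ Γ) (joinSpin Γ τ α)) = 0 := by
      refine rcInt_eq_zero lam del hr.countable fun d b hgen h => h ?_
      refine (hconn _ hΔJ d b hgen).mono_sets ?_ ?_ <;>
        exact fun p hp => ⟨Or.inl hp.1,
          (joinSpin_of_notMem (Set.disjoint_left.1 hΔΓ hp.1)).trans hp.2⟩
    rw [e1, e2]
    simp

lemma spinProb_eq (hΓ : Γ ⊆ Λ.carrier) (hΔΓ : Disjoint Δ Γ)
    (hJ : (Λ.forcedJumps Γ τ).Finite) :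
    Λ.spinProb lam del Γ τ Δ α = (Λ.rcInt lam del (Δ ∪ Γ) (Λ.forcedJumps Γ τ)
      (Λ.Compat (Λ.forcedJumps Γ τ) (Δ ∪ Γ) (joinSpin Γ τ α))).toReal /
      (Λ.rcInt lam del Γ (Λ.forcedJumps Γ τ) (Λ.Compat (Λ.forcedJumps Γ τ) Γ τ)).toReal := by
  rw [spinProb, lintegral_spinProbGiven lam del hΓ hΔΓ hJ, ENNReal.toReal_mul,
    ENNReal.toReal_inv, mul_comm, div_eq_mul_inv]

/-- The bounds for one pattern are divided by those for the sum over patterns. `β` and `Z` cancel,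
and the constant is `(1 - t²)(1 - t - t²) / (1 + t)`. -/
lemma quotient_bounds {t Z β a i X Y : ℝ} (ht : 0 ≤ t) (ht' : 0 < 1 - t - t ^ 2) (hZ : 0 < Z)
    (hβ : 0 < β) (hX : 0 < X) (hY : 0 < Y) (ha : 0 ≤ a) (hi : 0 ≤ i)
    (h₁ : (1 - t ^ 2) * (a * β) ≤ Z * i) (h₂ : (1 - t - t ^ 2) * (Z * i) ≤ (1 + t) * (a * β))
    (h₃ : (1 - t ^ 2) * (X * β) ≤ Z * Y) (h₄ : (1 - t - t ^ 2) * (Z * Y) ≤ (1 + t) * (X * β)) :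
    (1 - t) * (1 - t - t ^ 2) * (a / X) ≤ i / Y ∧
      (1 - t) * (1 - t - t ^ 2) * (i / Y) ≤ a / X := by
  have hl2 : 0 < 1 - t ^ 2 := by nlinarith
  have hcancel : ∀ {x y : ℝ}, (1 + t) * (Z * β) * x ≤ (1 + t) * (Z * β) * y → x ≤ y :=
    fun h => le_of_mul_le_mul_left h (by positivity)
  constructor
  · rw [le_div_iff₀ hY, ← mul_div_assoc, div_mul_eq_mul_div, div_le_iff₀ hX]
    refine hcancel ?_
    calc (1 + t) * (Z * β) * ((1 - t) * (1 - t - t ^ 2) * a * Y) =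
        ((1 - t ^ 2) * (a * β)) * ((1 - t - t ^ 2) * (Z * Y)) := by ring
      _ ≤ (Z * i) * ((1 + t) * (X * β)) :=
        mul_le_mul h₁ h₄ (by positivity) (mul_nonneg hZ.le hi)
      _ = _ := by ring
  · rw [le_div_iff₀ hX, ← mul_div_assoc, div_mul_eq_mul_div, div_le_iff₀ hY]
    refine hcancel ?_
    calc (1 + t) * (Z * β) * ((1 - t) * (1 - t - t ^ 2) * i * X) =
        ((1 - t - t ^ 2) * (Z * i)) * ((1 - t ^ 2) * (X * β)) := by ring
      _ ≤ ((1 + t) * (a * β)) * (Z * Y) := mul_le_mul h₂ h₃ (by positivity) (by positivity)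
      _ = _ := by ring

/-- Up to a factor, the spin probabilities do not depend on the boundary condition. -/
theorem spinProb_bounds (hdel : 0 < del) (hΓ : Γ ⊆ Λ.carrier) (hΔΛ : Δ ⊆ Λ.carrier)
    (hΔ : Δ.Finite) (hΔΓ : Disjoint Δ Γ) (hD : D ⊆ Λ.carrier) (hsep : Λ.Separates D Δ Γ)
    {t : ℝ} (ht : 0 ≤ t) (ht' : 0 < 1 - t - t ^ 2)
    (hgt : (Λ.rcInt lam del (Δ ∪ Γ) ∅ fun d b => ¬ Λ.ConnSets d b D Γ).toReal =
      (1 - t ^ 2) * (Λ.rcInt lam del (Δ ∪ Γ) ∅ fun _ _ => True).toReal)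
    (hα : α ∈ Λ.spinConfigs Δ) :
    ∃ P > 0, ∀ τ ∈ Λ.spinConfigs Γ,
      (1 - t) * (1 - t - t ^ 2) * P ≤ Λ.spinProb lam del Γ τ Δ α ∧
      (1 - t) * (1 - t - t ^ 2) * Λ.spinProb lam del Γ τ Δ α ≤ P := by
  classical
  have hW : Δ ∪ Γ ⊆ Λ.carrier := Set.union_subset hΔΛ hΓ
  have := hΔ.fintype
  set Z := (Λ.rcInt lam del (Δ ∪ Γ) ∅ fun _ _ => True).toReal with hZdef
  set A : (Pt → ℤˣ) → ℝ := fun α => (Λ.rcInt lam del (Δ ∪ Γ) ∅ fun d b =>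
        ¬ Λ.ConnSets d b (spinPart Δ α 1) (spinPart Δ α (-1))).toReal with hA
  set X := ∑ a : Δ → ℤˣ, A (extendSpin Δ a) with hX
  have hZ : 0 < Z := ENNReal.toReal_pos
    (rcInt_pos_of_empty lam del hW Set.finite_empty MeasEv.true trivial).ne'
    (rcInt_lt_top lam del Set.finite_empty).ne
  have hAα : 0 < A α := ENNReal.toReal_pos
    (rcInt_free_pos lam del hdel hW hΔΛ hΔ hα).ne' (rcInt_lt_top lam del Set.finite_empty).ne
  have hAX : A α ≤ X := by
    have : A α = A (extendSpin Δ fun p => α p) := by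
      have h : ∀ i, spinPart Δ α i = spinPart Δ (extendSpin Δ fun p => α p) i := by
        intro i
        ext p
        refine and_congr_right fun hp => ?_
        rw [extendSpin, dif_pos hp]
      simp only [hA, h 1, h (-1)]
    rw [this]
    exact Finset.single_le_sum (f := fun a : Δ → ℤˣ => A (extendSpin Δ a))
      (fun a _ => ENNReal.toReal_nonneg) (Finset.mem_univ _)
  have hXpos : 0 < X := hAα.trans_le hAX
  have hl : 0 < 1 - t := by nlinarith
  have hl2 : 0 < 1 - t ^ 2 := by nlinarith
  -- The reference value involves `Γ` only through the wiring and is the same for all `τ`.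
  refine ⟨A α / X, div_pos hAα hXpos, fun τ hτ => ?_⟩
  have hJ := finite_forcedJumps hΓ hτ
  have hg0 : (Λ.rcInt lam del (Δ ∪ Γ) ∅ fun d b => ¬ Λ.ConnSets d b D Γ) ≠ 0 := by
    intro h0
    rw [h0, ENNReal.toReal_zero] at hgt
    exact (mul_pos hl2 hZ).ne hgt
  have hΔJ := disjoint_forcedJumps lam del hΓ hΔ hD hsep hτ hg0
  have hb := compat_bounds lam del hdel hΓ hΔΛ hΔ hΔΓ hD hsep hτ ht hΔJ hgt
  obtain ⟨N, R, hr, -, -, -, hΔN⟩ := exists_roots (J := Λ.forcedJumps Γ τ) hΓ hΔ hJ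
  have hY := rcInt_compat_eq_sum (τ := τ) lam del hr.countable hΓ hΔΛ hΔΓ hJ hΔN hΔJ
  rw [spinProb_eq lam del hΓ hΔΓ hJ, hY, ENNReal.toReal_sum fun a _ => (rcInt_lt_top lam del hJ).ne]
  have hβ : 0 < (Λ.rcInt lam del (Δ ∪ Γ) (Λ.forcedJumps Γ τ)
      (Λ.Compat (Λ.forcedJumps Γ τ) Γ τ)).toReal := ENNReal.toReal_pos
    (rcInt_compat_pos lam del hdel hW hΓ hτ).ne' (rcInt_lt_top lam del hJ).ne
  set β := (Λ.rcInt lam del (Δ ∪ Γ) (Λ.forcedJumps Γ τ)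
      (Λ.Compat (Λ.forcedJumps Γ τ) Γ τ)).toReal with hβdef
  set i : (Pt → ℤˣ) → ℝ := fun α => (Λ.rcInt lam del (Δ ∪ Γ) (Λ.forcedJumps Γ τ)
      (Λ.Compat (Λ.forcedJumps Γ τ) (Δ ∪ Γ) (joinSpin Γ τ α))).toReal with hi
  change _ * _ ≤ i α / ∑ a : Δ → ℤˣ, i (extendSpin Δ a) ∧
    _ * (i α / ∑ a : Δ → ℤˣ, i (extendSpin Δ a)) ≤ _
  have hb' : ∀ α, (1 - t ^ 2) * (A α * β) ≤ Z * i α ∧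
    (1 - t - t ^ 2) * (Z * i α) ≤ (1 + t) * (A α * β) := hb
  set Y := ∑ a : Δ → ℤˣ, i (extendSpin Δ a) with hYdef
  have hY1 : (1 - t ^ 2) * (X * β) ≤ Z * Y := by
    rw [hX, hYdef, Finset.sum_mul, Finset.mul_sum, Finset.mul_sum]
    exact Finset.sum_le_sum fun a _ => (hb' _).1
  have hY2 : (1 - t - t ^ 2) * (Z * Y) ≤ (1 + t) * (X * β) := by
    rw [hX, hYdef, Finset.sum_mul, Finset.mul_sum, Finset.mul_sum, Finset.mul_sum]
    exact Finset.sum_le_sum fun a _ => (hb' _).2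
  have hYpos : 0 < Y := by
    have : 0 < Z * Y := lt_of_lt_of_le (mul_pos hl2 (mul_pos hXpos hβ)) hY1
    exact (mul_pos_iff_of_pos_left hZ).1 this
  exact quotient_bounds ht ht' hZ hβ hXpos hYpos hAα.le ENNReal.toReal_nonneg (hb' α).1 (hb' α).2
    hY1 hY2

/-- The wired connection probability in terms of random-cluster integrals. -/
lemma toReal_rcInt_not_connSets (hW : W ⊆ Λ.carrier) (hD : D ⊆ Λ.carrier) (hΓ : Γ ⊆ Λ.carrier) :
    (Λ.rcInt lam del W ∅ fun d b => ¬ Λ.ConnSets d b D Γ).toReal =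
      (1 - Λ.wiredConnProb lam del W D Γ) * (Λ.rcInt lam del W ∅ fun _ _ => True).toReal := by
  have mC : MeasEv fun d b => Λ.ConnSets d b D Γ := MeasEv.connSets Λ hD hΓ
  have hZ : 0 < Λ.rcInt lam del W ∅ fun _ _ => True :=
    rcInt_pos_of_empty lam del hW Set.finite_empty MeasEv.true trivial
  have hf : ∀ {E}, Λ.rcInt lam del W ∅ E ≠ ∞ := (rcInt_lt_top lam del Set.finite_empty).ne
  have hZ' : 0 < (Λ.rcInt lam del W ∅ fun _ _ => True).toReal := ENNReal.toReal_pos hZ.ne' hf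
  have h := rcInt_split (Λ := Λ) lam del hW Set.finite_empty MeasEv.true mC
  simp only [true_and] at h
  have h' := congrArg ENNReal.toReal h
  rw [ENNReal.toReal_add hf hf] at h'
  rw [wiredConnProb, wired_apply lam del mC, ENNReal.toReal_mul, ENNReal.toReal_inv, sub_mul,
    mul_comm _⁻¹, mul_assoc, inv_mul_cancel₀ hZ'.ne']
  linarith

end Box

/-! ### The numerical estimate and the conclusion. -/

/-- The error bound increases with `t₁`, so the case `t₁ = 0` suffices; there the claim is a
polynomial inequality in `t`. -/
lemma one_le_mul_of_mixing {t₁ t : ℝ} (h₁ : 0 ≤ t₁) (ht : 0 ≤ t) (hden : t₁ + 2 * t < 1)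
    (hle : 2 * (t₁ + 2 * t + (t₁ + t) / (1 - t₁ - 2 * t)) ≤ 1) :
    t ≤ 3 / 20 ∧ 1 ≤ (1 + 2 * (t₁ + 2 * t + (t₁ + t) / (1 - t₁ - 2 * t))) *
      ((1 - t) * (1 - t - t ^ 2)) ^ 2 := by
  have hd : 0 < 1 - t₁ - 2 * t := by linarith
  have hd' : 0 < 1 - 2 * t := by linarith
  have h1 : t / (1 - 2 * t) ≤ (t₁ + t) / (1 - t₁ - 2 * t) :=
    div_le_div₀ (by linarith) (by linarith) hd (by linarith)
  have hε : 4 * t + 2 * (t / (1 - 2 * t)) ≤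
      2 * (t₁ + 2 * t + (t₁ + t) / (1 - t₁ - 2 * t)) := by linarith
  -- At `t = 3/20` the lower bound `4t + 2t/(1 - 2t)` for the error is `3/5 + 3/7 > 1`.
  have ht' : t ≤ 3 / 20 := by
    by_contra hcon
    rw [not_le] at hcon
    have h2 : 3 / 14 ≤ t / (1 - 2 * t) := by
      rw [le_div_iff₀ hd']
      linarith
    linarith
  refine ⟨ht', ?_⟩
  have h3 : 1 ≤ (1 + (4 * t + 2 * (t / (1 - 2 * t)))) * ((1 - t) * (1 - t - t ^ 2)) ^ 2 := by
    have e : 1 + (4 * t + 2 * (t / (1 - 2 * t))) = (1 + 4 * t - 8 * t ^ 2) / (1 - 2 * t) := by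
      have := hd'.ne'
      rw [eq_div_iff this, add_mul, add_mul, mul_assoc 2, div_mul_cancel₀ _ this]
      ring
    rw [e, div_mul_eq_mul_div, le_div_iff₀ hd', one_mul]
    have h4 : t ^ 3 ≤ (3 / 20) ^ 3 := pow_le_pow_left₀ ht ht' 3
    have h5 : t ^ 4 ≤ (3 / 20) ^ 4 := pow_le_pow_left₀ ht ht' 4
    have h7 : t ^ 7 ≤ (3 / 20) ^ 7 := pow_le_pow_left₀ ht ht' 7
    have h8 : (1 / 20 : ℝ) ^ 2 ≤ (1 / 5 - t) ^ 2 := pow_le_pow_left₀ (by norm_num) (by linarith) 2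
    -- After clearing the denominator, this is the difference of the two sides divided by `t`, with
    -- `2 - 20t + 50t²` written as a square. For `t ≤ 3/20` the square term is at least `1/8`, which
    -- dominates the negative terms.
    have h9 : 0 ≤ 50 * (1 / 5 - t) ^ 2 - 28 * t ^ 3 - 32 * t ^ 4 - 8 * t ^ 7 + 33 * t ^ 5 +
        4 * t ^ 6 := by
      have : 0 ≤ t ^ 5 := by positivity
      have : 0 ≤ t ^ 6 := by positivity
      norm_num at h4 h5 h7 h8
      linarith
    have h10 := mul_nonneg ht h9
    linarith
  refine h3.trans (mul_le_mul_of_nonneg_right (by linarith) (by positivity))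

theorem mainTheorem4 (Λ : Box) (lam del : ℝ) (hlam : 0 < lam) (hdel : 0 < del)
    (Γ Δ D : Set Pt)
    (hΓΛ : Γ ⊆ Λ.carrier) (hΓ : MeasurableSet Γ)
    (hΔΛ : Δ ⊆ Λ.carrier) (hΔ : Δ.Finite) (hΔΓ : Disjoint Δ Γ)
    (hD : Λ.IsLinear D) (hsep : Λ.Separates D Δ Γ)
    (τ τ' α : Pt → ℤˣ)
    (hτ : τ ∈ Λ.spinConfigs Γ) (hτ' : τ' ∈ Λ.spinConfigs Γ) (hα : α ∈ Λ.spinConfigs Δ)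
    (t₁ t₂ : ℝ)
    (ht₁ : t₁ = Λ.wiredConnProb lam del (Δ ∪ Γ) Δ D)
    (ht₂ : t₂ = Real.sqrt (Λ.wiredConnProb lam del (Δ ∪ Γ) D Γ))
    (hden : t₁ + 2 * t₂ < 1)
    (hle : 2 * (t₁ + 2 * t₂ + (t₁ + t₂) / (1 - t₁ - 2 * t₂)) ≤ 1) :
    0 < Λ.spinProb lam del Γ τ' Δ α ∧
      |Λ.spinProb lam del Γ τ Δ α / Λ.spinProb lam del Γ τ' Δ α - 1| ≤
        2 * (t₁ + 2 * t₂ + (t₁ + t₂) / (1 - t₁ - 2 * t₂)) := by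
  have h₁ : 0 ≤ t₁ := ht₁ ▸ ENNReal.toReal_nonneg
  have h₂ : 0 ≤ t₂ := ht₂ ▸ Real.sqrt_nonneg _
  have hsq : t₂ ^ 2 = Λ.wiredConnProb lam del (Δ ∪ Γ) D Γ := by
    rw [ht₂]
    exact Real.sq_sqrt ENNReal.toReal_nonneg
  obtain ⟨hsmall, hmix⟩ := one_le_mul_of_mixing h₁ h₂ hden hle
  have hpos : 0 < 1 - t₂ - t₂ ^ 2 := by nlinarith
  have hc : 0 < (1 - t₂) * (1 - t₂ - t₂ ^ 2) := mul_pos (by linarith) hpos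
  have hDΛ := hD.subset_carrier
  have hgt := Box.toReal_rcInt_not_connSets (W := Δ ∪ Γ) lam del (Set.union_subset hΔΛ hΓΛ)
    hDΛ hΓΛ
  rw [← hsq] at hgt
  obtain ⟨P, hP, hbd⟩ := Box.spinProb_bounds lam del hdel hΓΛ hΔΛ hΔ hΔΓ hDΛ hsep h₂ hpos hgt hα
  obtain ⟨l, u⟩ := hbd τ hτ
  obtain ⟨l', u'⟩ := hbd τ' hτ'
  set c := (1 - t₂) * (1 - t₂ - t₂ ^ 2) with hcdef
  set ε := 2 * (t₁ + 2 * t₂ + (t₁ + t₂) / (1 - t₁ - 2 * t₂)) with hε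
  set x := Λ.spinProb lam del Γ τ Δ α
  set y := Λ.spinProb lam del Γ τ' Δ α
  have hx : 0 < x := lt_of_lt_of_le (mul_pos hc hP) l
  have hy : 0 < y := lt_of_lt_of_le (mul_pos hc hP) l'
  -- Both probabilities are within a factor `c` of `P`, hence within `c²` of each other, and `1 ≤ (1
  -- + ε) c²`.
  have compare : ∀ {x y : ℝ}, 0 < x → c * x ≤ P → c * P ≤ y → x ≤ (1 + ε) * y := by
    intro x y hx hu hl
    have h3 : c ^ 2 * x ≤ y := by
      calc c ^ 2 * x = c * (c * x) := by ring
        _ ≤ c * P := mul_le_mul_of_nonneg_left hu hc.le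
        _ ≤ y := hl
    have hε1 : 0 < 1 + ε := by
      by_contra hcon
      have := mul_nonpos_of_nonpos_of_nonneg (not_lt.1 hcon) (sq_nonneg c)
      linarith
    calc x ≤ ((1 + ε) * c ^ 2) * x := le_mul_of_one_le_left hx.le hmix
      _ = (1 + ε) * (c ^ 2 * x) := by ring
      _ ≤ (1 + ε) * y := mul_le_mul_of_nonneg_left h3 hε1.le
  have hxy := compare hx u l'
  have hyx := compare hy u' l
  have hε0 : 0 ≤ ε := by
    have : 0 ≤ (t₁ + t₂) / (1 - t₁ - 2 * t₂) := div_nonneg (by linarith) (by linarith)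
    linarith
  refine ⟨hy, abs_le.2 ⟨?_, ?_⟩⟩
  -- Exchanging the roles of `τ` and `τ'` gives `y ≤ (1 + ε) x`; then `(1 - ε)(1 + ε) ≤ 1`, where `ε
  -- ≤ 1` keeps the first factor nonnegative.
  · have : 1 - ε ≤ x / y := by
      rw [le_div_iff₀ hy]
      have h6 : (1 - ε) * y ≤ (1 - ε) * ((1 + ε) * x) :=
        mul_le_mul_of_nonneg_left hyx (by linarith)
      nlinarith [mul_nonneg (sq_nonneg ε) hx.le]
    linarith
  · have : x / y ≤ 1 + ε := (div_le_iff₀ hy).2 hxy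
    linarith
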